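/- Let $X$ be a complex Hilbert space, let $(A,D(A))$ be the generator of a strongly continuous semigroup $(S(t))_{t\ge 0}$ on $X$, and let $\eta:[-1,0]\to\mathcal L(X)$ be a function of bounded variation (with respect to the operator norm). Let $\Phi:C([-1,0],X)\to X$ be the bounded linear operator given by the Riemann–Stieltjes integral $$\Phi f=\int_{-1}^0 d\eta\, f .$$ On the space $\mathcal E=X\times L^2([-1,0],X)$ consider the operator $$\mathcal A\begin{pmatrix}x\\ f\end{pmatrix}=\begin{pmatrix}Ax+\Phi f\\ f'\end{pmatrix},\qquad D(\mathcal A)=\Big\{\begin{pmatrix}x\\ f\end{pmatrix}\in D(A)\times W^{1,2}([-1,0],X): f(0)=x\Big\},$$ where $f$ is identified with its continuous representative in $\Phi f$ and $f(0)$. For $\lambda\in\mathbb C$ let $\Phi(\epsilon_\lambda\otimes \mathrm{Id})\in\mathcal L(X)$ denote the operator $x\mapsto \Phi(s\mapsto e^{\lambda s}x)$, and let $R(\lambda,A)=(\lambda-A)^{-1}$. For the generator $G$ of a strongly continuous semigroup $(T(t))_{t\ge0}$, let $$\omega_0(G)=\inf\{\omega\in\mathbb R:\ \exists M>0\ \ \|T(t)\|\le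 Me^{\omega t}\ \ \forall t\ge0\}\in[-\infty,\infty).$$ Suppose $\omega_0(A)<\alpha\le 0$ and $$\sup_{\omega\in\mathbb R}\big\|\Phi(\epsilon_{\alpha+i\omega}\otimes \mathrm{Id})\big\|<\frac{1}{\sup_{\omega\in\mathbb R}\|R(\alpha+i\omega,A)\|}.$$ Then $(\mathcal A,D(\mathcal A))$ generates a strongly continuous semigroup on $\mathcal E$, and $\omega_0(\mathcal A)<\alpha\le 0$. In particular, the semigroup generated by $\mathcal A$ (the delay semigroup) is uniformly exponentially stable, that is, $\omega_0(\mathcal A)<0$. -/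

import Mathlib

open MeasureTheory Set Filter Topology
open scoped NNReal ENNReal

namespace DelayEq

/-! ### Strongly continuous semigroups -/

/-- A strongly continuous semigroup (`C₀`-semigroup) of bounded linear operators on `E`. -/
structure C0Semigroup (E : Type*) [NormedAddCommGroup E] [NormedSpace ℂ E] where
  /-- the operator at time `t` -/
  op : ℝ≥0 → E →L[ℂ] E
  op_zero : op 0 = ContinuousLinearMap.id ℂ E
  op_add : ∀ s t : ℝ≥0, op (s + t) = (op s).comp (op t)
  continuous_orbit : ∀ x : E, Continuous fun t : ℝ≥0 => op t x

namespace C0Semigroup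

variable {E : Type*} [NormedAddCommGroup E] [NormedSpace ℂ E]

/-- `G` is the (infinitesimal) generator of `T`: a vector `x` lies in `D(G)` with `G x = y`
exactly if the difference quotients `(T(h)x - x)/h` converge to `y` as `h ↓ 0`. -/
def IsGeneratedBy (T : C0Semigroup E) (G : E →ₗ.[ℂ] E) : Prop :=
  ∀ x y : E, (x, y) ∈ G.graph ↔
    Tendsto (fun h : ℝ≥0 => ((h : ℝ) : ℂ)⁻¹ • (T.op h x - x)) (𝓝[>] 0) (𝓝 y)

/-- The uniform growth bound `ω₀`, with values in `[-∞, ∞]`. -/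
noncomputable def growthBound (T : C0Semigroup E) : EReal :=
  sInf ((fun w : ℝ => (w : EReal)) ''
    {w : ℝ | ∃ M : ℝ, 0 < M ∧ ∀ t : ℝ≥0, ‖T.op t‖ ≤ M * Real.exp (w * t)})

/-- Uniform exponential stability: the growth bound is negative. -/
def UniformlyExponentiallyStable (T : C0Semigroup E) : Prop :=
  T.growthBound < 0

end C0Semigroup

/-! ### Resolvents of unbounded operators -/

section Resolvent

variable {X : Type*} [NormedAddCommGroup X] [NormedSpace ℂ X]

/-- `R` is a bounded two-sided inverse of `z - A : D(A) → X`. -/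
def IsResolventAt (A : X →ₗ.[ℂ] X) (z : ℂ) (R : X →L[ℂ] X) : Prop :=
  (∀ y : X, ∃ h : R y ∈ A.domain, z • R y - A ⟨R y, h⟩ = y) ∧
    ∀ x : A.domain, R (z • (x : X) - A x) = x

open scoped Classical in
/-- The resolvent `R(z, A) = (z - A)⁻¹` (and `0` by convention outside the resolvent set). -/
noncomputable def resolventOp (A : X →ₗ.[ℂ] X) (z : ℂ) : X →L[ℂ] X :=
  if h : ∃ R : X →L[ℂ] X, IsResolventAt A z R then h.choose else 0

theorem IsResolventAt.unique {A : X →ₗ.[ℂ] X} {z : ℂ} {R R' : X →L[ℂ] X}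
    (h : IsResolventAt A z R) (h' : IsResolventAt A z R') : R = R' := by
  ext y
  obtain ⟨hy, e⟩ := h.1 y
  have := h'.2 ⟨R y, hy⟩
  simp only [e] at this
  exact this.symm

theorem IsResolventAt.eq_resolventOp {A : X →ₗ.[ℂ] X} {z : ℂ} {R : X →L[ℂ] X}
    (h : IsResolventAt A z R) : resolventOp A z = R := by
  have hex : ∃ R : X →L[ℂ] X, IsResolventAt A z R := ⟨R, h⟩
  rw [resolventOp, dif_pos hex]
  exact hex.choose_spec.unique h

end Resolvent

/-! ### Riemann-Stieltjes integrals over `[-1, 0]` -/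

/-- A tagged partition `-1 = pt 0 ≤ tag 0 ≤ pt 1 ≤ tag 1 ≤ ⋯ ≤ pt n = 0` of `[-1, 0]`.
(The points `pt k` with `k > n` are irrelevant and set to `0`; so are the tags with `k ≥ n`.) -/
structure TaggedPartition where
  /-- number of subintervals -/
  n : ℕ
  /-- partition points -/
  pt : ℕ → ℝ
  /-- tags -/
  tag : ℕ → Icc (-1 : ℝ) 0
  mono : Monotone pt
  pt_zero : pt 0 = -1
  pt_last : ∀ k, n ≤ k → pt k = 0
  tag_mem : ∀ k, k < n → (tag k : ℝ) ∈ Icc (pt k) (pt (k + 1))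

namespace TaggedPartition

theorem pt_mem (P : TaggedPartition) (k : ℕ) : P.pt k ∈ Icc (-1 : ℝ) 0 := by
  constructor
  · rw [← P.pt_zero]; exact P.mono (Nat.zero_le k)
  · rw [← P.pt_last (max k P.n) (le_max_right _ _)]; exact P.mono (le_max_left _ _)

/-- Tagged partitions all of whose subintervals are shorter than `δ`. -/
def finer (δ : ℝ) : Set TaggedPartition :=
  {P | ∀ k, k < P.n → P.pt (k + 1) - P.pt k < δ}

/-- The filter "mesh tends to zero" on tagged partitions. -/
def meshFilter : Filter TaggedPartition :=
  ⨅ δ : Ioi (0 : ℝ), 𝓟 (finer δ)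

theorem hasBasis_meshFilter : meshFilter.HasBasis (fun δ : ℝ => 0 < δ) finer := by
  have : Nonempty (Ioi (0 : ℝ)) := ⟨⟨1, by simp⟩⟩
  refine ⟨fun s => ?_⟩
  rw [meshFilter, mem_iInf_of_directed]
  · constructor
    · rintro ⟨δ, h⟩; exact ⟨δ, δ.2, h⟩
    · rintro ⟨δ, h, h'⟩; exact ⟨⟨δ, h⟩, h'⟩
  · intro a b
    refine ⟨⟨min (a : ℝ) b, mem_Ioi.2 (lt_min a.2 b.2)⟩, ?_, ?_⟩ <;> simp only [ge_iff_le, le_principal_iff, mem_principal]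
    · exact fun P hP k hk => (hP k hk).trans_le (min_le_left _ _)
    · exact fun P hP k hk => (hP k hk).trans_le (min_le_right _ _)

theorem finer_nonempty {δ : ℝ} (hδ : 0 < δ) : (finer δ).Nonempty := by
  obtain ⟨N, hN⟩ := exists_nat_one_div_lt hδ
  have hN0 : (0 : ℝ) < N + 1 := by positivity
  have hm : ∀ k : ℕ, min (-1 + (k : ℝ) / (N + 1)) 0 ∈ Icc (-1 : ℝ) 0 := fun k =>
    ⟨le_min (by have : 0 ≤ (k : ℝ) / (N + 1) := by positivity
                linarith) (by norm_num), min_le_right _ _⟩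
  have hmono : Monotone fun k : ℕ => min (-1 + (k : ℝ) / (N + 1)) 0 := by
    intro a b hab
    have hab' : (a : ℝ) ≤ b := by exact_mod_cast hab
    dsimp only
    gcongr
  refine ⟨⟨N + 1, fun k => min (-1 + (k : ℝ) / (N + 1)) 0, fun k => ⟨_, hm k⟩, hmono, by simp,
    ?_, fun k _ => ⟨le_rfl, hmono (Nat.le_succ k)⟩⟩, ?_⟩
  · intro k hk
    have hk' : (N : ℝ) + 1 ≤ k := by exact_mod_cast hk
    have : 1 ≤ (k : ℝ) / (N + 1) := by rwa [le_div_iff₀ hN0, one_mul]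
    exact min_eq_right (by linarith)
  · intro k hk
    have hk' : (k : ℝ) + 1 ≤ N + 1 := by exact_mod_cast hk
    have h1 : ((k : ℝ) + 1) / (N + 1) ≤ 1 := by rwa [div_le_one hN0]
    have h2 : ((k : ℝ) + 1) / (N + 1) = (k : ℝ) / (N + 1) + 1 / (N + 1) := by ring
    have h3 : 0 < 1 / ((N : ℝ) + 1) := by positivity
    dsimp only
    push_cast
    rw [min_eq_left (by linarith), min_eq_left (by linarith)]
    linarith

instance : meshFilter.NeBot :=
  hasBasis_meshFilter.neBot_iff.2 fun h => finer_nonempty h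

end TaggedPartition

open TaggedPartition

section Stieltjes

variable {X : Type*} [NormedAddCommGroup X] [NormedSpace ℂ X]

/-- The Riemann-Stieltjes sum `∑ₖ (η(tₖ₊₁) - η(tₖ)) f(sₖ)`. -/
noncomputable def rsSum (η : ℝ → X →L[ℂ] X) (f : C(Icc (-1 : ℝ) 0, X)) (P : TaggedPartition) : X :=
  ∑ k ∈ Finset.range P.n, (η (P.pt (k + 1)) - η (P.pt k)) (f (P.tag k))

/-- The Riemann-Stieltjes integral `∫_{-1}^0 dη f`: limit of the Riemann-Stieltjes sums as the
mesh tends to zero. -/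
noncomputable def rsIntegral (η : ℝ → X →L[ℂ] X) (f : C(Icc (-1 : ℝ) 0, X)) : X :=
  limUnder meshFilter (rsSum η f)

theorem sum_variation_le {η : ℝ → X →L[ℂ] X} (hη : BoundedVariationOn η (Icc (-1 : ℝ) 0))
    {u : ℕ → ℝ} (hu : Monotone u) (hI : ∀ k, u k ∈ Icc (-1 : ℝ) 0) (n : ℕ) :
    ∑ k ∈ Finset.range n, ‖η (u (k + 1)) - η (u k)‖ ≤ (eVariationOn η (Icc (-1 : ℝ) 0)).toReal := by
  have h := eVariationOn.sum_le (f := η) (n := n) hu hI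
  have h2 := ENNReal.toReal_mono hη h
  rw [ENNReal.toReal_sum (fun _ _ => edist_ne_top _ _)] at h2
  simpa [edist_dist, dist_eq_norm] using h2

theorem norm_rsSum_le {η : ℝ → X →L[ℂ] X} (hη : BoundedVariationOn η (Icc (-1 : ℝ) 0))
    (f : C(Icc (-1 : ℝ) 0, X)) (P : TaggedPartition) :
    ‖rsSum η f P‖ ≤ (eVariationOn η (Icc (-1 : ℝ) 0)).toReal * ‖f‖ := by
  calc ‖rsSum η f P‖ ≤ ∑ k ∈ Finset.range P.n, ‖η (P.pt (k + 1)) - η (P.pt k)‖ * ‖f‖ := by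
        refine norm_sum_le_of_le _ fun k _ => ?_
        exact (ContinuousLinearMap.le_opNorm _ _).trans (by gcongr; exact f.norm_coe_le_norm _)
    _ ≤ _ := by
        rw [← Finset.sum_mul]
        gcongr
        exact sum_variation_le hη P.mono P.pt_mem _

/-- Clamping of `x` to the interval `[a, b]`. -/
noncomputable def clamp (a b x : ℝ) : ℝ := max a (min b x)

theorem sum_clamp_telescope (η : ℝ → X →L[ℂ] X) (Q : TaggedPartition) {a b : ℝ}
    (ha : -1 ≤ a) (hab : a ≤ b) (hb : b ≤ 0) :
    ∑ j ∈ Finset.range Q.n, (η (clamp a b (Q.pt (j + 1))) - η (clamp a b (Q.pt j))) =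
      η b - η a := by
  rw [Finset.sum_range_sub (fun j => η (clamp a b (Q.pt j))), Q.pt_zero, Q.pt_last _ le_rfl]
  simp [clamp, hab, hb, ha, ha.trans hab]

theorem clamp_symm (η : ℝ → X →L[ℂ] X) {a b c d : ℝ} (hab : a ≤ b) (hcd : c ≤ d) :
    η (clamp a b d) - η (clamp a b c) = η (clamp c d b) - η (clamp c d a) := by
  unfold clamp
  rcases le_total a c with h1 | h1 <;> rcases le_total b d with h2 | h2 <;>
  rcases le_total b c with h3 | h3 <;> rcases le_total a d with h4 | h4 <;>
  grind

theorem clamp_eq_of_not_overlap {a b c d : ℝ} (hab : a ≤ b) (hcd : c ≤ d)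
    (h : d ≤ a ∨ b ≤ c) : clamp a b d = clamp a b c := by
  unfold clamp
  rcases h with h | h
  · rw [min_eq_right (h.trans hab), min_eq_right ((hcd.trans h).trans hab), max_eq_left h,
      max_eq_left (hcd.trans h)]
  · rw [min_eq_left h, min_eq_left (h.trans hcd)]

theorem norm_rsSum_sub_le {η : ℝ → X →L[ℂ] X} (hη : BoundedVariationOn η (Icc (-1 : ℝ) 0))
    (f : C(Icc (-1 : ℝ) 0, X)) {ε δ : ℝ} (hε : 0 ≤ ε)
    (hf : ∀ s t : Icc (-1 : ℝ) 0, dist s t < 2 * δ → ‖f s - f t‖ ≤ ε)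
    {P Q : TaggedPartition} (hP : P ∈ finer δ) (hQ : Q ∈ finer δ) :
    ‖rsSum η f P - rsSum η f Q‖ ≤ (eVariationOn η (Icc (-1 : ℝ) 0)).toReal * ε := by
  set D : ℕ → ℕ → X →L[ℂ] X := fun i j =>
    η (clamp (P.pt i) (P.pt (i + 1)) (Q.pt (j + 1))) - η (clamp (P.pt i) (P.pt (i + 1)) (Q.pt j))
    with hD
  have hPD : rsSum η f P =
      ∑ i ∈ Finset.range P.n, ∑ j ∈ Finset.range Q.n, D i j (f (P.tag i)) := by
    unfold rsSum
    refine Finset.sum_congr rfl fun i _ => ?_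
    rw [← sum_clamp_telescope η Q (P.pt_mem i).1 (P.mono (Nat.le_succ i)) (P.pt_mem (i + 1)).2,
      sum_apply]
  have hQD : rsSum η f Q =
      ∑ i ∈ Finset.range P.n, ∑ j ∈ Finset.range Q.n, D i j (f (Q.tag j)) := by
    rw [Finset.sum_comm]
    unfold rsSum
    refine Finset.sum_congr rfl fun j _ => ?_
    rw [← sum_clamp_telescope η P (Q.pt_mem j).1 (Q.mono (Nat.le_succ j)) (Q.pt_mem (j + 1)).2,
      sum_apply]
    refine Finset.sum_congr rfl fun i _ => ?_
    rw [hD, clamp_symm η (Q.mono (Nat.le_succ j)) (P.mono (Nat.le_succ i))]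
  have hkey : ∀ i < P.n, ∀ j < Q.n, ‖D i j (f (P.tag i)) - D i j (f (Q.tag j))‖ ≤ ‖D i j‖ * ε := by
    intro i hi j hj
    by_cases ho : Q.pt (j + 1) ≤ P.pt i ∨ P.pt (i + 1) ≤ Q.pt j
    · have : D i j = 0 := by
        rw [hD]
        dsimp only
        rw [clamp_eq_of_not_overlap (P.mono (Nat.le_succ i)) (Q.mono (Nat.le_succ j)) ho, sub_self]
      simp [this]
    · push Not at ho
      rw [← map_sub]
      refine (ContinuousLinearMap.le_opNorm _ _).trans ?_
      gcongr
      apply hf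
      have h1 := P.tag_mem i hi
      have h2 := Q.tag_mem j hj
      have h3 := hP i hi
      have h4 := hQ j hj
      rw [Subtype.dist_eq, Real.dist_eq, abs_lt]
      constructor <;> linarith [h1.1, h1.2, h2.1, h2.2, ho.1, ho.2]
  rw [hPD, hQD, ← Finset.sum_sub_distrib]
  simp_rw [← Finset.sum_sub_distrib]
  calc ‖∑ i ∈ Finset.range P.n, ∑ j ∈ Finset.range Q.n,
          (D i j (f (P.tag i)) - D i j (f (Q.tag j)))‖
      ≤ ∑ i ∈ Finset.range P.n, ∑ j ∈ Finset.range Q.n, ‖D i j‖ * ε :=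
        norm_sum_le_of_le _ fun i hi => norm_sum_le_of_le _ fun j hj =>
          hkey i (Finset.mem_range.1 hi) j (Finset.mem_range.1 hj)
    _ = (∑ i ∈ Finset.range P.n, ∑ j ∈ Finset.range Q.n, ‖D i j‖) * ε := by
        simp_rw [Finset.sum_mul]
    _ ≤ _ := by
        gcongr
        have hv : ∀ i, ∑ j ∈ Finset.range Q.n, ‖D i j‖ ≤
            (eVariationOn η (Icc (P.pt i) (P.pt (i + 1)))).toReal := by
          intro i
          have hi := P.mono (Nat.le_succ i)
          have hfin : eVariationOn η (Icc (P.pt i) (P.pt (i + 1))) ≠ ⊤ :=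
            hη.mono (Icc_subset_Icc (P.pt_mem i).1 (P.pt_mem (i + 1)).2)
          have hu : Monotone fun j => clamp (P.pt i) (P.pt (i + 1)) (Q.pt j) := fun a b hab =>
            max_le_max le_rfl (min_le_min le_rfl (Q.mono hab))
          have hI : ∀ j, clamp (P.pt i) (P.pt (i + 1)) (Q.pt j) ∈
              Icc (P.pt i) (P.pt (i + 1)) := fun j =>
            ⟨le_max_left _ _, max_le hi (min_le_left _ _)⟩
          have h2 := ENNReal.toReal_mono hfin (eVariationOn.sum_le (f := η) (n := Q.n) hu hI)
          rw [ENNReal.toReal_sum (fun _ _ => edist_ne_top _ _)] at h2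
          simpa [hD, edist_dist, dist_eq_norm] using h2
        refine (Finset.sum_le_sum fun i _ => hv i).trans ?_
        rw [← ENNReal.toReal_sum]
        · apply ENNReal.toReal_mono hη
          rw [eVariationOn.sum' η P.mono]
          exact eVariationOn.mono _ (Icc_subset_Icc (P.pt_mem 0).1 (P.pt_mem _).2)
        · intro i _
          exact hη.mono (Icc_subset_Icc (P.pt_mem i).1 (P.pt_mem (i + 1)).2)

/-- The Riemann-Stieltjes sums of a continuous function against an integrator of bounded variation
converge to the Riemann-Stieltjes integral. -/
theorem tendsto_rsSum [CompleteSpace X] {η : ℝ → X →L[ℂ] X}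
    (hη : BoundedVariationOn η (Icc (-1 : ℝ) 0)) (f : C(Icc (-1 : ℝ) 0, X)) :
    Tendsto (rsSum η f) meshFilter (𝓝 (rsIntegral η f)) := by
  apply tendsto_nhds_limUnder
  apply cauchy_map_iff_exists_tendsto.1
  rw [Metric.uniformity_basis_dist.cauchy_iff]
  refine ⟨inferInstance, fun ε hε => ?_⟩
  set V := (eVariationOn η (Icc (-1 : ℝ) 0)).toReal
  have hV : 0 ≤ V := ENNReal.toReal_nonneg
  obtain ⟨δ, hδ, h⟩ := Metric.uniformContinuous_iff.1
    (CompactSpace.uniformContinuous_of_continuous f.continuous) (ε / (V + 1)) (by positivity)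
  refine ⟨_, image_mem_map (hasBasis_meshFilter.mem_of_mem (half_pos hδ)), ?_⟩
  rintro _ ⟨P, hP, rfl⟩ _ ⟨Q, hQ, rfl⟩
  have hle := norm_rsSum_sub_le hη f (ε := ε / (V + 1)) (δ := δ / 2) (by positivity)
    (fun s t hst => by
      rw [← dist_eq_norm]; exact (h (by linarith)).le) hP hQ
  change dist (rsSum η f P) (rsSum η f Q) < ε
  rw [dist_eq_norm]
  refine hle.trans_lt ?_
  change V * (ε / (V + 1)) < ε
  rw [mul_div_assoc', div_lt_iff₀ (by positivity)]
  nlinarith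

/-- The bounded linear operator `Φ f = ∫_{-1}^0 dη f` on `C([-1,0], X)`. -/
noncomputable def stieltjesOp [CompleteSpace X] (η : ℝ → X →L[ℂ] X)
    (hη : BoundedVariationOn η (Icc (-1 : ℝ) 0)) : C(Icc (-1 : ℝ) 0, X) →L[ℂ] X :=
  LinearMap.mkContinuous
    { toFun := rsIntegral η
      map_add' := fun f g => by
        refine tendsto_nhds_unique (tendsto_rsSum hη (f + g)) ?_
        refine ((tendsto_rsSum hη f).add (tendsto_rsSum hη g)).congr fun P => ?_
        simp only [rsSum, ContinuousMap.add_apply, map_add, Finset.sum_add_distrib]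
      map_smul' := fun c f => by
        refine tendsto_nhds_unique (tendsto_rsSum hη (c • f)) ?_
        refine ((tendsto_rsSum hη f).const_smul c).congr fun P => ?_
        simp only [rsSum, ContinuousMap.smul_apply, map_smul, Finset.smul_sum] }
    (eVariationOn η (Icc (-1 : ℝ) 0)).toReal
    fun f => le_of_tendsto (tendsto_rsSum hη f).norm (Eventually.of_forall (norm_rsSum_le hη f))

/-- The operator `ε_z ⊗ Id : X → C([-1,0], X)`, mapping `x` to the function `s ↦ e^{z s} x`. -/
noncomputable def expTensor (X : Type*) [NormedAddCommGroup X] [NormedSpace ℂ X] (z : ℂ) :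
    X →L[ℂ] C(Icc (-1 : ℝ) 0, X) :=
  LinearMap.mkContinuous
    { toFun := fun x => ⟨fun s => Complex.exp (z * ((s : ℝ) : ℂ)) • x, by fun_prop⟩
      map_add' := fun x y => by ext s; simp
      map_smul' := fun c x => by ext s; exact smul_comm _ c x }
    (Real.exp ‖z‖)
    fun x => by
      rw [ContinuousMap.norm_le _ (by positivity)]
      intro s
      simp only [LinearMap.coe_mk, AddHom.coe_mk, ContinuousMap.coe_mk, norm_smul]
      gcongr
      refine (Complex.norm_exp_le_exp_norm _).trans (Real.exp_le_exp.2 ?_)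
      rw [norm_mul, Complex.norm_real, Real.norm_eq_abs]
      exact mul_le_of_le_one_right (norm_nonneg _)
        (abs_le.2 ⟨s.2.1, s.2.2.trans zero_le_one⟩)

end Stieltjes

/-! ### The delay operator matrix -/

/-- Lebesgue measure on `[-1, 0]`. -/
noncomputable abbrev delayMeasure : Measure ℝ := volume.restrict (Icc (-1 : ℝ) 0)

open scoped ContDiff in
/-- `g` is the weak derivative of `f` on the interval `(-1, 0)`. -/
def IsWeakDeriv {X : Type*} [NormedAddCommGroup X] [NormedSpace ℝ X] (f g : ℝ → X) : Prop :=
  ∀ φ : ℝ → ℝ, ContDiff ℝ ∞ φ → HasCompactSupport φ → tsupport φ ⊆ Ioo (-1) 0 →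
    ∫ s in Icc (-1 : ℝ) 0, deriv φ s • f s = -∫ s in Icc (-1 : ℝ) 0, φ s • g s

section Matrix

variable {X : Type*} [NormedAddCommGroup X] [InnerProductSpace ℂ X]

/-- The Hilbert space `X × L²([-1,0], X)`. -/
abbrev DelaySpace (X : Type*) [NormedAddCommGroup X] [InnerProductSpace ℂ X] : Type _ :=
  WithLp 2 (X × Lp X 2 delayMeasure)

/-- `F` is the continuous representative of `f ∈ L²([-1,0], X)`. -/
def IsContRep {X : Type*} [NormedAddCommGroup X] (f : Lp X 2 delayMeasure) (F : C(Icc (-1 : ℝ) 0, X)) : Prop :=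
  f =ᵐ[delayMeasure] IccExtend (by norm_num : (-1 : ℝ) ≤ 0) F

theorem integrable_smul_Lp (φ : ℝ → ℝ) (hφ : Continuous φ) (f : Lp X 2 delayMeasure) :
    IntegrableOn (fun s => φ s • f s) (Icc (-1 : ℝ) 0) := by
  have hf : IntegrableOn f (Icc (-1 : ℝ) 0) :=
    (Lp.memLp f).integrable (by norm_num)
  exact hf.continuousOn_smul hφ.continuousOn isCompact_Icc

/-- The graph of the delay operator matrix: the pairs `((x, f), (A x + Φ f, f'))` with
`x ∈ D(A)`, `f ∈ W^{1,2}([-1,0], X)` and `f(0) = x`; `Φ` and the evaluation at `0` are applied to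
the continuous representative of `f`. -/
def delayGraph (A : X →ₗ.[ℂ] X) (Φ : C(Icc (-1 : ℝ) 0, X) →L[ℂ] X) :
    Submodule ℂ (DelaySpace X × DelaySpace X) where
  carrier := {q | ∃ (x : A.domain) (F : C(Icc (-1 : ℝ) 0, X)),
    q.1.fst = x ∧ IsContRep q.1.snd F ∧ F ⟨0, by norm_num⟩ = x ∧
      q.2.fst = A x + Φ F ∧ IsWeakDeriv q.1.snd q.2.snd}
  zero_mem' := by
    refine ⟨0, 0, by simp, ?_, by simp, by simp, ?_⟩
    · exact (Lp.coeFn_zero X 2 delayMeasure).trans (Eventually.of_forall fun s => by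
        simp [IccExtend])
    · intro φ _ _ _
      have h0 := Lp.coeFn_zero X 2 delayMeasure
      have key : ∀ ψ : ℝ → ℝ, ∫ s in Icc (-1 : ℝ) 0, ψ s • (0 : Lp X 2 delayMeasure) s = 0 := by
        intro ψ
        rw [integral_congr_ae (g := fun _ => (0 : X)), integral_zero]
        filter_upwards [h0] with s hs
        rw [hs, Pi.zero_apply, smul_zero]
      exact (key _).trans (by rw [← neg_zero]; exact congrArg _ (key φ).symm)
  add_mem' := by
    rintro ⟨u, v⟩ ⟨u', v'⟩ ⟨x, F, h1, h2, h3, h4, h5⟩ ⟨x', F', h1', h2', h3', h4', h5'⟩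
    dsimp only at *
    refine ⟨x + x', F + F', by simp [h1, h1'], ?_, by simp [h3, h3'], ?_, ?_⟩
    · filter_upwards [Lp.coeFn_add u.snd u'.snd, h2, h2'] with s hs hs1 hs2
      simp only [Prod.fst_add, WithLp.add_snd]
      rw [hs, Pi.add_apply, hs1, hs2]
      simp [IccExtend]
    · simp only [Prod.snd_add, WithLp.add_fst, h4, h4', map_add, LinearPMap.map_add]; abel
    · intro φ hφ hc hs
      have hφ' : Continuous (deriv φ) := hφ.continuous_deriv (by simp)
      have e1 : ∫ s in Icc (-1 : ℝ) 0, deriv φ s • (u + u').snd s =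
          ∫ s in Icc (-1 : ℝ) 0, (deriv φ s • u.snd s + deriv φ s • u'.snd s) := by
        refine integral_congr_ae ?_
        filter_upwards [Lp.coeFn_add u.snd u'.snd] with s hs
        rw [WithLp.add_snd, hs, Pi.add_apply, smul_add]
      have e2 : ∫ s in Icc (-1 : ℝ) 0, φ s • (v + v').snd s =
          ∫ s in Icc (-1 : ℝ) 0, (φ s • v.snd s + φ s • v'.snd s) := by
        refine integral_congr_ae ?_
        filter_upwards [Lp.coeFn_add v.snd v'.snd] with s hs
        rw [WithLp.add_snd, hs, Pi.add_apply, smul_add]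
      simp only [Prod.fst_add, Prod.snd_add]
      rw [e1, e2, integral_add (integrable_smul_Lp _ hφ' _) (integrable_smul_Lp _ hφ' _),
        integral_add (integrable_smul_Lp _ hφ.continuous _)
          (integrable_smul_Lp _ hφ.continuous _), h5 φ hφ hc hs, h5' φ hφ hc hs]
      abel
  smul_mem' := by
    rintro c ⟨u, v⟩ ⟨x, F, h1, h2, h3, h4, h5⟩
    dsimp only at *
    refine ⟨c • x, c • F, by simp [h1], ?_, by simp [h3], ?_, ?_⟩
    · filter_upwards [Lp.coeFn_smul c u.snd, h2] with s hs hs1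
      simp only [Prod.smul_fst, WithLp.smul_snd]
      rw [hs, Pi.smul_apply, hs1]
      simp [IccExtend]
    · simp only [Prod.smul_snd, WithLp.smul_fst, h4, LinearPMap.map_smul, map_smul, smul_add]
    · intro φ hφ hc hs
      have e1 : ∫ s in Icc (-1 : ℝ) 0, deriv φ s • (c • u).snd s =
          ∫ s in Icc (-1 : ℝ) 0, c • (deriv φ s • u.snd s) := by
        refine integral_congr_ae ?_
        filter_upwards [Lp.coeFn_smul c u.snd] with s hs
        rw [WithLp.smul_snd, hs, Pi.smul_apply, smul_comm]
      have e2 : ∫ s in Icc (-1 : ℝ) 0, φ s • (c • v).snd s =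
          ∫ s in Icc (-1 : ℝ) 0, c • (φ s • v.snd s) := by
        refine integral_congr_ae ?_
        filter_upwards [Lp.coeFn_smul c v.snd] with s hs
        rw [WithLp.smul_snd, hs, Pi.smul_apply, smul_comm]
      simp only [Prod.smul_fst, Prod.smul_snd]
      rw [e1, e2, integral_smul, integral_smul, h5 φ hφ hc hs, smul_neg]

theorem IsContRep.eq_zero {X : Type*} [NormedAddCommGroup X] {F : C(Icc (-1 : ℝ) 0, X)}
    (h : IsContRep (0 : Lp X 2 delayMeasure) F) : F = 0 := by
  have h0 : IccExtend (by norm_num : (-1 : ℝ) ≤ 0) F =ᵐ[delayMeasure] fun _ => (0 : X) :=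
    h.symm.trans (Lp.coeFn_zero X 2 delayMeasure)
  have h1 := Measure.eqOn_Icc_of_ae_eq (μ := volume) (by norm_num : (-1 : ℝ) ≠ 0) h0
    F.continuous.Icc_extend'.continuousOn continuousOn_const
  ext s
  simpa [IccExtend_of_mem _ _ s.2] using h1 s.2

theorem IsWeakDeriv.eq_zero [CompleteSpace X] {g : Lp X 2 delayMeasure}
    (h : IsWeakDeriv (0 : Lp X 2 delayMeasure) g) : g = 0 := by
  have hg : IntegrableOn g (Icc (-1 : ℝ) 0) := (Lp.memLp g).integrable (by norm_num)
  have key : ∀ᵐ s ∂(volume : Measure ℝ), s ∈ Ioo (-1 : ℝ) 0 → g s = 0 := by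
    refine isOpen_Ioo.ae_eq_zero_of_integral_contDiff_smul_eq_zero
      (hg.mono_set Ioo_subset_Icc_self).locallyIntegrableOn fun φ hφ hc hs => ?_
    have h1 := h φ hφ hc hs
    have e : ∫ s in Icc (-1 : ℝ) 0, deriv φ s • (0 : Lp X 2 delayMeasure) s = 0 := by
      rw [integral_congr_ae (g := fun _ => (0 : X))]
      · simp
      · filter_upwards [Lp.coeFn_zero X 2 delayMeasure] with s hs
        rw [hs, Pi.zero_apply, smul_zero]
    rw [e, eq_comm, neg_eq_zero, setIntegral_eq_integral_of_forall_compl_eq_zero] at h1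
    · exact h1
    · intro s hsI
      have : φ s = 0 := image_eq_zero_of_notMem_tsupport fun hsφ =>
        hsI (Ioo_subset_Icc_self (hs hsφ))
      simp [this]
  refine Lp.ext ?_
  have h3 : g =ᵐ[delayMeasure] fun _ => (0 : X) := by
    change ∀ᵐ s ∂(volume.restrict (Icc (-1 : ℝ) 0)), g s = 0
    rw [← Measure.restrict_congr_set (Ioo_ae_eq_Icc (μ := volume) (a := (-1 : ℝ)) (b := 0))]
    exact (ae_restrict_iff' measurableSet_Ioo).2 key
  exact h3.trans (Lp.coeFn_zero X 2 delayMeasure).symm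

theorem delayGraph_single_valued [CompleteSpace X] (A : X →ₗ.[ℂ] X)
    (Φ : C(Icc (-1 : ℝ) 0, X) →L[ℂ] X) :
    ∀ q ∈ delayGraph A Φ, q.1 = 0 → q.2 = 0 := by
  rintro ⟨u, v⟩ ⟨x, F, h1, h2, h3, h4, h5⟩ hu
  dsimp only at *
  subst hu
  have hx : x = 0 := by ext; simpa using h1.symm
  have hF : F = 0 := IsContRep.eq_zero (by simpa using h2)
  have hg : v.snd = 0 := IsWeakDeriv.eq_zero (by simpa using h5)
  have hv : v.fst = 0 := by simpa [hx, hF] using h4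
  refine WithLp.ofLp_injective 2 (Prod.ext ?_ ?_)
  · exact hv
  · exact hg

/-- The delay operator matrix `𝒜 (x, f) = (A x + Φ f, f')` with domain
`{(x, f) ∈ D(A) × W^{1,2}([-1,0], X) : f(0) = x}`. -/
noncomputable def delayMatrix (A : X →ₗ.[ℂ] X) (Φ : C(Icc (-1 : ℝ) 0, X) →L[ℂ] X) :
    DelaySpace X →ₗ.[ℂ] DelaySpace X :=
  (delayGraph A Φ).toLinearPMap

/-- The graph of the delay operator matrix is as prescribed. -/
theorem delayMatrix_graph [CompleteSpace X] (A : X →ₗ.[ℂ] X)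
    (Φ : C(Icc (-1 : ℝ) 0, X) →L[ℂ] X) :
    (delayMatrix A Φ).graph = delayGraph A Φ :=
  Submodule.toLinearPMap_graph_eq _ (delayGraph_single_valued A Φ)

end Matrix

end DelayEq

/-!
The delay semigroup is built from its orbits. Assume first that the smallness condition holds on the
imaginary axis and that the semigroup `S` generated by `A` decays exponentially. A mild solution with
initial value `x` and history `f` is a function `v` on the line which equals `f` on `[-1, 0]`, is zero
before, and satisfies on the half-line the variation of constants formula `v = σ x + K (1_{t ≥ 0} N v)`
in `L²(ℝ, X)`, where `σ x = S(·) x`, `K` is convolution with `S` and `(N v)(t) = Φ(v_t)`.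

Both `K` and `N` are Fourier multipliers, with symbols `R(iω, A)` and `Φ(ε_{iω} ⊗ Id)`. As `X` is a
Hilbert space, Plancherel's theorem bounds their norms by the suprema of the symbols
(`norm_fourierMul_le`), so the hypothesis says that `‖K N‖ < 1`. A Neumann series then solves the
equation in the space `L²(ℝ, X)` itself (`StableDelay.sol`), and causality shows that the value and
the history of the solution at time `t` form a bounded strongly continuous semigroup
(`StableDelay.semigroup`).

Its generator is identified through its resolvent: for `b > 0` the Laplace transform of the semigroup
is a right inverse of `b - 𝒜` (`StableDelay.laplace_mem_delayGraph`), and for large `b` the operator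
`b - 𝒜` is injective (`StableDelay.eq_zero_of_mem_delayGraph`).

The general case is obtained by exponential weights. The similarity `(x, f) ↦ (x, e^{β·} f)` carries
the problem on the line `Re z = β` to the imaginary axis (`expWeight_mem_delayGraph`), so that the
condition on `Re z = β` yields a delay semigroup of growth `e^{βt}`
(`exists_isGeneratedBy_delayMatrix`). The strict inequality on `Re z = α` persists on a line
`Re z = β` with `β < α` by the resolvent identity (`exists_shift_smallness`), whence a growth bound
strictly below `α`. As a semigroup is determined by its generator (`C0Semigroup.HasGrowth.ext`), this
holds for every semigroup generated by `𝒜`.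
-/

namespace DelayEq

/-! ### Laplace transforms and generators of semigroups -/

namespace C0Semigroup

variable {E : Type*} [NormedAddCommGroup E] [NormedSpace ℂ E]

/-- The pair `(x, y)` belongs to the graph of the generator of `T`. Generators are handled as this
relation, without reference to a partially defined operator. -/
def IsGenPair (T : C0Semigroup E) (x y : E) : Prop :=
  Tendsto (fun h : ℝ≥0 => ((h : ℝ) : ℂ)⁻¹ • (T.op h x - x)) (𝓝[>] 0) (𝓝 y)

theorem IsGenPair.unique {T : C0Semigroup E} {x y y' : E} (h : T.IsGenPair x y)
    (h' : T.IsGenPair x y') : y = y' :=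
  tendsto_nhds_unique h h'

theorem op_comm (T : C0Semigroup E) (s t : ℝ≥0) (x : E) :
    T.op s (T.op t x) = T.op t (T.op s x) := by
  rw [← ContinuousLinearMap.comp_apply, ← T.op_add, add_comm, T.op_add]; rfl

theorem continuous_real_orbit (T : C0Semigroup E) (x : E) :
    Continuous fun r : ℝ => T.op r.toNNReal x :=
  (T.continuous_orbit x).comp continuous_real_toNNReal

/-- The growth estimate `‖T(t)‖ ≤ M e^{wt}`. The sign of `M` is not prescribed. -/
def HasGrowth (T : C0Semigroup E) (M w : ℝ) : Prop :=
  ∀ t : ℝ≥0, ‖T.op t‖ ≤ M * Real.exp (w * t)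

theorem HasGrowth.nonneg {T : C0Semigroup E} {M w : ℝ} (h : T.HasGrowth M w) : 0 ≤ M := by
  simpa using (norm_nonneg _).trans (h 0)

theorem HasGrowth.growthBound_le {T : C0Semigroup E} {M w : ℝ} (h : T.HasGrowth M w) :
    T.growthBound ≤ w := by
  refine sInf_le ⟨w, ⟨M + 1, by linarith [h.nonneg], fun t => (h t).trans ?_⟩, rfl⟩
  gcongr
  linarith

theorem exists_hasGrowth {T : C0Semigroup E} {a : ℝ} (h : T.growthBound < a) :
    ∃ w < a, ∃ M, T.HasGrowth M w := by
  obtain ⟨_, ⟨w, ⟨M, -, hw⟩, rfl⟩, hwa⟩ := sInf_lt_iff.1 h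
  exact ⟨w, EReal.coe_lt_coe_iff.1 hwa, M, hw⟩

theorem norm_exp_smul_op_le {T : C0Semigroup E} {M w : ℝ} (hT : T.HasGrowth M w) (z : ℂ) (x : E)
    {r : ℝ} (hr : 0 ≤ r) :
    ‖Complex.exp (-z * r) • T.op r.toNNReal x‖ ≤ M * ‖x‖ * Real.exp (-(z.re - w) * r) := by
  have h1 := (T.op r.toNNReal).le_of_opNorm_le (hT r.toNNReal) x
  rw [Real.coe_toNNReal r hr] at h1
  rw [norm_smul, Complex.norm_exp]
  have h2 : (-z * (r : ℂ)).re = -z.re * r := by simp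
  rw [h2]
  calc _ ≤ Real.exp (-z.re * r) * (M * Real.exp (w * r) * ‖x‖) := by gcongr
    _ = M * ‖x‖ * (Real.exp (-z.re * r) * Real.exp (w * r)) := by ring
    _ = _ := by rw [← Real.exp_add]; ring_nf

theorem continuous_exp_smul_op (T : C0Semigroup E) (z : ℂ) (x : E) :
    Continuous fun r : ℝ => Complex.exp (-z * r) • T.op r.toNNReal x :=
  (by fun_prop : Continuous fun r : ℝ => Complex.exp (-z * r)).smul (T.continuous_real_orbit x)

theorem integrableOn_exp_smul_op {T : C0Semigroup E} {M w : ℝ} (hT : T.HasGrowth M w) {z : ℂ}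
    (hz : w < z.re) (x : E) :
    IntegrableOn (fun r : ℝ => Complex.exp (-z * r) • T.op r.toNNReal x) (Ioi 0) := by
  refine Integrable.mono' (g := fun r => M * ‖x‖ * Real.exp (-(z.re - w) * r))
    ((exp_neg_integrableOn_Ioi 0 (sub_pos.2 hz)).const_mul _)
    (T.continuous_exp_smul_op z x).aestronglyMeasurable ?_
  filter_upwards [ae_restrict_mem measurableSet_Ioi] with r hr
  exact norm_exp_smul_op_le hT z x (le_of_lt hr)

/-- The Laplace transform `x ↦ ∫_0^∞ e^{-zr} T(r) x dr`, a bounded operator as soon as the real part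
of `z` exceeds the exponential rate of `T`. -/
noncomputable def laplace (T : C0Semigroup E) {M w : ℝ} (hT : T.HasGrowth M w) {z : ℂ}
    (hz : w < z.re) : E →L[ℂ] E :=
  LinearMap.mkContinuous
    { toFun := fun x => ∫ r in Ioi (0 : ℝ), Complex.exp (-z * r) • T.op r.toNNReal x
      map_add' := fun x y => by
        rw [← integral_add (integrableOn_exp_smul_op hT hz x) (integrableOn_exp_smul_op hT hz y)]
        simp only [map_add, smul_add]
      map_smul' := fun c x => by
        rw [RingHom.id_apply, ← integral_smul]
        simp only [map_smul, smul_comm c] }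
    (M / (z.re - w)) fun x => by
      have hI := exp_neg_integrableOn_Ioi 0 (sub_pos.2 hz)
      refine (norm_integral_le_of_norm_le (hI.const_mul (M * ‖x‖)) ?_).trans_eq ?_
      · filter_upwards [ae_restrict_mem measurableSet_Ioi] with r hr
        exact norm_exp_smul_op_le hT z x (le_of_lt hr)
      · rw [integral_const_mul, integral_exp_mul_Ioi (by linarith) 0]
        have h1 : -(z.re - w) ≠ 0 := by linarith
        have h2 : z.re - w ≠ 0 := by linarith
        rw [mul_zero, Real.exp_zero, neg_div_neg_eq]
        field_simp

theorem laplace_apply {T : C0Semigroup E} {M w : ℝ} (hT : T.HasGrowth M w) {z : ℂ}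
    (hz : w < z.re) (x : E) :
    T.laplace hT hz x = ∫ r in Ioi (0 : ℝ), Complex.exp (-z * r) • T.op r.toNNReal x := rfl

theorem norm_laplace_le {T : C0Semigroup E} {M w : ℝ} (hT : T.HasGrowth M w) {z : ℂ}
    (hz : w < z.re) : ‖T.laplace hT hz‖ ≤ M / (z.re - w) :=
  LinearMap.mkContinuous_norm_le _ (div_nonneg hT.nonneg (sub_pos.2 hz).le) _

theorem tendsto_coe_nhdsGT :
    Tendsto (fun h : ℝ≥0 => (h : ℝ)) (𝓝[>] 0) (𝓝[>] 0) := by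
  refine tendsto_nhdsWithin_iff.2 ⟨?_, ?_⟩
  · exact (NNReal.continuous_coe.tendsto' 0 0 rfl).mono_left nhdsWithin_le_nhds
  · filter_upwards [self_mem_nhdsWithin] with h hh
    exact NNReal.coe_pos.2 hh

/-- A derivative at `0` as the limit of the one-sided difference quotients by which generators are
defined. -/
theorem tendsto_diffQuotient_nnreal {f : ℝ → E} {y : E} (hf : HasDerivAt f y 0) :
    Tendsto (fun h : ℝ≥0 => ((h : ℝ) : ℂ)⁻¹ • (f h - f 0)) (𝓝[>] 0) (𝓝 y) := by
  have h1 := (hasDerivAt_iff_tendsto_slope.1 hf).comp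
    (tendsto_coe_nhdsGT.mono_right (nhdsWithin_mono (0 : ℝ) fun x (hx : 0 < x) => hx.ne'))
  refine h1.congr fun h => ?_
  simp only [Function.comp, slope, vsub_eq_sub, sub_zero]
  rw [← Complex.ofReal_inv, Complex.coe_smul]

theorem IsGenPair.op {T : C0Semigroup E} {x y : E} (h : T.IsGenPair x y) (s : ℝ≥0) :
    T.IsGenPair (T.op s x) (T.op s y) := by
  refine (((T.op s).continuous.tendsto y).comp h).congr fun h => ?_
  simp only [Function.comp, map_smul, map_sub]
  rw [op_comm]

/-- A semigroup with a growth estimate is jointly continuous in time and space. -/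
theorem tendsto_op_apply {T : C0Semigroup E} {M w : ℝ} (hT : T.HasGrowth M w) {ι : Type*}
    {l : Filter ι} {t : ι → ℝ≥0} {x : ι → E} {t₀ : ℝ≥0} {x₀ : E} (ht : Tendsto t l (𝓝 t₀))
    (hx : Tendsto x l (𝓝 x₀)) : Tendsto (fun i => T.op (t i) (x i)) l (𝓝 (T.op t₀ x₀)) := by
  have h1 : Tendsto (fun i => T.op (t i) x₀) l (𝓝 (T.op t₀ x₀)) :=
    ((T.continuous_orbit x₀).tendsto t₀).comp ht
  have h2 : Tendsto (fun i => T.op (t i) (x i - x₀)) l (𝓝 0) := by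
    have h3 : Tendsto (fun i => M * Real.exp (w * t i) * ‖x i - x₀‖) l (𝓝 0) := by
      have h4 : Tendsto (fun i => M * Real.exp (w * t i)) l (𝓝 (M * Real.exp (w * t₀))) :=
        ((by fun_prop : Continuous fun t : ℝ≥0 => M * Real.exp (w * t)).tendsto t₀).comp ht
      have h5 : Tendsto (fun i => ‖x i - x₀‖) l (𝓝 0) := by
        have := (hx.sub_const x₀).norm
        simpa using this
      simpa using h4.mul h5
    exact squeeze_zero_norm (fun i => (T.op (t i)).le_of_opNorm_le (hT _) _) h3
  have h6 := h1.add h2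
  rw [add_zero] at h6
  refine h6.congr fun i => ?_
  rw [map_sub]; abel

section Complete

variable [CompleteSpace E]

/-- Bounded operators commute with the Laplace integral. -/
theorem map_laplace {T : C0Semigroup E} {M w : ℝ} (hT : T.HasGrowth M w) {z : ℂ}
    (hz : w < z.re) {G : Type*} [NormedAddCommGroup G] [NormedSpace ℂ G] [CompleteSpace G]
    (L : E →L[ℂ] G) (x : E) : L (T.laplace hT hz x) =
      ∫ r in Ioi (0 : ℝ), Complex.exp (-z * r) • L (T.op r.toNNReal x) := by
  rw [laplace_apply, ← L.integral_comp_comm (integrableOn_exp_smul_op hT hz x)]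
  simp only [map_smul]

theorem op_laplace {T : C0Semigroup E} {M w : ℝ} (hT : T.HasGrowth M w) {z : ℂ}
    (hz : w < z.re) (h : ℝ≥0) (x : E) :
    T.op h (T.laplace hT hz x) = T.laplace hT hz (T.op h x) := by
  rw [map_laplace, laplace_apply]
  refine integral_congr_ae (Eventually.of_forall fun r => ?_)
  dsimp only
  rw [op_comm]

/-- Substitution in the Laplace integral. The right-hand side makes sense for all real `h`, which
gives access to differentiation at `0`. -/
theorem op_laplace_eq {T : C0Semigroup E} {M w : ℝ} (hT : T.HasGrowth M w) {z : ℂ}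
    (hz : w < z.re) (h : ℝ≥0) (x : E) :
    T.op h (T.laplace hT hz x) = Complex.exp (z * (h : ℝ)) • (T.laplace hT hz x -
      ∫ r in (0 : ℝ)..h, Complex.exp (-z * r) • T.op r.toNNReal x) := by
  have hint := integrableOn_exp_smul_op hT hz x
  have h0 : (0 : ℝ) ≤ h := h.2
  have e1 : T.laplace hT hz x - ∫ r in (0 : ℝ)..h, Complex.exp (-z * r) • T.op r.toNNReal x =
      ∫ r in Ioi (h : ℝ), Complex.exp (-z * r) • T.op r.toNNReal x := by
    rw [laplace_apply, ← intervalIntegral.integral_interval_add_Ioi hint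
      (hint.mono_set (Ioi_subset_Ioi h0))]
    abel
  rw [e1, laplace_apply, ← (T.op h).integral_comp_comm hint, ← integral_smul]
  have e2 := (measurePreserving_add_right volume (h : ℝ)).setIntegral_preimage_emb
    (measurableEmbedding_addRight (h : ℝ))
    (fun r : ℝ => Complex.exp (z * (h : ℝ)) • Complex.exp (-z * r) • T.op r.toNNReal x) (Ioi (h : ℝ))
  have e3 : (fun r : ℝ => r + h) ⁻¹' Ioi (h : ℝ) = Ioi 0 := by ext r; simp
  rw [e3] at e2
  rw [← e2]
  refine setIntegral_congr_fun measurableSet_Ioi fun r hr => ?_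
  have hr' : (0 : ℝ) ≤ r := le_of_lt hr
  rw [map_smul, smul_smul, ← Complex.exp_add, Real.toNNReal_add hr' h0, Real.toNNReal_coe, add_comm
    r.toNNReal h, T.op_add]
  congr 2
  push_cast
  ring

/-- The Laplace transform is a right inverse of `z - G`, where `G` is the generator. -/
theorem isGenPair_laplace {T : C0Semigroup E} {M w : ℝ} (hT : T.HasGrowth M w) {z : ℂ}
    (hz : w < z.re) (x : E) :
    T.IsGenPair (T.laplace hT hz x) (z • T.laplace hT hz x - x) := by
  set f : ℝ → E := fun h => Complex.exp (z * h) • (T.laplace hT hz x -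
      ∫ r in (0 : ℝ)..h, Complex.exp (-z * r) • T.op r.toNNReal x) with hf
  have hc := T.continuous_exp_smul_op z x
  have hd1 : HasDerivAt (fun h : ℝ => Complex.exp (z * h)) z 0 := by
    have h1 : HasDerivAt (fun h : ℝ => z * (h : ℂ)) (z * 1) 0 :=
      (Complex.ofRealCLM.hasDerivAt (x := (0 : ℝ))).const_mul z
    simpa using h1.cexp
  have hd2 : HasDerivAt (fun h : ℝ => T.laplace hT hz x -
      ∫ r in (0 : ℝ)..h, Complex.exp (-z * r) • T.op r.toNNReal x) (-x) 0 := by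
    have := intervalIntegral.integral_hasDerivAt_right (hc.intervalIntegrable 0 0)
      hc.aestronglyMeasurable.stronglyMeasurableAtFilter hc.continuousAt
    simpa [T.op_zero] using this.const_sub (T.laplace hT hz x)
  have hd : HasDerivAt f (z • T.laplace hT hz x - x) 0 := by
    have := hd1.smul hd2
    simp only [intervalIntegral.integral_same, sub_zero, Complex.ofReal_zero, mul_zero,
      Complex.exp_zero, one_smul] at this
    rw [sub_eq_neg_add]
    exact this
  refine (tendsto_diffQuotient_nnreal hd).congr fun h => ?_
  have : f 0 = T.laplace hT hz x := by simp [hf]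
  rw [this, op_laplace_eq]

/-- The graph of the generator is described by the Laplace transform, which is its resolvent. -/
theorem isGenPair_iff_laplace {T : C0Semigroup E} {M w : ℝ} (hT : T.HasGrowth M w) {z : ℂ}
    (hz : w < z.re) {x y : E} :
    T.IsGenPair x y ↔ T.laplace hT hz (z • x - y) = x := by
  constructor
  · intro h
    have h1 := ((T.laplace hT hz).continuous.tendsto y).comp h
    have h2 : T.IsGenPair (T.laplace hT hz x) (T.laplace hT hz y) := by
      refine h1.congr fun h => ?_
      simp only [Function.comp, map_smul, map_sub, op_laplace]
    rw [map_sub, map_smul, h2.unique (isGenPair_laplace hT hz x), sub_sub_cancel]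
  · intro h
    have := isGenPair_laplace hT hz (z • x - y)
    rwa [h, sub_sub_cancel] at this

theorem IsGeneratedBy.isResolventAt_laplace {T : C0Semigroup E} {G : E →ₗ.[ℂ] E}
    (hG : T.IsGeneratedBy G) {M w : ℝ} (hT : T.HasGrowth M w) {z : ℂ} (hz : w < z.re) :
    IsResolventAt G z (T.laplace hT hz) := by
  refine ⟨fun y => ?_, fun x => ?_⟩
  · have h := (hG _ _).2 (isGenPair_laplace hT hz y)
    obtain ⟨u, h1, h2⟩ := (LinearPMap.mem_graph_iff _).1 h
    dsimp only at h1 h2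
    refine ⟨h1 ▸ u.2, ?_⟩
    have : (⟨T.laplace hT hz y, h1 ▸ u.2⟩ : G.domain) = u := Subtype.ext h1.symm
    rw [this, h2, sub_sub_cancel]
  · have h : T.IsGenPair x (G x) := (hG _ _).1 (LinearPMap.mem_graph _ x)
    exact (isGenPair_iff_laplace hT hz).1 h

/-! ### Uniqueness of the semigroup with a given generator -/

/-- The domain of the generator is dense: it contains the averages `h⁻¹ ∫_0^h T(r) x dr`. -/
theorem dense_isGenPair (T : C0Semigroup E) :
    Dense {x : E | ∃ y, T.IsGenPair x y} := by
  intro x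
  set c := fun h : ℝ≥0 => ((h : ℝ) : ℂ)⁻¹ • (∫ r in (0 : ℝ)..h, T.op r.toNNReal x)
  have hc := T.continuous_real_orbit x
  have ht : Tendsto c (𝓝[>] 0) (𝓝 x) := by
    have hd := intervalIntegral.integral_hasDerivAt_right (hc.intervalIntegrable 0 0)
      hc.aestronglyMeasurable.stronglyMeasurableAtFilter hc.continuousAt
    have := tendsto_diffQuotient_nnreal hd
    simpa [T.op_zero, c] using this
  refine mem_closure_of_tendsto ht (Eventually.of_forall fun h => ?_)
  refine ⟨((h : ℝ) : ℂ)⁻¹ • (T.op h x - x), ?_⟩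
  set J := ∫ r in (0 : ℝ)..h, T.op r.toNNReal x
  have hJ : T.IsGenPair J (T.op h x - x) := by
    set f : ℝ → E := fun k => (∫ r in (h : ℝ)..(h + k), T.op r.toNNReal x) -
      ∫ r in (0 : ℝ)..k, T.op r.toNNReal x with hf
    have hd : HasDerivAt f (T.op h x - x) 0 := by
      have h1 : HasDerivAt (fun k : ℝ => ∫ r in (h : ℝ)..(h + k), T.op r.toNNReal x)
          (T.op h x) 0 := by
        have := intervalIntegral.integral_hasDerivAt_right (a := (h : ℝ)) (b := h + 0)
          (hc.intervalIntegrable _ _)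
          hc.aestronglyMeasurable.stronglyMeasurableAtFilter hc.continuousAt
        have h2 := this.comp_const_add (h : ℝ) 0
        simpa using h2
      have h2 := intervalIntegral.integral_hasDerivAt_right (hc.intervalIntegrable 0 0)
        hc.aestronglyMeasurable.stronglyMeasurableAtFilter hc.continuousAt
      have h3 := h1.sub h2
      simp only [Real.toNNReal_zero, T.op_zero, ContinuousLinearMap.id_apply] at h3
      exact h3
    refine (tendsto_diffQuotient_nnreal hd).congr fun k => ?_
    have e0 : f 0 = 0 := by simp [hf]
    rw [e0, sub_zero]
    congr 1
    have e1 : T.op k J = ∫ r in (k : ℝ)..(h + k), T.op r.toNNReal x := by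
      rw [← ContinuousLinearMap.intervalIntegral_comp_comm _ (hc.intervalIntegrable _ _)]
      have e2 := intervalIntegral.integral_comp_add_right (a := 0) (b := (h : ℝ))
        (fun r => T.op r.toNNReal x) (k : ℝ)
      rw [zero_add] at e2
      rw [← e2]
      refine intervalIntegral.integral_congr fun r hr => ?_
      replace hr : r ∈ Icc (0 : ℝ) h := by
        rwa [uIcc_of_le (NNReal.coe_nonneg h)] at hr
      rw [Real.toNNReal_add hr.1 (NNReal.coe_nonneg k), Real.toNNReal_coe, add_comm, T.op_add]
      rfl
    rw [e1, hf]
    dsimp only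
    have i1 := intervalIntegral.integral_add_adjacent_intervals (μ := volume)
      (hc.intervalIntegrable 0 (k : ℝ)) (hc.intervalIntegrable (k : ℝ) (h + k))
    have i2 := intervalIntegral.integral_add_adjacent_intervals (μ := volume)
      (hc.intervalIntegrable 0 (h : ℝ)) (hc.intervalIntegrable (h : ℝ) (h + k))
    have i3 := i1.trans i2.symm
    rw [sub_eq_sub_iff_add_eq_add, add_comm, ← i3, add_comm]
  refine ((hJ.const_smul (((h : ℝ) : ℂ)⁻¹))).congr fun k => ?_
  rw [map_smul, ← smul_sub, smul_comm]

/-- A semigroup is determined by its generator: `s ↦ T(t - s) T'(s) x` has vanishing derivative for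
`x` in the common domain. -/
theorem HasGrowth.ext {T T' : C0Semigroup E} {M w : ℝ} (hT : T.HasGrowth M w)
    (h : ∀ x y, T.IsGenPair x y ↔ T'.IsGenPair x y) : T' = T := by
  have key : ∀ (t : ℝ≥0) (x y : E), T.IsGenPair x y → T'.op t x = T.op t x := by
    intro t x y hxy
    set F : ℝ → E := fun s => T.op (t - s.toNNReal) (T'.op s.toNNReal x) with hF
    have hFc : Continuous F := by
      refine continuous_iff_continuousAt.2 fun s => ?_
      refine tendsto_op_apply hT ?_ ?_
      · have : Continuous fun s : ℝ => t - s.toNNReal := by fun_prop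
        exact this.tendsto s
      · exact (T'.continuous_real_orbit x).tendsto s
    have hder : ∀ s ∈ Ico (0 : ℝ) t, HasDerivWithinAt F 0 (Ici s) s := by
      intro s hs
      have hst : s.toNNReal < t := by
        rw [← NNReal.coe_lt_coe, Real.coe_toNNReal s hs.1]; exact hs.2
      rw [hasDerivWithinAt_iff_tendsto_slope]
      have hset : Ici s \ {s} = Ioi s := by ext u; simp [lt_iff_le_and_ne]
      rw [hset]
      set u := T'.op s.toNNReal x
      set v := T'.op s.toNNReal y
      have h1 : T'.IsGenPair u v := ((h _ _).1 hxy).op _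
      have h2 : T.IsGenPair u v := (h _ _).2 h1
      have h3 := h1.sub h2
      rw [sub_self] at h3
      have hh : Tendsto (fun r : ℝ => (r - s).toNNReal) (𝓝[>] s) (𝓝[>] 0) := by
        refine tendsto_nhdsWithin_iff.2 ⟨?_, ?_⟩
        · exact ((by fun_prop : Continuous fun r : ℝ => (r - s).toNNReal).tendsto' s 0
            (by simp)).mono_left nhdsWithin_le_nhds
        · filter_upwards [self_mem_nhdsWithin] with r hr
          exact Real.toNNReal_pos.2 (sub_pos.2 hr)
      have h4 := h3.comp hh
      have ht' : Tendsto (fun r : ℝ => t - r.toNNReal) (𝓝[>] s) (𝓝 (t - s.toNNReal)) :=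
        ((by fun_prop : Continuous fun r : ℝ => t - r.toNNReal).tendsto s).mono_left
          nhdsWithin_le_nhds
      have h5 := tendsto_op_apply hT ht' h4
      rw [map_zero] at h5
      refine h5.congr' ?_
      filter_upwards [Ioo_mem_nhdsGT hs.2] with r hr
      have hr0 : 0 ≤ r := hs.1.trans hr.1.le
      have hrs : 0 ≤ r - s := sub_nonneg.2 hr.1.le
      have e1 : r.toNNReal = (r - s).toNNReal + s.toNNReal := by
        rw [← Real.toNNReal_add hrs hs.1]; ring_nf
      have e2 : t - s.toNNReal = (t - r.toNNReal) + (r - s).toNNReal := by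
        have hrt : r.toNNReal ≤ t := by
          rw [← NNReal.coe_le_coe, Real.coe_toNNReal r hr0]; exact hr.2.le
        have e1' := congrArg NNReal.toReal e1
        rw [← NNReal.coe_inj, NNReal.coe_add, NNReal.coe_sub hst.le, NNReal.coe_sub hrt]
        push_cast [NNReal.coe_add] at e1'
        linarith
      simp only [Function.comp, slope, vsub_eq_sub, hF, Real.coe_toNNReal _ hrs]
      have e3 : T'.op r.toNNReal x = T'.op (r - s).toNNReal u := by
        rw [e1, T'.op_add]; rfl
      rw [e2, T.op_add, ContinuousLinearMap.comp_apply, e3, ← map_sub,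
        ← smul_sub, map_smul, ← Complex.ofReal_inv, Complex.coe_smul]
      congr 2
      abel
    have hconst := constant_of_has_deriv_right_zero hFc.continuousOn hder t ⟨t.2, le_rfl⟩
    simpa [hF, T.op_zero, T'.op_zero] using hconst
  have hop : ∀ t, T'.op t = T.op t := fun t => by
    have : (T'.op t : E → E) = T.op t :=
      Continuous.ext_on (dense_isGenPair T) (T'.op t).continuous (T.op t).continuous
        fun x ⟨y, hy⟩ => key t x y hy
    exact ContinuousLinearMap.ext (congrFun this)
  cases T; cases T'
  congr
  exact funext hop

end Complete

/-! ### Rescaled and similar semigroups -/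

/-- The rescaled semigroup `e^{βt} T(t)`. -/
noncomputable def rescale (T : C0Semigroup E) (β : ℝ) : C0Semigroup E where
  op t := Complex.exp ((β * t : ℝ)) • T.op t
  op_zero := by simp [T.op_zero]
  op_add s t := by
    ext x
    simp only [T.op_add, smul_apply, ContinuousLinearMap.comp_apply, map_smul,
      smul_smul, ← Complex.exp_add]
    congr 2
    push_cast
    ring
  continuous_orbit x := by
    have : Continuous fun t : ℝ≥0 => Complex.exp ((β * t : ℝ)) := by fun_prop
    exact this.smul (T.continuous_orbit x)

theorem rescale_op (T : C0Semigroup E) (β : ℝ) (t : ℝ≥0) :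
    (T.rescale β).op t = Complex.exp ((β * t : ℝ)) • T.op t := rfl

theorem HasGrowth.rescale {T : C0Semigroup E} {M w : ℝ} (hT : T.HasGrowth M w) (β : ℝ) :
    (T.rescale β).HasGrowth M (w + β) := by
  intro t
  rw [rescale_op, norm_smul, Complex.norm_exp_ofReal]
  calc _ ≤ Real.exp (β * t) * (M * Real.exp (w * t)) := by gcongr; exact hT t
    _ = M * (Real.exp (w * t) * Real.exp (β * t)) := by ring
    _ = _ := by rw [← Real.exp_add]; ring_nf

theorem IsGenPair.rescale {T : C0Semigroup E} {x y : E} (h : T.IsGenPair x y) (β : ℝ) :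
    (T.rescale β).IsGenPair x (y + (β : ℂ) • x) := by
  have h1 : HasDerivAt (fun h : ℝ => Complex.exp ((β * h : ℝ)) • x) ((β : ℂ) • x) 0 := by
    have h2 : HasDerivAt (fun h : ℝ => (((β * h : ℝ)) : ℂ)) (β : ℂ) 0 := by
      simpa using ((hasDerivAt_id (0 : ℝ)).const_mul β).ofReal_comp
    simpa using h2.cexp.smul_const x
  have h2 := tendsto_diffQuotient_nnreal h1
  have h3 : Tendsto (fun h : ℝ≥0 => Complex.exp ((β * h : ℝ))) (𝓝[>] 0) (𝓝 1) :=
    ((by fun_prop : Continuous fun h : ℝ≥0 => Complex.exp ((β * h : ℝ))).tendsto' 0 1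
      (by simp)).mono_left nhdsWithin_le_nhds
  have h4 := (h3.smul h).add h2
  rw [one_smul] at h4
  refine h4.congr fun k => ?_
  simp only [rescale_op, smul_apply, mul_zero, Complex.ofReal_zero,
    Complex.exp_zero, one_smul, smul_sub]
  rw [smul_comm (Complex.exp _) (_ : ℂ), smul_comm (Complex.exp _) (_ : ℂ)]
  abel

theorem rescale_rescale_neg (T : C0Semigroup E) (β : ℝ) : (T.rescale β).rescale (-β) = T := by
  have : ((T.rescale β).rescale (-β)).op = T.op := by
    funext t
    rw [rescale_op, rescale_op, smul_smul, ← Complex.exp_add, ← Complex.ofReal_add]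
    simp
  cases T
  simp only [rescale] at this ⊢
  congr

theorem isGenPair_rescale_iff {T : C0Semigroup E} {x y : E} (β : ℝ) :
    (T.rescale β).IsGenPair x y ↔ T.IsGenPair x (y - (β : ℂ) • x) := by
  constructor
  · intro h
    have := h.rescale (-β)
    rwa [rescale_rescale_neg, Complex.ofReal_neg, neg_smul, ← sub_eq_add_neg] at this
  · intro h
    simpa using h.rescale β

/-- The similar semigroup `e T(t) e⁻¹`. -/
def conj (T : C0Semigroup E) (e : E ≃L[ℂ] E) : C0Semigroup E where
  op t := (e : E →L[ℂ] E).comp ((T.op t).comp (e.symm : E →L[ℂ] E))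
  op_zero := by ext x; simp [T.op_zero]
  op_add s t := by ext x; simp [T.op_add]
  continuous_orbit x := e.continuous.comp (T.continuous_orbit (e.symm x))

theorem HasGrowth.conj {T : C0Semigroup E} {M w : ℝ} (hT : T.HasGrowth M w) (e : E ≃L[ℂ] E) :
    (T.conj e).HasGrowth (‖(e : E →L[ℂ] E)‖ * M * ‖(e.symm : E →L[ℂ] E)‖) w := by
  intro t
  calc _ ≤ ‖(e : E →L[ℂ] E)‖ * (‖T.op t‖ * ‖(e.symm : E →L[ℂ] E)‖) :=
        (ContinuousLinearMap.opNorm_comp_le _ _).trans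
          (by gcongr; exact ContinuousLinearMap.opNorm_comp_le _ _)
    _ ≤ ‖(e : E →L[ℂ] E)‖ * (M * Real.exp (w * t) * ‖(e.symm : E →L[ℂ] E)‖) := by
        gcongr; exact hT t
    _ = _ := by ring

theorem isGenPair_conj_iff {T : C0Semigroup E} {x y : E} (e : E ≃L[ℂ] E) :
    (T.conj e).IsGenPair x y ↔ T.IsGenPair (e.symm x) (e.symm y) := by
  have key : ∀ h : ℝ≥0, ((h : ℝ) : ℂ)⁻¹ • ((T.conj e).op h x - x) =
      e (((h : ℝ) : ℂ)⁻¹ • (T.op h (e.symm x) - e.symm x)) := fun h => by simp [conj]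
  constructor
  · intro h
    refine ((e.symm.continuous.tendsto y).comp h).congr fun k => ?_
    simp only [Function.comp, key, e.symm_apply_apply]
  · intro h
    have := (e.continuous.tendsto _).comp h
    rw [e.apply_symm_apply] at this
    exact this.congr fun k => (key k).symm

end C0Semigroup

/-- The first resolvent identity. -/
theorem IsResolventAt.sub_eq {X : Type*} [NormedAddCommGroup X] [NormedSpace ℂ X]
    {A : X →ₗ.[ℂ] X} {z z' : ℂ} {R R' : X →L[ℂ] X}
    (h : IsResolventAt A z R) (h' : IsResolventAt A z' R') :
    R - R' = (z' - z) • R.comp R' := by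
  ext y
  obtain ⟨hy, e⟩ := h'.1 y
  have e2 := h.2 ⟨R' y, hy⟩
  have e3 : A ⟨R' y, hy⟩ = z' • R' y - y := (sub_eq_of_eq_add' (sub_eq_iff_eq_add.1 e)).symm
  rw [e3, map_sub, map_sub, map_smul, map_smul] at e2
  simp only [sub_apply, smul_apply,
    ContinuousLinearMap.comp_apply, sub_smul]
  rw [sub_eq_iff_eq_add]
  calc R y = z' • R (R' y) - z • R (R' y) + (z • R (R' y) - (z' • R (R' y) - R y)) := by abel
    _ = _ := by rw [e2]

/-! ### Pointwise multiplication by operators on `L²` -/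

section Multiplier

variable {F G : Type*} [NormedAddCommGroup F] [NormedSpace ℂ F] [NormedAddCommGroup G]
  [NormedSpace ℂ G]

/-- An operator-valued function `Q`, bounded by `c`, for which `ω ↦ Q ω (f ω)` is measurable
whenever `f` is. -/
structure IsMultiplier (μ : Measure ℝ) (Q : ℝ → F →L[ℂ] G) (c : ℝ) : Prop where
  nonneg : 0 ≤ c
  norm_le : ∀ ω, ‖Q ω‖ ≤ c
  meas : ∀ f : ℝ → F, AEStronglyMeasurable f μ → AEStronglyMeasurable (fun ω => Q ω (f ω)) μ

/-- Bounded strongly continuous operator functions are jointly continuous. -/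
theorem continuous_uncurry_of_strong {Q : ℝ → F →L[ℂ] G} {c : ℝ} (hc : ∀ ω, ‖Q ω‖ ≤ c)
    (hQ : ∀ y, Continuous fun ω => Q ω y) : Continuous fun p : ℝ × F => Q p.1 p.2 := by
  refine continuous_iff_continuousAt.2 fun ⟨ω, y⟩ => ?_
  have h1 : Tendsto (fun p : ℝ × F => Q p.1 y) (𝓝 (ω, y)) (𝓝 (Q ω y)) :=
    ((hQ y).comp continuous_fst).tendsto (ω, y)
  have h2 : Tendsto (fun p : ℝ × F => Q p.1 (p.2 - y)) (𝓝 (ω, y)) (𝓝 0) := by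
    have h3 : Tendsto (fun p : ℝ × F => c * ‖p.2 - y‖) (𝓝 (ω, y)) (𝓝 0) :=
      (by fun_prop : Continuous fun p : ℝ × F => c * ‖p.2 - y‖).tendsto' _ _ (by simp)
    exact squeeze_zero_norm (fun p => (Q p.1).le_of_opNorm_le (hc _) _) h3
  have h3 := h1.add h2
  rw [add_zero] at h3
  refine h3.congr fun p => ?_
  rw [map_sub]; abel

theorem IsMultiplier.of_continuous {μ : Measure ℝ} {Q : ℝ → F →L[ℂ] G} {c : ℝ}
    (hc : ∀ ω, ‖Q ω‖ ≤ c) (hQ : ∀ y, Continuous fun ω => Q ω y) : IsMultiplier μ Q c where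
  nonneg := (norm_nonneg _).trans (hc 0)
  norm_le := hc
  meas _ hf := (continuous_uncurry_of_strong hc hQ).comp_aestronglyMeasurable
    (continuous_id.aestronglyMeasurable.prodMk hf)

variable {μ : Measure ℝ} {Q : ℝ → F →L[ℂ] G} {c : ℝ}

theorem IsMultiplier.memLp (h : IsMultiplier μ Q c) (f : Lp F 2 μ) :
    MemLp (fun ω => Q ω (f ω)) 2 μ :=
  (Lp.memLp f).of_le_mul (c := c) (h.meas _ (Lp.aestronglyMeasurable f))
    (Eventually.of_forall fun ω => (Q ω).le_of_opNorm_le (h.norm_le ω) _)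

/-- The operator of pointwise multiplication by `Q` on `L²`. -/
noncomputable def mulOp (h : IsMultiplier μ Q c) : Lp F 2 μ →L[ℂ] Lp G 2 μ :=
  LinearMap.mkContinuous
    { toFun := fun f => (h.memLp f).toLp _
      map_add' := fun f g => by
        rw [← MemLp.toLp_add]
        refine MemLp.toLp_congr _ _ ?_
        filter_upwards [Lp.coeFn_add f g] with ω hω
        rw [hω, Pi.add_apply, map_add, Pi.add_apply]
      map_smul' := fun a f => by
        rw [RingHom.id_apply, ← MemLp.toLp_const_smul]
        refine MemLp.toLp_congr _ _ ?_
        filter_upwards [Lp.coeFn_smul a f] with ω hω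
        rw [hω, Pi.smul_apply, map_smul, Pi.smul_apply] }
    c fun f => by
      refine Lp.norm_le_mul_norm_of_ae_le_mul ?_
      filter_upwards [(h.memLp f).coeFn_toLp] with ω hω
      refine (congrArg norm hω).trans_le ?_
      exact (Q ω).le_of_opNorm_le (h.norm_le ω) _

theorem coeFn_mulOp (h : IsMultiplier μ Q c) (f : Lp F 2 μ) :
    mulOp h f =ᵐ[μ] fun ω => Q ω (f ω) :=
  (h.memLp f).coeFn_toLp

theorem norm_mulOp_le (h : IsMultiplier μ Q c) : ‖mulOp h‖ ≤ c :=
  LinearMap.mkContinuous_norm_le _ h.nonneg _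

end Multiplier

/-! ### Translations and cut-offs on the line -/

/-- The space `L²(ℝ, F)`. -/
abbrev LineL2 (F : Type*) [NormedAddCommGroup F] : Type _ := Lp F 2 (volume : Measure ℝ)

section Line

variable {F : Type*} [NormedAddCommGroup F] [NormedSpace ℂ F]

/-- The translation `(τ_s f)(t) = f(t + s)` on `L²(ℝ, F)`. -/
noncomputable def translate (s : ℝ) : LineL2 F →L[ℂ] LineL2 F :=
  (Lp.compMeasurePreservingₗᵢ ℂ (fun t : ℝ => t + s)
    (measurePreserving_add_right volume s)).toContinuousLinearMap

theorem coeFn_translate (s : ℝ) (f : LineL2 F) :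
    translate s f =ᵐ[volume] fun t => f (t + s) :=
  Lp.coeFn_compMeasurePreserving f (measurePreserving_add_right volume s)

theorem norm_translate (s : ℝ) (f : LineL2 F) : ‖translate s f‖ = ‖f‖ :=
  Lp.norm_compMeasurePreserving f (measurePreserving_add_right volume s)

theorem ae_comp_add {p : ℝ → Prop} (h : ∀ᵐ t, p t) (s : ℝ) : ∀ᵐ t : ℝ, p (t + s) :=
  (measurePreserving_add_right volume s).quasiMeasurePreserving.ae h

theorem translate_translate (s t : ℝ) (f : LineL2 F) :
    translate s (translate t f) = translate (s + t) f := by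
  refine Lp.ext ?_
  filter_upwards [coeFn_translate s (translate t f), ae_comp_add (coeFn_translate t f) s,
    coeFn_translate (s + t) f] with r h1 h2 h3
  rw [h1, h2, h3, add_assoc]

theorem translate_zero (f : LineL2 F) : translate 0 f = f := by
  refine Lp.ext ?_
  filter_upwards [coeFn_translate 0 f] with r h1
  rw [h1, add_zero]

theorem continuous_translate (f : LineL2 F) : Continuous fun s : ℝ => translate s f := by
  let g : ℝ → C(ℝ, ℝ) := fun s => ⟨fun t => t + s, by fun_prop⟩
  have hg : Continuous g := by
    refine ContinuousMap.continuous_of_continuous_uncurry _ ?_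
    change Continuous fun p : ℝ × ℝ => p.2 + p.1
    fun_prop
  exact (continuous_const (y := f)).compMeasurePreservingLp hg
    (fun s => measurePreserving_add_right volume s) (by norm_num)

open scoped Classical in
theorem isMultiplier_cut (a : ℝ) : IsMultiplier volume
    (fun t : ℝ => if a ≤ t then ContinuousLinearMap.id ℂ F else 0) 1 where
  nonneg := zero_le_one
  norm_le t := by
    split_ifs
    · exact ContinuousLinearMap.norm_id_le
    · simp
  meas f hf := by
    refine (hf.indicator (measurableSet_Ici (a := a))).congr (Eventually.of_forall fun t => ?_)
    by_cases h : a ≤ t <;> simp [h]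

/-- The cut-off `f ↦ 1_{[a, ∞)} f` on `L²(ℝ, F)`. -/
noncomputable def cut (a : ℝ) : LineL2 F →L[ℂ] LineL2 F := mulOp (isMultiplier_cut a)

theorem coeFn_cut (a : ℝ) (f : LineL2 F) : cut a f =ᵐ[volume] (Ici a).indicator f := by
  filter_upwards [coeFn_mulOp (isMultiplier_cut a) f] with t ht
  refine Eq.trans ht ?_
  by_cases h : a ≤ t <;> simp [h]

theorem translate_cut (s a : ℝ) (f : LineL2 F) :
    translate s (cut a f) = cut (a - s) (translate s f) := by
  refine Lp.ext ?_
  filter_upwards [coeFn_translate s (cut a f), ae_comp_add (coeFn_cut a f) s,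
    coeFn_cut (a - s) (translate s f), coeFn_translate s f] with t h1 h2 h3 h4
  rw [h1, h2, h3]
  by_cases h : a ≤ t + s
  · rw [indicator_of_mem (mem_Ici.2 h), indicator_of_mem (mem_Ici.2 (by linarith)), h4]
  · rw [indicator_of_notMem (by simpa using h), indicator_of_notMem (by simp; linarith)]

theorem cut_cut (a b : ℝ) (f : LineL2 F) : cut a (cut b f) = cut (max a b) f := by
  refine Lp.ext ?_
  filter_upwards [coeFn_cut a (cut b f), coeFn_cut b f, coeFn_cut (max a b) f] with t h1 h2 h3
  rw [h1, h3, ← Ici_inter_Ici, ← indicator_indicator]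
  by_cases h : t ∈ Ici a
  · rw [indicator_of_mem h, indicator_of_mem h, h2]
  · rw [indicator_of_notMem h, indicator_of_notMem h]

theorem cut_translate_cut (t : ℝ≥0) (g : LineL2 F) :
    cut 0 (translate t (cut 0 g)) = cut 0 (translate t g) := by
  rw [translate_cut, cut_cut, max_eq_left]
  simp

end Line

/-! ### The pairing of scalar with vector-valued functions -/

section Pairing

variable {X : Type*} [NormedAddCommGroup X] [NormedSpace ℂ X] [CompleteSpace X]

theorem integrable_pair {X : Type*} [NormedAddCommGroup X] [NormedSpace ℂ X] {μ : Measure ℝ}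
    {φ : ℝ → ℂ} {g : ℝ → X} (hφ : MemLp φ 2 μ) (hg : MemLp g 2 μ) :
    Integrable (fun t => φ t • g t) μ :=
  memLp_one_iff_integrable.1 (hg.smul hφ)

/-- The bilinear pairing `(φ, g) ↦ ∫ φ(t) g(t) dt` of `L²(ℝ, ℂ)` with `L²(ℝ, X)`. -/
noncomputable def pair : LineL2 ℂ →L[ℂ] LineL2 X →L[ℂ] X :=
  (ContinuousLinearMap.lsmul ℂ ℂ).lpPairing volume 2 2

theorem pair_apply (φ : LineL2 ℂ) (g : LineL2 X) : pair φ g = ∫ t, φ t • g t :=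
  ContinuousLinearMap.lpPairing_eq_integral _ φ g

theorem pair_toLp {φ : ℝ → ℂ} (hφ : MemLp φ 2 volume) (g : LineL2 X) :
    pair (hφ.toLp φ) g = ∫ t, φ t • g t := by
  rw [pair_apply]
  refine integral_congr_ae ?_
  filter_upwards [hφ.coeFn_toLp] with t ht
  rw [ht]

theorem pair_translate (φ : LineL2 ℂ) (s : ℝ) (g : LineL2 X) :
    pair φ (translate s g) = pair (translate (-s) φ) g := by
  rw [pair_apply, pair_apply,
    ← integral_add_right_eq_self (fun t => translate (-s) φ t • g t) s]
  refine integral_congr_ae ?_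
  filter_upwards [coeFn_translate s g, ae_comp_add (coeFn_translate (-s) φ) s] with t h1 h2
  rw [h1, h2, add_neg_cancel_right]

theorem pair_cut (φ : LineL2 ℂ) (a : ℝ) (g : LineL2 X) :
    pair φ (cut a g) = pair (cut a φ) g := by
  rw [pair_apply, pair_apply]
  refine integral_congr_ae ?_
  filter_upwards [coeFn_cut a g, coeFn_cut a φ] with t h1 h2
  rw [h1, h2]
  by_cases h : t ∈ Ici a
  · rw [indicator_of_mem h, indicator_of_mem h]
  · rw [indicator_of_notMem h, indicator_of_notMem h, smul_zero, zero_smul]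

/-- The pairing separates points, so that identities in `L²(ℝ, X)` can be verified after pairing with
scalar functions, that is, for `X`-valued integrals. -/
theorem eq_of_forall_pair {g g' : LineL2 X} (h : ∀ φ, pair φ g = pair φ g') : g = g' := by
  rw [← sub_eq_zero]
  set d := g - g'
  have hd : ∀ φ, pair φ d = 0 := fun φ => by rw [map_sub, h, sub_self]
  have hloc : LocallyIntegrable d volume := (Lp.memLp d).locallyIntegrable (by norm_num)
  have := ae_eq_zero_of_integral_contDiff_smul_eq_zero hloc fun φ hφ hc => by
    have hm : MemLp (fun t => (φ t : ℂ)) 2 volume :=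
      (Complex.continuous_ofReal.comp hφ.continuous).memLp_of_hasCompactSupport
        (hc.comp_left Complex.ofReal_zero)
    have h2 := hd (hm.toLp _)
    rw [pair_toLp] at h2
    simpa only [Complex.coe_smul] using h2
  refine Lp.ext ?_
  filter_upwards [this, Lp.coeFn_zero X 2 volume] with t h1 h2
  rw [h1, h2, Pi.zero_apply]

theorem continuous_pair_translate (φ : LineL2 ℂ) (g : LineL2 X) :
    Continuous fun s : ℝ => pair φ (translate s g) :=
  (pair φ).continuous.comp (continuous_translate g)

end Pairing

/-! ### Restriction to and extension from the history interval -/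

section History

theorem memLp_indicator_history {X : Type*} [NormedAddCommGroup X]
    (f : Lp X 2 delayMeasure) :
    MemLp ((Icc (-1 : ℝ) 0).indicator f) 2 volume :=
  (memLp_indicator_iff_restrict measurableSet_Icc).2 (Lp.memLp f)

theorem indicator_history_ae_eq {X : Type*} [NormedAddCommGroup X] {f g : ℝ → X}
    (h : f =ᵐ[delayMeasure] g) :
    (Icc (-1 : ℝ) 0).indicator f =ᵐ[volume] (Icc (-1 : ℝ) 0).indicator g := by
  filter_upwards [(ae_restrict_iff' measurableSet_Icc).1 h] with t ht
  by_cases hm : t ∈ Icc (-1 : ℝ) 0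
  · rw [indicator_of_mem hm, indicator_of_mem hm, ht hm]
  · rw [indicator_of_notMem hm, indicator_of_notMem hm]

variable {X : Type*} [NormedAddCommGroup X] [NormedSpace ℂ X]

/-- Restriction of functions on the line to the history interval `[-1, 0]`. -/
noncomputable def restr : LineL2 X →L[ℂ] Lp X 2 delayMeasure :=
  LpToLpRestrictCLM ℝ X ℂ volume 2 (Icc (-1 : ℝ) 0)

theorem coeFn_restr (g : LineL2 X) : restr g =ᵐ[delayMeasure] g :=
  LpToLpRestrictCLM_coeFn ℂ _ g

/-- Extension by zero of functions on the history interval `[-1, 0]` to the line. -/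
noncomputable def extend : Lp X 2 (delayMeasure) →L[ℂ] LineL2 X :=
  LinearMap.mkContinuous
    { toFun := fun f => (memLp_indicator_history f).toLp _
      map_add' := fun f g => by
        rw [← MemLp.toLp_add]
        refine MemLp.toLp_congr _ _ ?_
        rw [← indicator_add']
        exact indicator_history_ae_eq (Lp.coeFn_add f g)
      map_smul' := fun a f => by
        rw [RingHom.id_apply, ← MemLp.toLp_const_smul]
        refine MemLp.toLp_congr _ _ ?_
        refine (indicator_history_ae_eq (Lp.coeFn_smul a f)).trans ?_
        exact Eventually.of_forall fun t => indicator_const_smul_apply _ a f t }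
    1 fun f => by
      rw [one_mul]
      refine (Lp.norm_toLp _ (memLp_indicator_history f)).trans_le ?_
      rw [eLpNorm_indicator_eq_eLpNorm_restrict measurableSet_Icc]
      rfl

theorem coeFn_extend (f : Lp X 2 delayMeasure) :
    extend f =ᵐ[volume] (Icc (-1 : ℝ) 0).indicator f :=
  (memLp_indicator_history f).coeFn_toLp

theorem restr_extend (f : Lp X 2 delayMeasure) : restr (extend f) = f := by
  refine Lp.ext ?_
  filter_upwards [coeFn_restr (extend f), ae_restrict_of_ae (coeFn_extend f),
    ae_restrict_mem measurableSet_Icc] with t h1 h2 h3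
  rw [h1, h2, indicator_of_mem h3]

theorem extend_restr (g : LineL2 X) : extend (restr g) = cut (-1) g - cut 0 g := by
  refine Lp.ext ?_
  filter_upwards [coeFn_extend (restr g), indicator_history_ae_eq (coeFn_restr g),
    Lp.coeFn_sub (cut (-1) g) (cut 0 g), coeFn_cut (-1) g, coeFn_cut 0 g,
    Measure.ae_ne volume (0 : ℝ)] with t h1 h2 h3 h4 h5 h6
  rw [h1, h2, h3, Pi.sub_apply, h4, h5]
  rcases lt_or_ge t (-1) with h | h
  · rw [indicator_of_notMem (by simp; intro; linarith), indicator_of_notMem (by simpa using h),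
      indicator_of_notMem (by simp; linarith), sub_zero]
  · rcases lt_or_gt_of_ne h6 with h' | h'
    · rw [indicator_of_mem (show t ∈ Icc (-1 : ℝ) 0 from ⟨h, h'.le⟩), indicator_of_mem (mem_Ici.2 h),
        indicator_of_notMem (by simpa using h'), sub_zero]
    · rw [indicator_of_notMem (by simpa using fun _ => h'), indicator_of_mem (mem_Ici.2 h),
        indicator_of_mem (mem_Ici.2 h'.le), sub_self]

theorem restr_cut (g : LineL2 X) : restr (cut (-1) g) = restr g := by
  refine Lp.ext ?_
  filter_upwards [coeFn_restr (cut (-1) g), coeFn_restr g, ae_restrict_of_ae (coeFn_cut (-1) g),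
    ae_restrict_mem measurableSet_Icc] with t h1 h2 h3 h4
  rw [h1, h2, h3, indicator_of_mem (mem_Ici.2 h4.1)]

theorem restr_eq_zero_of_cut {g : LineL2 X} : restr (cut 0 g) = 0 := by
  have h := restr_extend (restr g)
  rw [extend_restr, map_sub, restr_cut] at h
  exact sub_eq_self.1 h

theorem cut_zero_extend (f : Lp X 2 delayMeasure) : cut 0 (extend f) = 0 := by
  have h := extend_restr (extend f)
  rw [restr_extend] at h
  have h2 := congrArg (cut 0) h
  rw [map_sub, cut_cut, cut_cut] at h2
  simpa using h2

end History

/-! ### Exponential functions as symbols of delay operators -/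

section Exponential

variable {X : Type*} [NormedAddCommGroup X] [NormedSpace ℂ X]

theorem expTensor_apply (z : ℂ) (x : X) (s : Icc (-1 : ℝ) 0) :
    expTensor X z x s = Complex.exp (z * ((s : ℝ) : ℂ)) • x := rfl

theorem norm_expTensor_le {z : ℂ} (hz : 0 ≤ z.re) : ‖expTensor X z‖ ≤ 1 := by
  refine ContinuousLinearMap.opNorm_le_bound _ zero_le_one fun x => ?_
  rw [one_mul, ContinuousMap.norm_le _ (norm_nonneg _)]
  intro s
  rw [expTensor_apply, norm_smul, Complex.norm_exp]
  refine mul_le_of_le_one_left (norm_nonneg _) (Real.exp_le_one_iff.2 ?_)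
  simpa using mul_nonpos_of_nonneg_of_nonpos hz s.2.2

theorem isMultiplier_expTensor (X : Type*) [NormedAddCommGroup X] [NormedSpace ℂ X] :
    IsMultiplier volume
    (fun ω : ℝ => expTensor X (Complex.I * ((2 * Real.pi * ω : ℝ) : ℂ))) 1 :=
  .of_continuous (fun ω => norm_expTensor_le (by simp)) fun y => by
    refine ContinuousMap.continuous_of_continuous_uncurry _ ?_
    change Continuous fun p : ℝ × Icc (-1 : ℝ) 0 =>
      Complex.exp (Complex.I * ((2 * Real.pi * p.1 : ℝ) : ℂ) * ((p.2 : ℝ) : ℂ)) • y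
    fun_prop

theorem isMultiplier_delay (Φ : C(Icc (-1 : ℝ) 0, X) →L[ℂ] X) {c : ℝ}
    (hc : ∀ ω : ℝ, ‖Φ.comp (expTensor X (Complex.I * (ω : ℂ)))‖ ≤ c) :
    IsMultiplier volume
      (fun ω : ℝ => Φ.comp (expTensor X (Complex.I * ((2 * Real.pi * ω : ℝ) : ℂ)))) c where
  nonneg := (norm_nonneg _).trans (hc 0)
  norm_le _ := hc _
  meas f hf := Φ.continuous.comp_aestronglyMeasurable ((isMultiplier_expTensor X).meas f hf)

end Exponential

/-! ### Fourier multipliers on `L²(ℝ, X)` -/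

section Fourier

open scoped FourierTransform

variable {X : Type*} [NormedAddCommGroup X] [InnerProductSpace ℂ X] [CompleteSpace X]

/-- The Fourier transform on `L²(ℝ, X)`, a unitary operator. -/
noncomputable abbrev fourierL2 (X : Type*) [NormedAddCommGroup X] [InnerProductSpace ℂ X]
    [CompleteSpace X] : LineL2 X ≃ₗᵢ[ℂ] LineL2 X :=
  Lp.fourierTransformₗᵢ ℝ X

theorem fourierL2_toLp (f : SchwartzMap ℝ X) : fourierL2 X (f.toLp 2) = (𝓕 f).toLp 2 :=
  SchwartzMap.toLp_fourier_eq f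

theorem denseRange_schwartz (X : Type*) [NormedAddCommGroup X] [InnerProductSpace ℂ X] :
    DenseRange fun f : SchwartzMap ℝ X => f.toLp 2 (volume : Measure ℝ) :=
  SchwartzMap.denseRange_toLpCLM ENNReal.ofNat_ne_top

/-- The Fourier transform is symmetric for the bilinear pairing, by density of Schwartz functions. -/
theorem pair_fourierL2 (φ : LineL2 ℂ) (g : LineL2 X) :
    pair (fourierL2 ℂ φ) g = pair φ (fourierL2 X g) := by
  have h1 : ∀ f : SchwartzMap ℝ ℂ, ∀ g : LineL2 X,
      pair (fourierL2 ℂ (f.toLp 2)) g = pair (f.toLp 2) (fourierL2 X g) := by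
    intro f
    refine congrFun ((denseRange_schwartz X).equalizer (by fun_prop) (by fun_prop) ?_)
    funext g
    simp only [Function.comp]
    rw [fourierL2_toLp, fourierL2_toLp, pair_apply, pair_apply]
    have e := SchwartzMap.integral_fourier_smul_eq f g
    refine Eq.trans (integral_congr_ae ?_) (e.trans (integral_congr_ae ?_))
    · filter_upwards [(𝓕 f).coeFn_toLp 2 volume, g.coeFn_toLp 2 volume] with t h1 h2
      rw [h1, h2]
    · filter_upwards [f.coeFn_toLp 2 volume, (𝓕 g).coeFn_toLp 2 volume] with t h1 h2
      rw [h1, h2]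
  refine congrFun ((denseRange_schwartz ℂ).equalizer
    (g := fun φ : LineL2 ℂ => pair (fourierL2 ℂ φ) g)
    (h := fun φ : LineL2 ℂ => pair φ (fourierL2 X g)) ?_ ?_ ?_) φ
  · exact (ContinuousLinearMap.flip pair g).continuous.comp (fourierL2 ℂ).continuous
  · exact (ContinuousLinearMap.flip pair (fourierL2 X g)).continuous
  · funext f
    exact h1 f g

theorem pair_fourierL2_symm (φ : LineL2 ℂ) (g : LineL2 X) :
    pair φ ((fourierL2 X).symm g) = pair ((fourierL2 ℂ).symm φ) g := by
  have h := pair_fourierL2 ((fourierL2 ℂ).symm φ) ((fourierL2 X).symm g)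
  rwa [LinearIsometryEquiv.apply_symm_apply, LinearIsometryEquiv.apply_symm_apply] at h

theorem isMultiplier_char (F : Type*) [NormedAddCommGroup F] [NormedSpace ℂ F] (s : ℝ) :
    IsMultiplier volume
    (fun ω : ℝ => Complex.exp (Complex.I * ((2 * Real.pi * ω : ℝ) : ℂ) * s) •
      ContinuousLinearMap.id ℂ F) 1 :=
  .of_continuous (fun ω => by
      have : Complex.I * ((2 * Real.pi * ω : ℝ) : ℂ) * s
          = ((2 * Real.pi * ω * s : ℝ) : ℂ) * Complex.I := by push_cast; ring
      rw [norm_smul, this, Complex.norm_exp_ofReal_mul_I, one_mul]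
      exact ContinuousLinearMap.norm_id_le)
    fun y => by
      simp only [smul_apply, ContinuousLinearMap.id_apply]
      fun_prop

/-- The Fourier transform turns translations into multiplication by characters. -/
theorem fourierL2_translate (s : ℝ) (g : LineL2 X) :
    fourierL2 X (translate s g) = mulOp (isMultiplier_char X s) (fourierL2 X g) := by
  refine congrFun ((denseRange_schwartz X).equalizer
    (g := fun g => fourierL2 X (translate s g))
    (h := fun g => mulOp (isMultiplier_char X s) (fourierL2 X g)) (by fun_prop) (by fun_prop) ?_) g
  funext f
  simp only [Function.comp]
  have e1 : translate s (f.toLp 2 volume) =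
      (SchwartzMap.compSubConstCLM ℂ (-s) f).toLp 2 volume := by
    refine Lp.ext ?_
    filter_upwards [coeFn_translate s (f.toLp 2 volume), ae_comp_add (f.coeFn_toLp 2 volume) s,
      (SchwartzMap.compSubConstCLM ℂ (-s) f).coeFn_toLp 2 volume] with t h1 h2 h3
    rw [h1, h2, h3, SchwartzMap.compSubConstCLM_apply, sub_neg_eq_add]
  rw [e1, fourierL2_toLp, fourierL2_toLp]
  refine Lp.ext ?_
  filter_upwards [(𝓕 (SchwartzMap.compSubConstCLM ℂ (-s) f)).coeFn_toLp 2 volume,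
    (𝓕 f).coeFn_toLp 2 volume, coeFn_mulOp (isMultiplier_char X s) ((𝓕 f).toLp 2 volume)]
    with ω h1 h2 h3
  rw [h1, h3, h2, SchwartzMap.fourier_coe, SchwartzMap.fourier_coe, smul_apply,
    ContinuousLinearMap.id_apply]
  have e2 : ((SchwartzMap.compSubConstCLM ℂ (-s) f : SchwartzMap ℝ X) : ℝ → X) =
      (f : ℝ → X) ∘ fun v => v + s := by
    funext t
    rw [SchwartzMap.compSubConstCLM_apply, sub_neg_eq_add]; rfl
  rw [e2]
  have e3 := congrFun (VectorFourier.fourierIntegral_comp_add_right Real.fourierChar volume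
    (innerₗ ℝ) (f : ℝ → X) s) ω
  refine e3.trans ?_
  rw [Circle.smul_def]
  congr 1
  rw [Real.fourierChar_apply]
  congr 1
  simp
  ring

/-- The Fourier multiplier operator `𝓕⁻¹ Q 𝓕` on `L²(ℝ, X)`. -/
noncomputable def fourierMul {Q : ℝ → X →L[ℂ] X} {c : ℝ} (h : IsMultiplier volume Q c) :
    LineL2 X →L[ℂ] LineL2 X :=
  ((fourierL2 X).symm.toContinuousLinearEquiv : LineL2 X →L[ℂ] LineL2 X).comp
    ((mulOp h).comp ((fourierL2 X).toContinuousLinearEquiv : LineL2 X →L[ℂ] LineL2 X))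

theorem fourierMul_apply {Q : ℝ → X →L[ℂ] X} {c : ℝ} (h : IsMultiplier volume Q c)
    (g : LineL2 X) : fourierMul h g = (fourierL2 X).symm (mulOp h (fourierL2 X g)) := rfl

/-- By Plancherel, a Fourier multiplier is bounded by the supremum of its symbol. -/
theorem norm_fourierMul_le {Q : ℝ → X →L[ℂ] X} {c : ℝ} (h : IsMultiplier volume Q c) :
    ‖fourierMul h‖ ≤ c := by
  refine ContinuousLinearMap.opNorm_le_bound _ h.nonneg fun g => ?_
  rw [fourierMul_apply, LinearIsometryEquiv.norm_map]
  refine ((mulOp h).le_of_opNorm_le (norm_mulOp_le h) _).trans_eq ?_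
  rw [LinearIsometryEquiv.norm_map]

theorem pair_fourierMul {Q : ℝ → X →L[ℂ] X} {c : ℝ} (h : IsMultiplier volume Q c)
    (φ : LineL2 ℂ) (g : LineL2 X) :
    pair φ (fourierMul h g) = ∫ ω, (fourierL2 ℂ).symm φ ω • Q ω (fourierL2 X g ω) := by
  rw [fourierMul_apply, pair_fourierL2_symm, pair_apply]
  refine integral_congr_ae ?_
  filter_upwards [coeFn_mulOp h (fourierL2 X g)] with ω hω
  rw [hω]

/-- The pairing with a translate, on the Fourier side. -/
theorem pair_translate_eq_fourier (φ : LineL2 ℂ) (s : ℝ) (g : LineL2 X) :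
    pair φ (translate s g) = ∫ ω : ℝ, (fourierL2 ℂ).symm φ ω •
      Complex.exp (Complex.I * ((2 * Real.pi * ω : ℝ) : ℂ) * s) • fourierL2 X g ω := by
  rw [← (fourierL2 X).symm_apply_apply (translate s g), pair_fourierL2_symm, pair_apply,
    fourierL2_translate]
  refine integral_congr_ae ?_
  filter_upwards [coeFn_mulOp (isMultiplier_char X s) (fourierL2 X g)] with ω hω
  rw [hω]; rfl

/-! ### The delay operator on `L²(ℝ, X)` -/

/-- The continuous function `s ↦ ∫ φ(t) g(t + s) dt` on `[-1, 0]`: the `φ`-average of the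
histories `g_t`. -/
noncomputable def pairHist (φ : LineL2 ℂ) (g : LineL2 X) : C(Icc (-1 : ℝ) 0, X) :=
  ⟨fun s => pair φ (translate (s : ℝ) g),
    (continuous_pair_translate φ g).comp continuous_subtype_val⟩

/-- The averaged form of `(N g)(t) = Φ(g_t)`, where `N` is the Fourier multiplier with symbol
`Φ(ε_{2πiω} ⊗ Id)`. -/
theorem pair_fourierMul_delay (Φ : C(Icc (-1 : ℝ) 0, X) →L[ℂ] X) {c : ℝ}
    (hc : ∀ ω : ℝ, ‖Φ.comp (expTensor X (Complex.I * (ω : ℂ)))‖ ≤ c) (φ : LineL2 ℂ)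
    (g : LineL2 X) :
    pair φ (fourierMul (isMultiplier_delay Φ hc) g) = Φ (pairHist φ g) := by
  rw [pair_fourierMul]
  set E := fun ω : ℝ => (fourierL2 ℂ).symm φ ω •
    expTensor X (Complex.I * ((2 * Real.pi * ω : ℝ) : ℂ)) (fourierL2 X g ω) with hE
  have hint : Integrable E :=
    integrable_pair (Lp.memLp _) ((isMultiplier_expTensor X).memLp (fourierL2 X g))
  have e1 : pairHist φ g = ∫ ω, E ω := by
    ext s
    have := (ContinuousMap.evalCLM ℂ s : C(Icc (-1 : ℝ) 0, X) →L[ℂ] X).integral_comp_comm hint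
    simp only [ContinuousMap.evalCLM_apply] at this
    rw [← this]
    exact pair_translate_eq_fourier φ s g
  -- `Φ` is applied under a Bochner integral in `C([-1, 0], X)`.
  rw [e1, ← Φ.integral_comp_comm hint]
  refine integral_congr_ae (Eventually.of_forall fun ω => ?_)
  simp only [hE, map_smul]
  rfl

end Fourier

/-! ### Convolution with an exponentially stable semigroup -/

theorem memLp_expDecay {b : ℝ} (hb : 0 < b) :
    MemLp ((Ici (0 : ℝ)).indicator fun t => ((Real.exp (-b * t) : ℝ) : ℂ)) 2 volume := by
  refine (memLp_indicator_iff_restrict measurableSet_Ici).2 ?_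
  rw [memLp_two_iff_integrable_sq_norm (by fun_prop)]
  refine (((exp_neg_integrableOn_Ioi 0 (by linarith : 0 < 2 * b))).congr_set_ae
    Ioi_ae_eq_Ici.symm).congr (Eventually.of_forall fun t => ?_)
  simp only [Complex.norm_real, Real.norm_eq_abs, Real.abs_exp, ← Real.exp_nat_mul]
  congr 1
  push_cast
  ring

/-- The function `t ↦ 1_{t ≥ 0} e^{-bt}` as an element of `L²(ℝ, ℂ)`. -/
noncomputable def expDecay {b : ℝ} (hb : 0 < b) : LineL2 ℂ := (memLp_expDecay hb).toLp _

theorem coeFn_expDecay {b : ℝ} (hb : 0 < b) :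
    expDecay hb =ᵐ[volume] (Ici (0 : ℝ)).indicator fun t => ((Real.exp (-b * t) : ℝ) : ℂ) :=
  (memLp_expDecay hb).coeFn_toLp

theorem cut_expDecay {b : ℝ} (hb : 0 < b) : cut 0 (expDecay hb) = expDecay hb := by
  refine Lp.ext ?_
  filter_upwards [coeFn_cut 0 (expDecay hb), coeFn_expDecay hb] with t h1 h2
  rw [h1]
  by_cases h : t ∈ Ici (0 : ℝ)
  · rw [indicator_of_mem h]
  · rw [indicator_of_notMem h, h2, indicator_of_notMem h]

/-- Shifting the decaying exponential to the left rescales it on the half-line. -/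
theorem cut_translate_expDecay {b : ℝ} (hb : 0 < b) {r : ℝ} (hr : 0 ≤ r) :
    cut 0 (translate r (expDecay hb)) = ((Real.exp (-b * r) : ℝ) : ℂ) • expDecay hb := by
  refine Lp.ext ?_
  filter_upwards [coeFn_cut 0 (translate r (expDecay hb)), coeFn_translate r (expDecay hb),
    ae_comp_add (coeFn_expDecay hb) r, coeFn_expDecay hb,
    Lp.coeFn_smul ((Real.exp (-b * r) : ℝ) : ℂ) (expDecay hb)] with t h1 h2 h3 h4 h5
  rw [h1, h5, Pi.smul_apply, h4]
  by_cases h : t ∈ Ici (0 : ℝ)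
  · have h' : t + r ∈ Ici (0 : ℝ) := add_nonneg h hr
    rw [indicator_of_mem h, indicator_of_mem h, h2, h3, indicator_of_mem h', smul_eq_mul,
      ← Complex.ofReal_mul, ← Real.exp_add]
    ring_nf
  · rw [indicator_of_notMem h, indicator_of_notMem h, smul_zero]

namespace C0Semigroup

section Stable

variable {X : Type*} [NormedAddCommGroup X] [NormedSpace ℂ X]
  {S : C0Semigroup X} {M w : ℝ}

theorem continuous_uncurry_op (hS : S.HasGrowth M w) :
    Continuous fun p : ℝ × X => S.op p.1.toNNReal p.2 :=
  continuous_iff_continuousAt.2 fun p => tendsto_op_apply hS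
    ((continuous_real_toNNReal.comp continuous_fst).tendsto p) (continuous_snd.tendsto p)

theorem norm_op_toNNReal_le (hS : S.HasGrowth M w) {r : ℝ} (hr : 0 ≤ r) (x : X) :
    ‖S.op r.toNNReal x‖ ≤ M * Real.exp (w * r) * ‖x‖ := by
  have := (S.op r.toNNReal).le_of_opNorm_le (hS r.toNNReal) x
  rwa [Real.coe_toNNReal r hr] at this

theorem norm_indicator_orbit_le (hS : S.HasGrowth M w) (x : X) (t : ℝ) :
    ‖(Ici (0 : ℝ)).indicator (fun t => S.op t.toNNReal x) t‖ ≤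
      M * ‖x‖ * ‖(Ici (0 : ℝ)).indicator (fun t => ((Real.exp (-(-w) * t) : ℝ) : ℂ)) t‖ := by
  by_cases h : t ∈ Ici (0 : ℝ)
  · rw [indicator_of_mem h, indicator_of_mem h, Complex.norm_real, Real.norm_eq_abs, Real.abs_exp,
      neg_neg]
    refine (norm_op_toNNReal_le hS h x).trans_eq (by ring)
  · rw [indicator_of_notMem h, indicator_of_notMem h]
    simp

theorem memLp_orbit (hS : S.HasGrowth M w) (hw : w < 0) (x : X) :
    MemLp ((Ici (0 : ℝ)).indicator fun t => S.op t.toNNReal x) 2 volume :=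
  (memLp_expDecay (neg_pos.2 hw)).of_le_mul
    ((S.continuous_real_orbit x).aestronglyMeasurable.indicator measurableSet_Ici)
    (Eventually.of_forall fun t => norm_indicator_orbit_le hS x t)

/-- The orbit map `x ↦ (t ↦ 1_{t ≥ 0} S(t) x)` of an exponentially stable semigroup, with values
in `L²(ℝ, X)`. -/
noncomputable def orbitL2 (hS : S.HasGrowth M w) (hw : w < 0) : X →L[ℂ] LineL2 X :=
  LinearMap.mkContinuous
    { toFun := fun x => (memLp_orbit hS hw x).toLp _
      map_add' := fun x y => by
        rw [← MemLp.toLp_add]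
        refine MemLp.toLp_congr _ _ (Eventually.of_forall fun t => ?_)
        by_cases h : t ∈ Ici (0 : ℝ) <;> simp [indicator, h]
      map_smul' := fun c x => by
        rw [RingHom.id_apply, ← MemLp.toLp_const_smul]
        refine MemLp.toLp_congr _ _ (Eventually.of_forall fun t => ?_)
        by_cases h : t ∈ Ici (0 : ℝ) <;> simp [indicator, h] }
    (M * ‖expDecay (neg_pos.2 hw)‖) fun x => by
      have h : ∀ᵐ t, ‖(memLp_orbit hS hw x).toLp _ t‖ ≤
          M * ‖x‖ * ‖expDecay (neg_pos.2 hw) t‖ := by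
        filter_upwards [(memLp_orbit hS hw x).coeFn_toLp, coeFn_expDecay (neg_pos.2 hw)]
          with t h1 h2
        rw [h1, h2]
        exact norm_indicator_orbit_le hS x t
      exact (Lp.norm_le_mul_norm_of_ae_le_mul h).trans_eq (by ring)

theorem coeFn_orbitL2 (hS : S.HasGrowth M w) (hw : w < 0) (x : X) :
    orbitL2 hS hw x =ᵐ[volume] (Ici (0 : ℝ)).indicator fun t => S.op t.toNNReal x :=
  (memLp_orbit hS hw x).coeFn_toLp

theorem cut_orbitL2 (hS : S.HasGrowth M w) (hw : w < 0) (x : X) :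
    cut 0 (orbitL2 hS hw x) = orbitL2 hS hw x := by
  refine Lp.ext ?_
  filter_upwards [coeFn_cut 0 (orbitL2 hS hw x), coeFn_orbitL2 hS hw x] with t h1 h2
  rw [h1]
  by_cases h : t ∈ Ici (0 : ℝ)
  · rw [indicator_of_mem h]
  · rw [indicator_of_notMem h, h2, indicator_of_notMem h]

theorem cut_translate_orbitL2 (hS : S.HasGrowth M w) (hw : w < 0) (x : X) (t : ℝ≥0) :
    cut 0 (translate t (orbitL2 hS hw x)) = orbitL2 hS hw (S.op t x) := by
  refine Lp.ext ?_
  filter_upwards [coeFn_cut 0 (translate t (orbitL2 hS hw x)),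
    coeFn_translate t (orbitL2 hS hw x), ae_comp_add (coeFn_orbitL2 hS hw x) t,
    coeFn_orbitL2 hS hw (S.op t x)] with r h1 h2 h3 h4
  rw [h1, h4]
  by_cases h : r ∈ Ici (0 : ℝ)
  · have h' : r + t ∈ Ici (0 : ℝ) := add_nonneg h t.2
    rw [indicator_of_mem h, indicator_of_mem h, h2, h3, indicator_of_mem h',
      Real.toNNReal_add h (NNReal.coe_nonneg t), Real.toNNReal_coe, S.op_add]
    rfl
  · rw [indicator_of_notMem h, indicator_of_notMem h]

/-! ### The value at time zero of the convolution -/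

theorem isMultiplier_evalPast (hS : S.HasGrowth M w) (hw : w < 0) :
    IsMultiplier volume
      (fun t : ℝ => ((Real.exp (w / 2 * t) : ℝ) : ℂ) • S.op (-t).toNNReal) M :=
  .of_continuous (fun t => by
      rw [norm_smul, Complex.norm_real, Real.norm_eq_abs, Real.abs_exp]
      have h := hS (-t).toNNReal
      rcases le_total 0 t with h0 | h0
      · rw [Real.toNNReal_of_nonpos (by linarith)] at h ⊢
        simp only [NNReal.coe_zero, mul_zero, Real.exp_zero, mul_one] at h
        have h1 : Real.exp (w / 2 * t) ≤ 1 := Real.exp_le_one_iff.2 (by nlinarith)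
        exact (mul_le_of_le_one_left (norm_nonneg _) h1).trans h
      · rw [Real.coe_toNNReal _ (by linarith)] at h
        calc _ ≤ Real.exp (w / 2 * t) * (M * Real.exp (w * -t)) := by gcongr
          _ = M * Real.exp (-(w / 2) * t) := by
            rw [mul_left_comm, ← Real.exp_add]; ring_nf
          _ ≤ M * 1 := by
            have := hS.nonneg
            gcongr
            exact Real.exp_le_one_iff.2 (by nlinarith)
          _ = M := mul_one M)
    fun y => by
      have h1 : Continuous fun t : ℝ => ((Real.exp (w / 2 * t) : ℝ) : ℂ) := by fun_prop
      exact h1.smul ((S.continuous_real_orbit y).comp continuous_neg)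

theorem memLp_expGrowth {b : ℝ} (hb : 0 < b) :
    MemLp ((Iic (0 : ℝ)).indicator fun t => ((Real.exp (b * t) : ℝ) : ℂ)) 2 volume := by
  refine (memLp_indicator_iff_restrict measurableSet_Iic).2 ?_
  rw [memLp_two_iff_integrable_sq_norm (by fun_prop)]
  refine (integrableOn_exp_mul_Iic (by linarith : 0 < 2 * b) 0).congr
    (Eventually.of_forall fun t => ?_)
  simp only [Complex.norm_real, Real.norm_eq_abs, Real.abs_exp, ← Real.exp_nat_mul]
  congr 1
  push_cast
  ring

variable [CompleteSpace X]

/-- The bounded functional `g ↦ ∫_{-∞}^0 S(-t) g(t) dt`: the value at time `0` of the convolution of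
`S` with `g`. The weight `e^{wt/2}` is shifted from the kernel to the operator family, which splits
the integral into a scalar pairing and a bounded multiplication. -/
noncomputable def evalPast (hS : S.HasGrowth M w) (hw : w < 0) : LineL2 X →L[ℂ] X :=
  (pair ((memLp_expGrowth (by linarith : 0 < -w / 2)).toLp _)).comp
    (mulOp (isMultiplier_evalPast hS hw))

theorem evalPast_apply (hS : S.HasGrowth M w) (hw : w < 0) (g : LineL2 X) :
    evalPast hS hw g = ∫ t in Iic (0 : ℝ), S.op (-t).toNNReal (g t) := by
  rw [evalPast, ContinuousLinearMap.comp_apply, pair_toLp, ← integral_indicator measurableSet_Iic]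
  refine integral_congr_ae ?_
  filter_upwards [coeFn_mulOp (isMultiplier_evalPast hS hw) g] with t ht
  rw [ht]
  by_cases h : t ∈ Iic (0 : ℝ)
  · rw [indicator_of_mem h, indicator_of_mem h, smul_apply, smul_smul, ← Complex.ofReal_mul,
      ← Real.exp_add]
    ring_nf
    simp
  · rw [indicator_of_notMem h, indicator_of_notMem h, zero_smul]

theorem evalPast_translate (hS : S.HasGrowth M w) (hw : w < 0) (s : ℝ) (g : LineL2 X) :
    evalPast hS hw (translate s g) = ∫ t in Iic (0 : ℝ), S.op (-t).toNNReal (g (t + s)) := by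
  rw [evalPast_apply]
  refine integral_congr_ae ?_
  filter_upwards [ae_restrict_of_ae (coeFn_translate s g)] with t ht
  rw [ht]

theorem evalPast_translate_eq_conv (hS : S.HasGrowth M w) (hw : w < 0) (s : ℝ) (g : LineL2 X) :
    evalPast hS hw (translate s g) = ∫ r in Ioi (0 : ℝ), S.op r.toNNReal (g (s - r)) := by
  rw [evalPast_translate, ← neg_zero, ← integral_comp_neg_Iic]
  simp [sub_eq_add_neg, add_comm]

/-- The value at time `0` does not depend on the future. -/
theorem evalPast_cut (hS : S.HasGrowth M w) (hw : w < 0) {b : ℝ} (hb : 0 ≤ b) (g : LineL2 X) :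
    evalPast hS hw (cut b g) = 0 := by
  rw [evalPast_apply]
  refine integral_eq_zero_of_ae ?_
  filter_upwards [ae_restrict_of_ae (coeFn_cut b g), ae_restrict_mem measurableSet_Iic,
    ae_restrict_of_ae (Measure.ae_ne volume (0 : ℝ))] with t h1 h2 h3
  have h4 : t < 0 := lt_of_le_of_ne h2 h3
  rw [h1, indicator_of_notMem (by simp; linarith), map_zero, Pi.zero_apply]

/-- Functions supported in the past are propagated by the semigroup. -/
theorem evalPast_translate_past (hS : S.HasGrowth M w) (hw : w < 0) (t : ℝ≥0) (g : LineL2 X) :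
    evalPast hS hw (translate t (g - cut 0 g)) = S.op t (evalPast hS hw g) := by
  have ht : (0 : ℝ) ≤ t := t.2
  have hint : IntegrableOn (fun r : ℝ => S.op (-r).toNNReal (g r)) (Iic (0 : ℝ)) := by
    have h1 := integrable_pair (memLp_expGrowth (by linarith : 0 < -w / 2))
      ((isMultiplier_evalPast hS hw).memLp g)
    refine h1.integrableOn.congr ?_
    filter_upwards [ae_restrict_mem measurableSet_Iic] with r hr
    rw [indicator_of_mem hr, smul_apply, smul_smul, ← Complex.ofReal_mul, ← Real.exp_add]
    ring_nf
    simp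
  rw [evalPast_translate, evalPast_apply, ← (S.op t).integral_comp_comm hint,
    ← integral_indicator measurableSet_Iic, ← integral_indicator measurableSet_Iic]
  refine Eq.trans (integral_congr_ae ?_) (integral_add_right_eq_self
    ((Iic (0 : ℝ)).indicator fun r => S.op t (S.op (-r).toNNReal (g r))) (t : ℝ))
  filter_upwards [ae_comp_add (Lp.coeFn_sub g (cut 0 g)) t, ae_comp_add (coeFn_cut 0 g) t,
    ae_comp_add (Measure.ae_ne volume (0 : ℝ)) t] with r h1 h2 h3
  rcases lt_or_gt_of_ne h3 with h | h
  · have hr : r ∈ Iic (0 : ℝ) := by simp only [mem_Iic]; linarith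
    have hr' : r + t ∈ Iic (0 : ℝ) := h.le
    rw [indicator_of_mem hr, indicator_of_mem hr', h1, Pi.sub_apply, h2,
      indicator_of_notMem (by simpa using h), sub_zero, ← ContinuousLinearMap.comp_apply, ← S.op_add]
    congr 2
    have e : t = (t : ℝ).toNNReal := Real.toNNReal_coe.symm
    rw [e, ← Real.toNNReal_add (by simp) (by rw [← e]; linarith), ← e]
    congr 1
    ring
  · rw [indicator_of_notMem (show r + t ∉ Iic (0 : ℝ) by simpa using h)]
    by_cases hr : r ∈ Iic (0 : ℝ)
    · rw [indicator_of_mem hr, h1, Pi.sub_apply, h2, indicator_of_mem (mem_Ici.2 h.le), sub_self,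
        map_zero]
    · rw [indicator_of_notMem hr]

/-- Interchange of a Lebesgue integral with convolution by the semigroup. -/
theorem integral_integral_op_swap (hS : S.HasGrowth M w) (hw : w < 0) {p : ℝ → ℝ → X}
    (hp : StronglyMeasurable (Function.uncurry p)) (hi : ∀ r, Integrable (p r)) {C : ℝ}
    (hC : ∀ r, ∫ t, ‖p r t‖ ≤ C) :
    ∫ t, ∫ r in Ioi (0 : ℝ), S.op r.toNNReal (p r t) =
      ∫ r in Ioi (0 : ℝ), S.op r.toNNReal (∫ t, p r t) := by
  have hm : StronglyMeasurable fun q : ℝ × ℝ => S.op q.1.toNNReal (p q.1 q.2) :=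
    (continuous_uncurry_op hS).comp_stronglyMeasurable (measurable_fst.stronglyMeasurable.prodMk hp)
  have hC0 : 0 ≤ C := (integral_nonneg fun t => norm_nonneg _).trans (hC 0)
  have hI : Integrable (fun q : ℝ × ℝ => S.op q.1.toNNReal (p q.1 q.2))
      ((volume.restrict (Ioi (0 : ℝ))).prod volume) := by
    refine (integrable_prod_iff hm.aestronglyMeasurable).2 ⟨?_, ?_⟩
    · exact Eventually.of_forall fun r => (S.op r.toNNReal).integrable_comp (hi r)
    · have hE : IntegrableOn (fun r : ℝ => M * C * Real.exp (-(-w) * r)) (Ioi 0) :=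
        (exp_neg_integrableOn_Ioi 0 (neg_pos.2 hw)).const_mul (M * C)
      refine Integrable.mono' hE
        (StronglyMeasurable.integral_prod_right' (ν := volume)
          (f := fun q : ℝ × ℝ => ‖S.op q.1.toNNReal (p q.1 q.2)‖) hm.norm).aestronglyMeasurable ?_
      filter_upwards [ae_restrict_mem measurableSet_Ioi] with r hr
      rw [Real.norm_of_nonneg (integral_nonneg fun t => norm_nonneg _), neg_neg]
      have hr' : (0 : ℝ) ≤ r := le_of_lt hr
      calc _ ≤ ∫ t, M * Real.exp (w * r) * ‖p r t‖ :=
            integral_mono ((S.op r.toNNReal).integrable_comp (hi r)).norm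
              ((hi r).norm.const_mul _) fun t => norm_op_toNNReal_le hS hr' _
        _ = M * Real.exp (w * r) * ∫ t, ‖p r t‖ := integral_const_mul _ _
        _ ≤ M * Real.exp (w * r) * C := by
            have := hS.nonneg
            gcongr
            exact hC r
        _ = _ := by ring
  rw [← integral_integral_swap hI]
  exact integral_congr_ae (Eventually.of_forall fun r =>
    (S.op r.toNNReal).integral_comp_comm (hi r))

/-- Interchange of the pairing with convolution by the semigroup, along translations to the left
(`σ = 1`) or to the right (`σ = -1`). -/
theorem integral_smul_conv_swap (hS : S.HasGrowth M w) (hw : w < 0) (φ : LineL2 ℂ) (g : LineL2 X)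
    (σ : ℝ) :
    ∫ t, φ t • ∫ r in Ioi (0 : ℝ), S.op r.toNNReal (g (t + σ * r)) =
      ∫ r in Ioi (0 : ℝ), S.op r.toNNReal (pair φ (translate (σ * r) g)) := by
  set p : ℝ → ℝ → X := fun r t => φ t • g (t + σ * r) with hp
  have hpm : StronglyMeasurable (Function.uncurry p) :=
    ((Lp.stronglyMeasurable φ).comp_measurable measurable_snd).smul
      ((Lp.stronglyMeasurable g).comp_measurable
        (measurable_snd.add (measurable_fst.const_mul σ)))
  have hg2 : Integrable fun t => ‖g t‖ ^ 2 :=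
    (memLp_two_iff_integrable_sq_norm (Lp.aestronglyMeasurable g)).1 (Lp.memLp g)
  have hφ2 : Integrable fun t => ‖φ t‖ ^ 2 :=
    (memLp_two_iff_integrable_sq_norm (Lp.aestronglyMeasurable φ)).1 (Lp.memLp φ)
  have hle : ∀ r t, ‖p r t‖ ≤ ‖φ t‖ ^ 2 + ‖g (t + σ * r)‖ ^ 2 := fun r t => by
    rw [hp]
    dsimp only
    rw [norm_smul]
    nlinarith [sq_nonneg (‖φ t‖ - ‖g (t + σ * r)‖),
      mul_nonneg (norm_nonneg (φ t)) (norm_nonneg (g (t + σ * r)))]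
  have hbi : ∀ r, Integrable fun t => ‖φ t‖ ^ 2 + ‖g (t + σ * r)‖ ^ 2 := fun r =>
    hφ2.add (hg2.comp_add_right (σ * r))
  have hpi : ∀ r, Integrable (p r) := fun r =>
    (hbi r).mono' (hpm.comp_measurable measurable_prodMk_left).aestronglyMeasurable
      (Eventually.of_forall fun t => hle r t)
  have key := integral_integral_op_swap hS hw hpm hpi
    (C := (∫ t, ‖φ t‖ ^ 2) + ∫ t, ‖g t‖ ^ 2) fun r => by
      refine (integral_mono (hpi r).norm (hbi r) (hle r)).trans_eq ?_
      rw [integral_add hφ2 (hg2.comp_add_right (σ * r)),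
        integral_add_right_eq_self (fun t => ‖g t‖ ^ 2) (σ * r)]
  refine Eq.trans (integral_congr_ae (Eventually.of_forall fun t => ?_)) (key.trans
    (integral_congr_ae (Eventually.of_forall fun r => ?_)))
  · dsimp only
    rw [← integral_smul]
    refine integral_congr_ae (Eventually.of_forall fun r => ?_)
    simp only [hp, map_smul]
  · dsimp only
    rw [pair_apply]
    congr 1
    refine integral_congr_ae ?_
    filter_upwards [coeFn_translate (σ * r) g] with t ht
    rw [ht]

end Stable

/-! ### The convolution as a Fourier multiplier -/

section Convolution

variable {X : Type*} [NormedAddCommGroup X] [InnerProductSpace ℂ X]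
  {S : C0Semigroup X} {M w : ℝ}

/-- The Laplace transform on the imaginary axis. -/
noncomputable def laplaceI (hS : S.HasGrowth M w) (hw : w < 0) (ω : ℝ) : X →L[ℂ] X :=
  S.laplace hS (z := Complex.I * (ω : ℂ)) (by simpa using hw)

theorem isMultiplier_laplaceI (hS : S.HasGrowth M w) (hw : w < 0) {c : ℝ}
    (hc : ∀ ω, ‖laplaceI hS hw ω‖ ≤ c) :
    IsMultiplier volume (fun ω : ℝ => laplaceI hS hw (2 * Real.pi * ω)) c :=
  .of_continuous (fun _ => hc _) fun y => by
    refine continuous_of_dominated (bound := fun r => M * ‖y‖ * Real.exp (-(-w) * r))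
      (fun ω => (S.continuous_exp_smul_op _ y).aestronglyMeasurable) (fun ω => ?_)
      ((exp_neg_integrableOn_Ioi 0 (neg_pos.2 hw)).const_mul _)
      (Eventually.of_forall fun r => by fun_prop)
    filter_upwards [ae_restrict_mem measurableSet_Ioi] with r hr
    refine (norm_exp_smul_op_le hS _ y (le_of_lt hr)).trans_eq ?_
    simp

variable [CompleteSpace X]

/-- Convolution with `S` on `L²(ℝ, X)`, as the Fourier multiplier whose symbol is the resolvent on
the imaginary axis. -/
noncomputable def convOp (hS : S.HasGrowth M w) (hw : w < 0) {c : ℝ}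
    (hc : ∀ ω, ‖laplaceI hS hw ω‖ ≤ c) : LineL2 X →L[ℂ] LineL2 X :=
  fourierMul (isMultiplier_laplaceI hS hw hc)

variable (hS : S.HasGrowth M w) (hw : w < 0) {c : ℝ} (hc : ∀ ω, ‖laplaceI hS hw ω‖ ≤ c)

/-- The Fourier multiplier with symbol `R(iω, A)` is convolution with `S`, after pairing. -/
theorem pair_convOp (φ : LineL2 ℂ) (g : LineL2 X) :
    pair φ (convOp hS hw hc g) =
      ∫ r in Ioi (0 : ℝ), S.op r.toNNReal (pair φ (translate (-r) g)) := by
  set ψ := (fourierL2 ℂ).symm φ with hψ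
  set u := fourierL2 X g with hu
  set p : ℝ → ℝ → X := fun r ω =>
    ψ ω • Complex.exp (Complex.I * ((2 * Real.pi * ω : ℝ) : ℂ) * ((-r : ℝ) : ℂ)) • u ω with hp
  have hpn : ∀ r ω, ‖p r ω‖ = ‖ψ ω • u ω‖ := fun r ω => by
    have e : Complex.I * ((2 * Real.pi * ω : ℝ) : ℂ) * ((-r : ℝ) : ℂ) =
      ((2 * Real.pi * ω * -r : ℝ) : ℂ) * Complex.I := by push_cast; ring
    rw [hp]
    dsimp only
    rw [norm_smul, norm_smul, e, Complex.norm_exp_ofReal_mul_I, one_mul, norm_smul]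
  have hpm : StronglyMeasurable (Function.uncurry p) := by
    have h1 : Continuous fun q : ℝ × ℝ =>
      Complex.exp (Complex.I * ((2 * Real.pi * q.2 : ℝ) : ℂ) * ((-q.1 : ℝ) : ℂ)) := by fun_prop
    exact ((Lp.stronglyMeasurable ψ).comp_measurable measurable_snd).smul
      (h1.stronglyMeasurable.smul ((Lp.stronglyMeasurable u).comp_measurable measurable_snd))
  have hI : Integrable fun ω => ψ ω • u ω := integrable_pair (Lp.memLp ψ) (Lp.memLp u)
  have hpi : ∀ r, Integrable (p r) := fun r =>
    hI.mono (hpm.comp_measurable measurable_prodMk_left).aestronglyMeasurable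
      (Eventually.of_forall fun ω => (hpn r ω).le)
  have key := integral_integral_op_swap hS hw hpm hpi (C := ∫ ω, ‖ψ ω • u ω‖)
    fun r => (integral_congr_ae (Eventually.of_forall fun ω => hpn r ω)).le
  rw [convOp, pair_fourierMul]
  refine Eq.trans (integral_congr_ae (Eventually.of_forall fun ω => ?_)) (key.trans
    (integral_congr_ae (Eventually.of_forall fun r => ?_)))
  · dsimp only
    rw [laplaceI, laplace_apply, ← integral_smul]
    refine integral_congr_ae (Eventually.of_forall fun r => ?_)
    simp only [hp, map_smul]
    congr 3
    push_cast
    ring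
  · dsimp only
    rw [pair_translate_eq_fourier]

/-- The convolution has a continuous representative, given by `evalPast` on translates. -/
theorem coeFn_convOp (g : LineL2 X) :
    convOp hS hw hc g =ᵐ[volume] fun t => evalPast hS hw (translate t g) := by
  have hcont : Continuous fun t => evalPast hS hw (translate t g) :=
    (evalPast hS hw).continuous.comp (continuous_translate g)
  refine ae_eq_of_integral_contDiff_smul_eq ((Lp.memLp _).locallyIntegrable (by norm_num))
    hcont.locallyIntegrable fun φ hφ hφc => ?_
  have hm : MemLp (fun t => (φ t : ℂ)) 2 volume :=
    (Complex.continuous_ofReal.comp hφ.continuous).memLp_of_hasCompactSupport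
      (hφc.comp_left Complex.ofReal_zero)
  have h1 := pair_convOp hS hw hc (hm.toLp _) g
  rw [pair_toLp] at h1
  simp only [Complex.coe_smul] at h1
  rw [h1]
  have h2 := integral_smul_conv_swap hS hw (hm.toLp _) g (-1)
  simp only [neg_one_mul] at h2
  rw [← h2]
  refine integral_congr_ae ?_
  filter_upwards [hm.coeFn_toLp] with t ht
  rw [ht, evalPast_translate_eq_conv, Complex.coe_smul]
  simp only [sub_eq_add_neg]

theorem convOp_translate (s : ℝ) (g : LineL2 X) :
    convOp hS hw hc (translate s g) = translate s (convOp hS hw hc g) := by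
  refine Lp.ext ?_
  filter_upwards [coeFn_convOp hS hw hc (translate s g), coeFn_translate s (convOp hS hw hc g),
    ae_comp_add (coeFn_convOp hS hw hc g) s] with t h1 h2 h3
  rw [h1, h2, h3, translate_translate]

/-- Convolution with `S` is causal. -/
theorem cut_convOp_cut (a : ℝ) (g : LineL2 X) :
    cut a (convOp hS hw hc (cut a g)) = convOp hS hw hc (cut a g) := by
  refine Lp.ext ?_
  filter_upwards [coeFn_cut a (convOp hS hw hc (cut a g)), coeFn_convOp hS hw hc (cut a g)]
    with t h1 h2
  rw [h1]
  by_cases h : t ∈ Ici a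
  · rw [indicator_of_mem h]
  · rw [indicator_of_notMem h, h2, translate_cut, evalPast_cut]
    simp only [mem_Ici, not_le] at h
    linarith

/-- The convolution of a function supported in the past is, on the half-line, an orbit. -/
theorem cut_convOp_past (g : LineL2 X) :
    cut 0 (convOp hS hw hc (g - cut 0 g)) = orbitL2 hS hw (evalPast hS hw g) := by
  refine Lp.ext ?_
  filter_upwards [coeFn_cut 0 (convOp hS hw hc (g - cut 0 g)),
    coeFn_convOp hS hw hc (g - cut 0 g), coeFn_orbitL2 hS hw (evalPast hS hw g)] with t h1 h2 h3
  rw [h1, h3]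
  by_cases h : t ∈ Ici (0 : ℝ)
  · rw [indicator_of_mem h, indicator_of_mem h, h2, ← evalPast_translate_past,
      Real.coe_toNNReal t h]
  · rw [indicator_of_notMem h, indicator_of_notMem h]

end Convolution

end C0Semigroup

/-! ### Causality of the delay operator on the line -/

section DelayOp

variable {X : Type*} [NormedAddCommGroup X] [InnerProductSpace ℂ X] [CompleteSpace X]

theorem pairHist_translate (φ : LineL2 ℂ) (s : ℝ) (g : LineL2 X) :
    pairHist φ (translate s g) = pairHist (translate (-s) φ) g := by
  ext r
  change pair φ (translate r (translate s g)) = pair (translate (-s) φ) (translate r g)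
  rw [← pair_translate, translate_translate, translate_translate, add_comm]

/-- For times `t ≥ 0` the histories `g_t` only involve the values of `g` from time `-1` on. -/
theorem pairHist_cut_cut (φ : LineL2 ℂ) (g : LineL2 X) :
    pairHist (cut 0 φ) (cut (-1) g) = pairHist (cut 0 φ) g := by
  ext r
  change pair (cut 0 φ) (translate r (cut (-1) g)) = pair (cut 0 φ) (translate r g)
  rw [translate_cut, pair_cut, cut_cut, max_eq_right (by linarith [r.2.1])]

/-- If `g` is supported on the half-line, then its histories `g_t` vanish for `t < 0`. -/
theorem pairHist_cut_right (φ : LineL2 ℂ) (g : LineL2 X) :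
    pairHist (cut 0 φ) (cut 0 g) = pairHist φ (cut 0 g) := by
  ext r
  change pair (cut 0 φ) (translate r (cut 0 g)) = pair φ (translate r (cut 0 g))
  rw [← pair_cut, translate_cut, cut_cut, max_eq_right (by linarith [r.2.2])]

variable (Φ : C(Icc (-1 : ℝ) 0, X) →L[ℂ] X) {c : ℝ}
  (hc : ∀ ω : ℝ, ‖Φ.comp (expTensor X (Complex.I * (ω : ℂ)))‖ ≤ c)

/-- The operator `(N g)(t) = Φ(g_t)` on `L²(ℝ, X)`, where `g_t(s) = g(t + s)`. -/
noncomputable def delayOp : LineL2 X →L[ℂ] LineL2 X := fourierMul (isMultiplier_delay Φ hc)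

theorem pair_delayOp (φ : LineL2 ℂ) (g : LineL2 X) :
    pair φ (delayOp Φ hc g) = Φ (pairHist φ g) :=
  pair_fourierMul_delay Φ hc φ g

theorem delayOp_translate (s : ℝ) (g : LineL2 X) :
    delayOp Φ hc (translate s g) = translate s (delayOp Φ hc g) :=
  eq_of_forall_pair fun φ => by
    rw [pair_delayOp, pairHist_translate, ← pair_delayOp Φ hc, ← pair_translate]

/-- The delay is at most one: on the half-line, `N g` depends on `g` only from time `-1` on. -/
theorem cut_delayOp_cut_neg_one (g : LineL2 X) :
    cut 0 (delayOp Φ hc (cut (-1) g)) = cut 0 (delayOp Φ hc g) :=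
  eq_of_forall_pair fun φ => by
    rw [pair_cut, pair_delayOp, pairHist_cut_cut, ← pair_delayOp Φ hc, ← pair_cut]

/-- The delay operator is causal. -/
theorem cut_delayOp_cut (g : LineL2 X) :
    cut 0 (delayOp Φ hc (cut 0 g)) = delayOp Φ hc (cut 0 g) :=
  eq_of_forall_pair fun φ => by
    rw [pair_cut, pair_delayOp, pairHist_cut_right, ← pair_delayOp Φ hc]

end DelayOp

/-! ### Solution of the delay equation in `L²` -/

/-- The data of a delay equation `u'(t) = A u(t) + Φ u_t` satisfying the smallness condition on the
imaginary axis, with an exponentially stable semigroup `S` generated by `A`. The operator `A` only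
enters through `S`; its resolvent on the imaginary axis is the Laplace transform of `S`. -/
structure StableDelay (X : Type*) [NormedAddCommGroup X] [InnerProductSpace ℂ X] where
  /-- the semigroup of the equation without delay -/
  S : C0Semigroup X
  /-- the growth constant of `S` -/
  M : ℝ
  /-- the exponential rate of `S` -/
  w : ℝ
  growth : S.HasGrowth M w
  w_neg : w < 0
  /-- the delay functional -/
  Φ : C(Icc (-1 : ℝ) 0, X) →L[ℂ] X
  /-- the bound of the resolvent on the imaginary axis -/
  cR : ℝ
  /-- the bound of the delay symbol on the imaginary axis -/
  cΦ : ℝ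
  norm_resolvent_le : ∀ ω, ‖C0Semigroup.laplaceI growth w_neg ω‖ ≤ cR
  norm_symbol_le : ∀ ω : ℝ, ‖Φ.comp (expTensor X (Complex.I * (ω : ℂ)))‖ ≤ cΦ
  small : cR * cΦ < 1

namespace StableDelay

open C0Semigroup

variable {X : Type*} [NormedAddCommGroup X] [InnerProductSpace ℂ X] [CompleteSpace X]
  (D : StableDelay X)

/-- Convolution with the semigroup `S`. -/
noncomputable def K : LineL2 X →L[ℂ] LineL2 X := convOp D.growth D.w_neg D.norm_resolvent_le

/-- The delay operator `g ↦ (t ↦ Φ(g_t))`. -/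
noncomputable def N : LineL2 X →L[ℂ] LineL2 X := delayOp D.Φ D.norm_symbol_le

/-- The orbits of `S` on the half-line. -/
noncomputable def σ : X →L[ℂ] LineL2 X := orbitL2 D.growth D.w_neg

/-- The value at time zero of the convolution with `S`. -/
noncomputable def ev : LineL2 X →L[ℂ] X := evalPast D.growth D.w_neg

theorem norm_KN_lt : ‖D.K.comp D.N‖ < 1 :=
  calc _ ≤ ‖D.K‖ * ‖D.N‖ := ContinuousLinearMap.opNorm_comp_le _ _
    _ ≤ D.cR * D.cΦ := mul_le_mul (norm_fourierMul_le _) (norm_fourierMul_le _) (norm_nonneg _)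
        ((norm_nonneg _).trans (D.norm_resolvent_le 0))
    _ < 1 := D.small

theorem eq_zero_of_eq_KN {v : LineL2 X} (h : v = D.K (D.N v)) : v = 0 := by
  by_contra hv
  have h1 := (D.K.comp D.N).le_opNorm v
  rw [ContinuousLinearMap.comp_apply, ← h] at h1
  have h2 := mul_lt_of_lt_one_left (norm_pos_iff.2 hv) D.norm_KN_lt
  linarith

/-- The inverse of `1 - KN`, given by the Neumann series. -/
noncomputable def neumann : LineL2 X →L[ℂ] LineL2 X :=
  ((Units.oneSub (D.K.comp D.N) D.norm_KN_lt)⁻¹ : (LineL2 X →L[ℂ] LineL2 X)ˣ)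

theorem neumann_eq (b : LineL2 X) : D.neumann b = b + D.K (D.N (D.neumann b)) := by
  have h := (Units.oneSub (D.K.comp D.N) D.norm_KN_lt).mul_inv
  have h2 := congrArg (fun T : LineL2 X →L[ℂ] LineL2 X => T b) h
  simp only [Units.val_oneSub, mul_apply_eq_comp, sub_apply,
    one_apply_eq_self, ContinuousLinearMap.comp_apply] at h2
  exact sub_eq_iff_eq_add.1 h2

/-- The first component. -/
noncomputable abbrev fstL : DelaySpace X →L[ℂ] X := WithLp.fstL 2 ℂ X (Lp X 2 delayMeasure)

/-- The second component. -/
noncomputable abbrev sndL : DelaySpace X →L[ℂ] Lp X 2 (delayMeasure) :=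
  WithLp.sndL 2 ℂ X (Lp X 2 delayMeasure)

/-- The solution on the whole line with initial value `x` and history `f`: it is `f` on `[-1, 0]`,
vanishes before, and on the half-line solves the variation of constants formula. -/
noncomputable def sol : DelaySpace X →L[ℂ] LineL2 X :=
  extend.comp sndL + D.neumann.comp (D.σ.comp fstL + D.K.comp ((cut 0).comp
    (D.N.comp (extend.comp sndL))))

theorem cut_K_cut (g : LineL2 X) : cut 0 (D.K (cut 0 g)) = D.K (cut 0 g) :=
  cut_convOp_cut D.growth D.w_neg D.norm_resolvent_le 0 g

theorem cut_N_cut (g : LineL2 X) : cut 0 (D.N (cut 0 g)) = D.N (cut 0 g) :=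
  cut_delayOp_cut D.Φ D.norm_symbol_le g

/-- The fixed point `v` of the Neumann series is supported on the half-line, because its part `d` in
the past satisfies `‖d‖ ≤ ‖K N d‖`. -/
theorem cut_sol_aux (z : DelaySpace X) :
    cut 0 (D.sol z) = D.σ z.fst + D.K (cut 0 (D.N (D.sol z))) ∧
      D.sol z - cut 0 (D.sol z) = extend z.snd := by
  set b := D.σ z.fst + D.K (cut 0 (D.N (extend z.snd))) with hb
  set v := D.neumann b with hv
  have hsol : D.sol z = extend z.snd + v := rfl
  have hbc : cut 0 b = b := by
    rw [hb, map_add, cut_K_cut]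
    congr 1
    exact cut_orbitL2 D.growth D.w_neg z.fst
  have hvb : v = b + D.K (D.N v) := D.neumann_eq b
  have hvc : cut 0 v = v := by
    have h1 : D.N v = D.N (cut 0 v) + D.N (v - cut 0 v) := by rw [← map_add]; congr 1; abel
    have h2 : v - cut 0 v = D.K (D.N (v - cut 0 v)) -
        cut 0 (D.K (D.N (v - cut 0 v))) := by
      have h3 : cut 0 (D.K (D.N (cut 0 v))) = D.K (D.N (cut 0 v)) := by
        rw [← cut_N_cut, cut_K_cut]
      have h4 : v = b + D.K (D.N (cut 0 v)) + D.K (D.N (v - cut 0 v)) := by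
        rw [add_assoc, ← map_add, ← h1]; exact hvb
      have h5 := congrArg (cut 0) h4
      rw [map_add, map_add, h3, hbc] at h5
      have h6 := congrArg₂ (· - ·) h4 h5
      rwa [add_sub_add_left_eq_sub] at h6
    set d := v - cut 0 v with hd
    have hd0 : d = 0 := by
      by_contra hne
      have h3 : ‖d‖ ≤ ‖D.K (D.N d)‖ := by
        have h6 : ∀ᵐ t, ‖d t‖ ≤ ‖D.K (D.N d) t‖ := by
          filter_upwards [Lp.coeFn_sub (D.K (D.N d)) (cut 0 (D.K (D.N d))),
            coeFn_cut 0 (D.K (D.N d))] with t h7 h8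
          rw [← h2, Pi.sub_apply, h8] at h7
          rw [h7]
          by_cases ht : t ∈ Ici (0 : ℝ)
          · rw [indicator_of_mem ht]; simp
          · rw [indicator_of_notMem ht, sub_zero]
        exact Lp.norm_le_norm_of_ae_le h6
      have h4 := (D.K.comp D.N).le_opNorm d
      have h5 := mul_lt_of_lt_one_left (norm_pos_iff.2 hne) D.norm_KN_lt
      rw [ContinuousLinearMap.comp_apply] at h4
      linarith
    exact (sub_eq_zero.1 hd0).symm
  have hcut : cut 0 (D.sol z) = v := by rw [hsol, map_add, cut_zero_extend, zero_add, hvc]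
  refine ⟨?_, ?_⟩
  · rw [hcut, hsol, map_add, map_add, map_add, ← add_assoc, ← hb]
    nth_rewrite 1 [hvb]
    congr 2
    rw [← hvc, cut_N_cut, hvc]
  · rw [hcut, hsol, add_sub_cancel_right]

/-- The variation of constants formula on the half-line. -/
theorem cut_sol (z : DelaySpace X) :
    cut 0 (D.sol z) = D.σ z.fst + D.K (cut 0 (D.N (D.sol z))) := (D.cut_sol_aux z).1

/-- The solution has the prescribed history. -/
theorem sol_sub_cut (z : DelaySpace X) : D.sol z - cut 0 (D.sol z) = extend z.snd :=
  (D.cut_sol_aux z).2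

theorem sol_unique {z : DelaySpace X} {v : LineL2 X}
    (h1 : cut 0 v = D.σ z.fst + D.K (cut 0 (D.N v))) (h2 : v - cut 0 v = extend z.snd) :
    v = D.sol z := by
  rw [← sub_eq_zero]
  set d := v - D.sol z with hd
  have e1 : cut 0 d = d := by
    have := h2.trans (D.sol_sub_cut z).symm
    rw [hd, map_sub]
    exact (sub_eq_sub_iff_sub_eq_sub.1 this).symm
  have e2 : cut 0 d = D.K (cut 0 (D.N d)) := by
    rw [hd, map_sub, h1, D.cut_sol, map_sub, map_sub, map_sub]
    abel
  refine D.eq_zero_of_eq_KN ?_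
  calc d = cut 0 d := e1.symm
    _ = D.K (cut 0 (D.N (cut 0 d))) := by rw [e1, ← e2, e1]
    _ = D.K (D.N d) := by rw [cut_N_cut, e1]

/-! ### The delay semigroup -/

/-- The forcing term `1_{t ≥ 0} Φ(v_t)` of the solution `v`. -/
noncomputable def forcing : DelaySpace X →L[ℂ] LineL2 X := (cut 0).comp (D.N.comp D.sol)

theorem forcing_apply (z : DelaySpace X) : D.forcing z = cut 0 (D.N (D.sol z)) := rfl

/-- The delay semigroup at time `t`: the value and the history at time `t` of the solution. The value
is taken from the variation of constants formula, as `sol` is only defined almost everywhere. -/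
noncomputable def flow (t : ℝ≥0) : DelaySpace X →L[ℂ] DelaySpace X :=
  ((WithLp.prodContinuousLinearEquiv 2 ℂ X (Lp X 2 delayMeasure)).symm :
    X × Lp X 2 (delayMeasure) →L[ℂ] DelaySpace X).comp
    (((D.S.op t).comp fstL + D.ev.comp ((translate t).comp D.forcing)).prod
      (restr.comp ((translate t).comp D.sol)))

theorem flow_fst (t : ℝ≥0) (z : DelaySpace X) :
    (D.flow t z).fst = D.S.op t z.fst + D.ev (translate t (D.forcing z)) := rfl

theorem flow_snd (t : ℝ≥0) (z : DelaySpace X) :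
    (D.flow t z).snd = restr (translate t (D.sol z)) := rfl

/-- The solution with the data at time `t` is the shifted solution, as both satisfy the variation of
constants formula. -/
theorem sol_flow (t : ℝ≥0) (z : DelaySpace X) :
    D.sol (D.flow t z) = cut (-1) (translate t (D.sol z)) := by
  symm
  apply D.sol_unique
  · have h1 : cut 0 (D.N (cut (-1) (translate t (D.sol z)))) =
        cut 0 (translate t (D.forcing z)) := by
      rw [N, cut_delayOp_cut_neg_one, delayOp_translate, forcing_apply, cut_translate_cut]; rfl
    rw [h1, cut_cut, max_eq_left (by norm_num), ← cut_translate_cut, cut_sol, ← forcing_apply,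
      map_add, map_add, flow_fst, map_add, add_assoc]
    congr 1
    · exact cut_translate_orbitL2 D.growth D.w_neg z.fst t
    -- The forcing before time `t` contributes an orbit of `S`, the later one a convolution.
    · set n := translate (t : ℝ) (D.forcing z)
      have h2 : translate (t : ℝ) (D.K (D.forcing z)) = D.K n :=
        (convOp_translate D.growth D.w_neg D.norm_resolvent_le t _).symm
      have h3 : D.K n = D.K (n - cut 0 n) + D.K (cut 0 n) := by rw [← map_add]; congr 1; abel
      rw [h2, h3, map_add, cut_K_cut]
      congr 1
      exact cut_convOp_past D.growth D.w_neg D.norm_resolvent_le n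
  · rw [cut_cut, max_eq_left (by norm_num), flow_snd, extend_restr]

theorem forcing_flow (t : ℝ≥0) (z : DelaySpace X) :
    D.forcing (D.flow t z) = cut 0 (translate t (D.forcing z)) := by
  rw [forcing_apply, sol_flow, N, cut_delayOp_cut_neg_one, delayOp_translate, forcing_apply,
    cut_translate_cut]
  rfl

/-- The delay semigroup. -/
noncomputable def semigroup : C0Semigroup (DelaySpace X) where
  op := D.flow
  op_zero := by
    ext1 z
    refine WithLp.ofLp_injective 2 (Prod.ext ?_ ?_)
    · change (D.flow 0 z).fst = z.fst
      rw [flow_fst, D.S.op_zero, NNReal.coe_zero, translate_zero, forcing_apply]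
      simp [ev, evalPast_cut]
    · change (D.flow 0 z).snd = z.snd
      rw [flow_snd, NNReal.coe_zero, translate_zero, ← restr_extend z.snd, ← D.sol_sub_cut,
        map_sub, restr_eq_zero_of_cut, sub_zero]
  op_add s t := by
    ext1 z
    refine WithLp.ofLp_injective 2 (Prod.ext ?_ ?_)
    · change (D.flow (s + t) z).fst = (D.flow s (D.flow t z)).fst
      rw [flow_fst, flow_fst, flow_fst, forcing_flow, D.S.op_add, map_add,
        ContinuousLinearMap.comp_apply, add_assoc]
      congr 1
      set n := translate (t : ℝ) (D.forcing z) with hn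
      have h1 : D.S.op s (D.ev n) = D.ev (translate s (n - cut 0 n)) :=
        (evalPast_translate_past D.growth D.w_neg s n).symm
      rw [h1, ← map_add, ← map_add, sub_add_cancel, hn, translate_translate, NNReal.coe_add]
    · change (D.flow (s + t) z).snd = (D.flow s (D.flow t z)).snd
      rw [flow_snd, flow_snd, sol_flow, translate_cut, ← restr_cut (cut _ _), cut_cut, max_eq_left,
        restr_cut, translate_translate, NNReal.coe_add]
      simp
  continuous_orbit z := by
    have h : ∀ g : LineL2 X, Continuous fun t : ℝ≥0 => translate (t : ℝ) g := fun g =>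
      (continuous_translate g).comp NNReal.continuous_coe
    exact (WithLp.prodContinuousLinearEquiv 2 ℂ X (Lp X 2 delayMeasure)).symm.continuous.comp
      (((D.S.continuous_orbit z.fst).add (D.ev.continuous.comp (h (D.forcing z)))).prodMk
        (restr.continuous.comp (h (D.sol z))))

/-- The delay semigroup is bounded: value and history are controlled by the `L²` norm of the solution
and of the forcing term, which translations preserve. -/
theorem exists_hasGrowth_semigroup : ∃ C, D.semigroup.HasGrowth C 0 := by
  set e : X × Lp X 2 (delayMeasure) →L[ℂ] DelaySpace X :=
    ((WithLp.prodContinuousLinearEquiv 2 ℂ X (Lp X 2 delayMeasure)).symm :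
    X × Lp X 2 (delayMeasure) →L[ℂ] DelaySpace X)
  have hM := D.growth.nonneg
  refine ⟨‖e‖ * max (D.M * ‖(fstL : DelaySpace X →L[ℂ] X)‖ + ‖D.ev‖ * ‖D.forcing‖)
    (‖(restr : LineL2 X →L[ℂ] _)‖ * ‖D.sol‖), fun t => ?_⟩
  rw [zero_mul, Real.exp_zero, mul_one]
  refine ContinuousLinearMap.opNorm_le_bound _ (by positivity) fun z => ?_
  refine (e.le_opNorm _).trans ?_
  rw [mul_assoc]
  gcongr
  have h1 : ‖D.S.op t‖ ≤ D.M := (D.growth t).trans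
    (mul_le_of_le_one_right hM (Real.exp_le_one_iff.2
      (mul_nonpos_of_nonpos_of_nonneg D.w_neg.le t.2)))
  refine norm_prod_le_iff.2 ⟨?_, ?_⟩
  · refine le_trans ?_ (mul_le_mul_of_nonneg_right (le_max_left _ _) (norm_nonneg z))
    refine (norm_add_le _ _).trans ?_
    rw [add_mul]
    gcongr
    · refine ((D.S.op t).le_of_opNorm_le h1 _).trans ?_
      rw [mul_assoc]
      gcongr
      exact fstL.le_opNorm z
    · refine (D.ev.le_opNorm _).trans ?_
      refine (congrArg (‖D.ev‖ * ·) (norm_translate _ _)).trans_le ?_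
      rw [mul_assoc]
      gcongr
      exact D.forcing.le_opNorm z
  · refine le_trans ?_ (mul_le_mul_of_nonneg_right (le_max_right _ _) (norm_nonneg z))
    refine ((restr : LineL2 X →L[ℂ] _).le_opNorm (translate t (D.sol z))).trans ?_
    rw [norm_translate, mul_assoc]
    gcongr
    exact D.sol.le_opNorm z

end StableDelay

/-! ### The resolvent of the translation semigroup -/

/-- The identity semigroup, whose rescalings are the scalar exponentials `e^{-bt}`. -/
noncomputable def idSemigroup (E : Type*) [NormedAddCommGroup E] [NormedSpace ℂ E] :
    C0Semigroup E where
  op _ := ContinuousLinearMap.id ℂ E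
  op_zero := rfl
  op_add _ _ := rfl
  continuous_orbit _ := continuous_const

theorem hasGrowth_idSemigroup (E : Type*) [NormedAddCommGroup E] [NormedSpace ℂ E] :
    (idSemigroup E).HasGrowth 1 0 := fun t => by
  rw [zero_mul, Real.exp_zero, mul_one]
  exact ContinuousLinearMap.norm_id_le

/-- The semigroup of left translations on `L²(ℝ, E)`. -/
noncomputable def translationSemigroup (E : Type*) [NormedAddCommGroup E] [NormedSpace ℂ E] :
    C0Semigroup (LineL2 E) where
  op t := translate (t : ℝ)
  op_zero := by ext1 g; exact translate_zero g
  op_add s t := by ext1 g; exact (translate_translate (s : ℝ) t g).symm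
  continuous_orbit g := (continuous_translate g).comp NNReal.continuous_coe

theorem hasGrowth_translationSemigroup (E : Type*) [NormedAddCommGroup E] [NormedSpace ℂ E] :
    (translationSemigroup E).HasGrowth 1 0 := fun t => by
  rw [zero_mul, Real.exp_zero, mul_one]
  refine ContinuousLinearMap.opNorm_le_bound _ zero_le_one fun g => ?_
  rw [one_mul]
  exact (norm_translate (t : ℝ) g).le

/-- Pairing with a test function is differentiable along translations, as a convolution with the
reflected test function. -/
theorem hasDerivAt_pair_translate {X : Type*} [NormedAddCommGroup X] [NormedSpace ℂ X]
    {φ : ℝ → ℝ} (hφ : ContDiff ℝ 1 φ) (hc : HasCompactSupport φ)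
    (g : LineL2 X) :
    HasDerivAt (fun s : ℝ => ∫ t, φ t • g (t + s)) (-∫ t, deriv φ t • g t) 0 := by
  set f : ℝ → ℝ := fun t => φ (-t) with hf
  have hfc : HasCompactSupport f := hc.comp_homeomorph (Homeomorph.neg ℝ)
  have h := hfc.hasDerivAt_convolution_left (ContinuousLinearMap.lsmul ℝ ℝ)
    (μ := volume) (hφ.comp contDiff_neg) ((Lp.memLp g).locallyIntegrable (by norm_num)) 0
  have hd : ∀ t, deriv f t = -deriv φ (-t) := fun t => by
    rw [hf, deriv_comp_neg]
  convert h using 1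
  · funext s
    rw [convolution_def, ← integral_neg_eq_self]
    refine integral_congr_ae (Eventually.of_forall fun t => ?_)
    simp [hf, sub_eq_add_neg, add_comm]
  · rw [convolution_def, ← integral_neg_eq_self, ← integral_neg]
    refine integral_congr_ae (Eventually.of_forall fun t => ?_)
    simp [hd]

section Translation

variable {X : Type*} [NormedAddCommGroup X] [NormedSpace ℂ X] [CompleteSpace X]

theorem pair_expDecay {b : ℝ} (hb : 0 < b) (g : LineL2 X) :
    pair (expDecay hb) g = ∫ r in Ioi (0 : ℝ), Complex.exp (-(b : ℂ) * r) • g r := by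
  rw [expDecay, pair_toLp, ← integral_Ici_eq_integral_Ioi, ← integral_indicator measurableSet_Ici]
  refine integral_congr_ae (Eventually.of_forall fun t => ?_)
  by_cases h : t ∈ Ici (0 : ℝ)
  · simp only [indicator_of_mem h]
    push_cast
    rfl
  · simp only [indicator_of_notMem h, zero_smul]

/-- The resolvent of the translation semigroup at `b > 0`. -/
noncomputable def translationLaplace (X : Type*) [NormedAddCommGroup X] [NormedSpace ℂ X]
    {b : ℝ} (hb : 0 < b) : LineL2 X →L[ℂ] LineL2 X :=
  (translationSemigroup X).laplace (hasGrowth_translationSemigroup X) (z := (b : ℂ)) (by simpa)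

theorem map_translationLaplace {b : ℝ} (hb : 0 < b) {G : Type*} [NormedAddCommGroup G]
    [NormedSpace ℂ G] [CompleteSpace G] (T : LineL2 X →L[ℂ] G) (g : LineL2 X) :
    T (translationLaplace X hb g) =
      ∫ r in Ioi (0 : ℝ), Complex.exp (-(b : ℂ) * r) • T (translate r g) := by
  rw [translationLaplace, C0Semigroup.map_laplace]
  refine setIntegral_congr_fun measurableSet_Ioi fun r hr => ?_
  congr 2
  change translate ((r.toNNReal : ℝ≥0) : ℝ) g = translate r g
  rw [Real.coe_toNNReal r (le_of_lt hr)]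

/-- The resolvent of the translation semigroup has the continuous representative
`s ↦ ∫_0^∞ e^{-br} g(s + r) dr`. -/
theorem coeFn_translationLaplace {b : ℝ} (hb : 0 < b) (g : LineL2 X) :
    translationLaplace X hb g =ᵐ[volume] fun s => pair (expDecay hb) (translate s g) := by
  have hS := (hasGrowth_idSemigroup X).rescale (-b)
  have hop : ∀ r ∈ Ioi (0 : ℝ), ∀ y : X, ((idSemigroup X).rescale (-b)).op r.toNNReal y =
      Complex.exp (-(b : ℂ) * r) • y := fun r hr y => by
    rw [C0Semigroup.rescale_op, smul_apply, Real.coe_toNNReal r (le_of_lt hr)]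
    push_cast
    rfl
  refine ae_eq_of_integral_contDiff_smul_eq ((Lp.memLp _).locallyIntegrable (by norm_num))
    (continuous_pair_translate _ g).locallyIntegrable fun φ hφ hφc => ?_
  have hm : MemLp (fun t => (φ t : ℂ)) 2 volume :=
    (Complex.continuous_ofReal.comp hφ.continuous).memLp_of_hasCompactSupport
      (hφc.comp_left Complex.ofReal_zero)
  have h1 := pair_toLp hm (translationLaplace X hb g)
  simp only [Complex.coe_smul] at h1
  have h2 := C0Semigroup.integral_smul_conv_swap hS (by linarith) (hm.toLp _) g 1
  rw [← h1, map_translationLaplace]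
  refine Eq.trans ?_ (h2.symm.trans (integral_congr_ae ?_))
  · refine setIntegral_congr_fun measurableSet_Ioi fun r hr => ?_
    rw [hop r hr, one_mul]
  · filter_upwards [hm.coeFn_toLp] with t ht
    rw [ht, Complex.coe_smul, pair_expDecay]
    congr 1
    refine integral_congr_ae ?_
    filter_upwards [ae_restrict_mem measurableSet_Ioi, ae_restrict_of_ae (coeFn_translate t g)]
      with r hr hr'
    rw [hop r hr, hr', one_mul, add_comm]

/-- Differentiability along translations implies weak differentiability on the interval. -/
theorem IsGenPair.isWeakDeriv {k k' : LineL2 X} (h : (translationSemigroup X).IsGenPair k k') :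
    IsWeakDeriv (restr k) (restr k') := by
  intro φ hφ hc hs
  have hφ1 : ContDiff ℝ 1 φ := hφ.of_le (by norm_cast)
  have hm : MemLp (fun t => (φ t : ℂ)) 2 volume :=
    (Complex.continuous_ofReal.comp hφ.continuous).memLp_of_hasCompactSupport
      (hc.comp_left Complex.ofReal_zero)
  have hp : ∀ g : LineL2 X, pair (hm.toLp _) g = ∫ t, φ t • g t := fun g => by
    rw [pair_toLp]
    simp only [Complex.coe_smul]
  have h1 := tendsto_nhds_unique (((pair (hm.toLp _)).continuous.tendsto k').comp h)
    ((C0Semigroup.tendsto_diffQuotient_nnreal (hasDerivAt_pair_translate hφ1 hc k)).congr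
      fun s => by
        dsimp only [Function.comp]
        rw [map_smul, map_sub, hp, hp]
        simp only [add_zero]
        congr 2
        refine integral_congr_ae ?_
        filter_upwards [coeFn_translate (s : ℝ) k] with t ht
        change _ = φ t • translate (s : ℝ) k t
        rw [ht])
  rw [hp] at h1
  have hset : ∀ (ψ : ℝ → ℝ), (∀ t, t ∉ Icc (-1 : ℝ) 0 → ψ t = 0) → ∀ g : LineL2 X,
      ∫ t in Icc (-1 : ℝ) 0, ψ t • restr g t = ∫ t, ψ t • g t := fun ψ hψ g => by
    refine Eq.trans ?_ (setIntegral_eq_integral_of_forall_compl_eq_zero (s := Icc (-1 : ℝ) 0) ?_)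
    · refine integral_congr_ae ?_
      filter_upwards [coeFn_restr g] with t ht
      rw [ht]
    · intro t ht
      rw [hψ t ht, zero_smul]
  rw [hset _ ?_ k, hset _ ?_ k', h1, neg_neg]
  · intro t ht
    exact image_eq_zero_of_notMem_tsupport fun h => ht (Ioo_subset_Icc_self (hs h))
  · intro t ht
    exact image_eq_zero_of_notMem_tsupport fun h =>
      ht (Ioo_subset_Icc_self (hs (tsupport_deriv_subset (𝕜 := ℝ) h)))

end Translation

/-! ### The weak differential equation `f' = b f` -/

section WeakODE

variable {X : Type*} [NormedAddCommGroup X] [NormedSpace ℝ X] [CompleteSpace X]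

/-- A continuous function with vanishing weak derivative is constant: its mollifications have
vanishing derivative. -/
theorem eq_of_weakDeriv_zero {Q : ℝ → X} (hQ : Continuous Q)
    (h : ∀ φ : ℝ → ℝ, ContDiff ℝ (⊤ : ℕ∞) φ → HasCompactSupport φ → tsupport φ ⊆ Ioo (-1) 0 →
      ∫ s in Icc (-1 : ℝ) 0, deriv φ s • Q s = 0) {a b : ℝ} (ha : -1 < a) (hab : a ≤ b)
    (hb : b < 0) : Q a = Q b := by
  set r : ℝ := min (a + 1) (-b) with hr
  have hr0 : 0 < r := lt_min (by linarith) (by linarith)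
  let β : ℕ → ContDiffBump (0 : ℝ) := fun n =>
    ⟨r / 2 / (n + 2), r / (n + 2), by positivity, by
      have : (0 : ℝ) < n + 2 := by positivity
      gcongr
      linarith⟩
  have hβr : ∀ n, (β n).rOut < r := fun n => by
    change r / (n + 2) < r
    rw [div_lt_iff₀ (by positivity)]
    nlinarith [(Nat.cast_nonneg n : (0 : ℝ) ≤ n)]
  have hβ0 : Tendsto (fun n => (β n).rOut) atTop (𝓝 0) := by
    change Tendsto (fun n : ℕ => r / ((n : ℝ) + 2)) atTop (𝓝 0)
    exact tendsto_const_nhds.div_atTop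
      (tendsto_atTop_add_const_right _ _ tendsto_natCast_atTop_atTop)
  set m : ℕ → ℝ → X := fun n => convolution ((β n).normed volume) Q
    (ContinuousLinearMap.lsmul ℝ ℝ) volume with hm
  have hlim : ∀ s, Tendsto (fun n => m n s) atTop (𝓝 (Q s)) := fun s =>
    ContDiffBump.convolution_tendsto_right_of_continuous hβ0 hQ s
  have hconst : ∀ n, m n a = m n b := by
    intro n
    have hd : ∀ s ∈ Icc a b, HasDerivAt (m n) 0 s := by
      intro s hs
      have h1 := (β n).hasCompactSupport_normed (μ := volume) |>.hasDerivAt_convolution_left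
        (ContinuousLinearMap.lsmul ℝ ℝ) (μ := volume) ((β n).contDiff_normed (n := 1))
        hQ.locallyIntegrable s
      set ρ := (β n).normed volume with hρ
      have h2 : convolution (deriv ρ) Q (ContinuousLinearMap.lsmul ℝ ℝ) volume s = 0 := by
        set φ : ℝ → ℝ := fun t => ρ (s - t) with hφ
        have hφs : tsupport φ ⊆ Metric.closedBall s (β n).rOut := by
          refine closure_minimal (fun t ht => ?_) Metric.isClosed_closedBall
          have h3 : s - t ∈ tsupport ρ := subset_tsupport _ ht
          rw [hρ, (β n).tsupport_normed_eq, Metric.mem_closedBall, dist_zero_right,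
            Real.norm_eq_abs] at h3
          rw [Metric.mem_closedBall, dist_comm, Real.dist_eq]
          exact h3
        have hφI : tsupport φ ⊆ Ioo (-1) 0 := fun t ht => by
          have h3 := hφs ht
          rw [Real.closedBall_eq_Icc] at h3
          have h4 := hβr n
          have h5 : r ≤ a + 1 := min_le_left _ _
          have h6 : r ≤ -b := min_le_right _ _
          constructor <;> linarith [h3.1, h3.2, hs.1, hs.2]
        have hφc : HasCompactSupport φ :=
          (isCompact_closedBall s (β n).rOut).of_isClosed_subset (isClosed_tsupport φ) hφs
        have hφd : ∀ t, deriv φ t = -deriv ρ (s - t) := fun t => by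
          rw [hφ, deriv_comp_const_sub]
        have h3 := h φ ((β n).contDiff_normed.comp (contDiff_const.sub contDiff_id)) hφc hφI
        rw [setIntegral_eq_integral_of_forall_compl_eq_zero] at h3
        · rw [convolution_def, ← integral_sub_left_eq_self _ volume s]
          simp only [hφd, neg_smul, integral_neg, neg_eq_zero] at h3
          simpa using h3
        · intro t ht
          have : deriv φ t = 0 := image_eq_zero_of_notMem_tsupport fun h =>
            ht (Ioo_subset_Icc_self (hφI (tsupport_deriv_subset (𝕜 := ℝ) h)))
          rw [this, zero_smul]
      rwa [h2] at h1
    refine (constant_of_has_deriv_right_zero (f := m n) (a := a) (b := b)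
      (fun s hs => (hd s hs).continuousAt.continuousWithinAt)
      (fun s hs => (hd s ⟨hs.1, hs.2.le⟩).hasDerivWithinAt) b ⟨hab, le_rfl⟩).symm
  exact tendsto_nhds_unique (hlim a) ((hlim b).congr fun n => (hconst n).symm)

end WeakODE

section WeightedWeakDeriv

variable {X : Type*} [NormedAddCommGroup X] [NormedSpace ℝ X]

/-- The product rule for weak derivatives and exponential weights. -/
theorem IsWeakDeriv.exp_smul {f g f' g' : ℝ → X} (β : ℝ)
    (hf : IntegrableOn f (Icc (-1 : ℝ) 0)) (hg : IntegrableOn g (Icc (-1 : ℝ) 0))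
    (h : IsWeakDeriv f g)
    (h1 : f' =ᵐ[delayMeasure] fun s => Real.exp (β * s) • f s)
    (h2 : g' =ᵐ[delayMeasure] fun s => Real.exp (β * s) • (g s + β • f s)) :
    IsWeakDeriv f' g' := by
  intro φ hφ hc hs
  set ψ : ℝ → ℝ := fun s => Real.exp (β * s) * φ s with hψ
  have hE : ContDiff ℝ (⊤ : ℕ∞) fun s : ℝ => Real.exp (β * s) := by fun_prop
  have hψ1 : ContDiff ℝ (⊤ : ℕ∞) ψ := hE.mul hφ
  have hsub : tsupport ψ ⊆ tsupport φ := closure_mono fun s hs => by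
    simp only [hψ, Function.mem_support] at hs ⊢
    exact right_ne_zero_of_mul hs
  have hψ2 : HasCompactSupport ψ := hc.of_isClosed_subset (isClosed_tsupport _) hsub
  have key := h ψ hψ1 hψ2 (hsub.trans hs)
  have hd : ∀ s, deriv ψ s = Real.exp (β * s) * deriv φ s + β * ψ s := fun s => by
    have e1 : HasDerivAt (fun s : ℝ => Real.exp (β * s)) (Real.exp (β * s) * β) s := by
      simpa using ((hasDerivAt_id s).const_mul β).exp
    have e2 := e1.mul (hφ.differentiable (by simp) s).hasDerivAt
    have e3 := e2.deriv
    refine e3.trans ?_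
    simp only [hψ]
    ring
  have hφ' : Continuous (deriv φ) := hφ.continuous_deriv (by simp)
  have i1 : IntegrableOn (fun s => (Real.exp (β * s) * deriv φ s) • f s) (Icc (-1 : ℝ) 0) :=
    hf.continuousOn_smul (by fun_prop) isCompact_Icc
  have i2 : IntegrableOn (fun s => (β * ψ s) • f s) (Icc (-1 : ℝ) 0) :=
    hf.continuousOn_smul (by have := hψ1.continuous; fun_prop) isCompact_Icc
  have i3 : IntegrableOn (fun s => ψ s • g s) (Icc (-1 : ℝ) 0) :=
    hg.continuousOn_smul hψ1.continuous.continuousOn isCompact_Icc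
  simp only [hd, add_smul] at key
  rw [integral_add i1 i2] at key
  have e1 : ∫ s in Icc (-1 : ℝ) 0, deriv φ s • f' s =
      ∫ s in Icc (-1 : ℝ) 0, (Real.exp (β * s) * deriv φ s) • f s := by
    refine integral_congr_ae ?_
    filter_upwards [h1] with s hs
    rw [hs, smul_smul, mul_comm]
  have e2 : ∫ s in Icc (-1 : ℝ) 0, φ s • g' s =
      (∫ s in Icc (-1 : ℝ) 0, ψ s • g s) + ∫ s in Icc (-1 : ℝ) 0, (β * ψ s) • f s := by
    rw [← integral_add i3 i2]
    refine integral_congr_ae ?_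
    filter_upwards [h2] with s hs
    rw [hs, smul_smul, smul_add, smul_smul]
    simp only [hψ]
    ring_nf
  rw [e1, e2, neg_add, ← key]
  abel

end WeightedWeakDeriv

/-! ### The resolvent of the delay semigroup -/

theorem integrableOn_history {X : Type*} [NormedAddCommGroup X] (f : Lp X 2 delayMeasure) :
    IntegrableOn f (Icc (-1 : ℝ) 0) :=
  (Lp.memLp f).integrable (by norm_num)

/-- The continuous solutions of the weak equation `f' = b f` are exponentials. -/
theorem IsContRep.eq_expTensor {X : Type*} [NormedAddCommGroup X] [NormedSpace ℂ X]
    [CompleteSpace X] {f g : Lp X 2 delayMeasure} {b : ℝ} (h : IsWeakDeriv f g)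
    (hg : g =ᵐ[delayMeasure] fun s => b • f s) {F : C(Icc (-1 : ℝ) 0, X)} (hF : IsContRep f F) :
    F = expTensor X (b : ℂ) (F ⟨0, by norm_num⟩) := by
  set Fe : ℝ → X := IccExtend (by norm_num : (-1 : ℝ) ≤ 0) F with hFe
  have hFc : Continuous Fe := F.continuous.Icc_extend'
  set Q : ℝ → X := fun s => Real.exp (-b * s) • Fe s with hQ
  have hQc : Continuous Q := by fun_prop
  have hw : IsWeakDeriv Q (fun _ => (0 : X)) := by
    refine h.exp_smul (-b) (integrableOn_history f) (integrableOn_history g) ?_ ?_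
    · filter_upwards [hF] with s hs
      rw [hs]
    · filter_upwards [hg] with s hs
      rw [hs, neg_smul, add_neg_cancel, smul_zero]
  have h0 : ∀ φ : ℝ → ℝ, ContDiff ℝ (⊤ : ℕ∞) φ → HasCompactSupport φ →
      tsupport φ ⊆ Ioo (-1) 0 → ∫ s in Icc (-1 : ℝ) 0, deriv φ s • Q s = 0 := fun φ h1 h2 h3 => by
    rw [hw φ h1 h2 h3]
    simp
  have h1 : EqOn Q (fun _ => Q (-1 / 2)) (Ioo (-1) 0) := fun s hs => by
    rcases le_total s (-1 / 2) with h | h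
    · exact eq_of_weakDeriv_zero hQc h0 hs.1 h (by norm_num)
    · exact (eq_of_weakDeriv_zero hQc h0 (by norm_num) h hs.2).symm
  have h2 := h1.closure hQc continuous_const
  rw [closure_Ioo (by norm_num)] at h2
  ext s
  have h3 := (h2 s.2).trans (h2 (right_mem_Icc.2 (by norm_num : (-1 : ℝ) ≤ 0))).symm
  have e1 : Fe s = F s := by rw [hFe, IccExtend_of_mem _ _ s.2]
  have e2 : Fe 0 = F ⟨0, by norm_num⟩ := by
    rw [hFe, IccExtend_of_mem _ _ (right_mem_Icc.2 (by norm_num : (-1 : ℝ) ≤ 0))]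
  simp only [hQ, e1, e2, mul_zero, Real.exp_zero, one_smul] at h3
  rw [← h3]
  change F s = Complex.exp ((b : ℂ) * ((s : ℝ) : ℂ)) • Real.exp (-b * s) • F s
  rw [← Complex.coe_smul, smul_smul, Complex.ofReal_exp, ← Complex.exp_add]
  simp

namespace StableDelay

open C0Semigroup

theorem w_lt {X : Type*} [NormedAddCommGroup X] [InnerProductSpace ℂ X] (D : StableDelay X)
    {b : ℝ} (hb : 0 < b) : D.w < (b : ℂ).re := by
  simpa using D.w_neg.trans hb

variable {X : Type*} [NormedAddCommGroup X] [InnerProductSpace ℂ X] [CompleteSpace X]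
  (D : StableDelay X)

/-- The resolvent of the generator of `S`. -/
noncomputable def RS {b : ℝ} (hb : 0 < b) : X →L[ℂ] X := D.S.laplace D.growth (D.w_lt hb)

theorem pair_expDecay_σ {b : ℝ} (hb : 0 < b) (y : X) :
    pair (expDecay hb) (D.σ y) = D.RS hb y := by
  rw [pair_expDecay, RS, laplace_apply]
  refine integral_congr_ae ?_
  filter_upwards [ae_restrict_of_ae (coeFn_orbitL2 D.growth D.w_neg y),
    ae_restrict_mem measurableSet_Ioi] with r h1 h2
  rw [σ, h1, indicator_of_mem (mem_Ici.2 (le_of_lt h2))]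

theorem pair_expDecay_K {b : ℝ} (hb : 0 < b) (g : LineL2 X) :
    pair (expDecay hb) (D.K g) = D.ev (translationLaplace X hb g) := by
  rw [pair_expDecay, map_translationLaplace]
  refine integral_congr_ae ?_
  filter_upwards [ae_restrict_of_ae
    (coeFn_convOp D.growth D.w_neg D.norm_resolvent_le g)] with r h1
  rw [K, h1]; rfl

/-- The Laplace transform of the convolution of `S` with a function on the half-line is the product of
the Laplace transforms. -/
theorem pair_expDecay_K_cut {b : ℝ} (hb : 0 < b) (g : LineL2 X) :
    pair (expDecay hb) (D.K (cut 0 g)) = D.RS hb (pair (expDecay hb) g) := by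
  rw [K, pair_convOp, RS, laplace_apply]
  refine setIntegral_congr_fun measurableSet_Ioi fun r hr => ?_
  have hr' : 0 ≤ r := le_of_lt hr
  rw [pair_translate, pair_cut, neg_neg, cut_translate_expDecay hb hr', map_smul,
    smul_apply, map_smul]
  push_cast
  rfl

/-- The first component of the Laplace transform of the delay semigroup. -/
theorem laplace_fst {C : ℝ} (hT : D.semigroup.HasGrowth C 0) {b : ℝ} (hb : 0 < b)
    (z : DelaySpace X) (hb' : 0 < (b : ℂ).re) :
    (D.semigroup.laplace hT hb' z).fst =
      D.RS hb z.fst + D.ev (translationLaplace X hb (D.forcing z)) := by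
  have h1 := map_laplace hT hb' fstL z
  refine h1.trans ?_
  rw [RS, laplace_apply, map_translationLaplace, ← integral_add]
  · refine setIntegral_congr_fun measurableSet_Ioi fun r hr => ?_
    have hr' : ((r.toNNReal : ℝ≥0) : ℝ) = r := Real.coe_toNNReal r (le_of_lt hr)
    change _ • (D.flow r.toNNReal z).fst = _
    rw [flow_fst, smul_add, hr']
  · exact integrableOn_exp_smul_op D.growth (D.w_lt hb) z.fst
  · have h2 := integrableOn_exp_smul_op (hasGrowth_translationSemigroup X) hb' (D.forcing z)
    refine IntegrableOn.congr_fun (D.ev.integrable_comp h2) (fun r hr => ?_) measurableSet_Ioi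
    have hr' : ((r.toNNReal : ℝ≥0) : ℝ) = r := Real.coe_toNNReal r (le_of_lt hr)
    rw [map_smul]
    change _ • D.ev (translate ((r.toNNReal : ℝ≥0) : ℝ) (D.forcing z)) = _
    rw [hr']

/-- The second component of the Laplace transform of the delay semigroup. -/
theorem laplace_snd {C : ℝ} (hT : D.semigroup.HasGrowth C 0) {b : ℝ} (hb : 0 < b)
    (z : DelaySpace X) (hb' : 0 < (b : ℂ).re) :
    (D.semigroup.laplace hT hb' z).snd = restr (translationLaplace X hb (D.sol z)) := by
  have h1 := map_laplace hT hb' sndL z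
  refine h1.trans ?_
  rw [map_translationLaplace]
  refine setIntegral_congr_fun measurableSet_Ioi fun r hr => ?_
  have hr' : ((r.toNNReal : ℝ≥0) : ℝ) = r := Real.coe_toNNReal r (le_of_lt hr)
  change _ • (D.flow r.toNNReal z).snd = _
  rw [flow_snd, hr']

variable {A : X →ₗ.[ℂ] X}

/-- The Laplace transform of the delay semigroup is a right inverse of `b - 𝒜`. -/
theorem laplace_mem_delayGraph {C : ℝ} (hT : D.semigroup.HasGrowth C 0)
    (hA : D.S.IsGeneratedBy A) {b : ℝ} (hb : 0 < b) (hb' : 0 < (b : ℂ).re) (z : DelaySpace X) :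
    (D.semigroup.laplace hT hb' z, (b : ℂ) • D.semigroup.laplace hT hb' z - z) ∈
      delayGraph A D.Φ := by
  set u := D.semigroup.laplace hT hb' z with hu
  set v := D.sol z with hv
  set F := pairHist (expDecay hb) v with hF
  have hΦ : D.Φ F = pair (expDecay hb) (D.N v) := (pair_delayOp D.Φ D.norm_symbol_le _ v).symm
  have hfor : D.forcing z = cut 0 (D.N v) := rfl
  have hfst : u.fst = D.RS hb (z.fst + D.Φ F) := by
    rw [hu, laplace_fst D hT hb z hb', ← pair_expDecay_K, hfor, pair_expDecay_K_cut, map_add, hΦ]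
  have hF0 : F ⟨0, by norm_num⟩ = u.fst := by
    change pair (expDecay hb) (translate 0 v) = u.fst
    rw [translate_zero, ← cut_expDecay, ← pair_cut, hv, D.cut_sol, map_add, pair_expDecay_σ, ← hv,
      pair_expDecay_K_cut, hfst, map_add, hΦ]
  have hgen := (hA _ _).2 (isGenPair_laplace D.growth (D.w_lt hb) (z.fst + D.Φ F))
  change (D.RS hb (z.fst + D.Φ F), (b : ℂ) • D.RS hb (z.fst + D.Φ F) - (z.fst + D.Φ F)) ∈ _ at hgen
  rw [← hfst] at hgen
  obtain ⟨x, hx, hAx⟩ := (LinearPMap.mem_graph_iff _).1 hgen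
  have hsnd : u.snd = restr (translationLaplace X hb v) := D.laplace_snd hT hb z hb'
  have hz : z.snd = restr v := by
    rw [← restr_extend z.snd, ← D.sol_sub_cut, map_sub, restr_eq_zero_of_cut, sub_zero]
  refine ⟨x, F, hx.symm, ?_, hF0.trans hx.symm, ?_, ?_⟩
  · change u.snd =ᵐ[delayMeasure] _
    rw [hsnd]
    filter_upwards [coeFn_restr (translationLaplace X hb v),
      ae_restrict_of_ae (coeFn_translationLaplace hb v), ae_restrict_mem measurableSet_Icc]
      with s h1 h2 h3
    rw [h1, h2, IccExtend_of_mem _ _ h3]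
    rfl
  · rw [hAx]
    change (b : ℂ) • u.fst - z.fst = (b : ℂ) • u.fst - (z.fst + D.Φ F) + D.Φ F
    abel
  · change IsWeakDeriv u.snd (((b : ℂ) • u.snd - z.snd : Lp X 2 delayMeasure) : ℝ → X)
    rw [hsnd, hz, ← map_smul, ← map_sub]
    exact IsGenPair.isWeakDeriv (isGenPair_laplace (hasGrowth_translationSemigroup X) hb' v)

/-- For large `b` the operator `b - 𝒜` is injective: an element of its kernel has the form
`(x, e^{b·} x)` with `x = R(b, A) Φ(e^{b·} x)`, and the right-hand side is contractive in `x`. -/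
theorem eq_zero_of_mem_delayGraph (hA : D.S.IsGeneratedBy A) {b : ℝ} (hb : 0 < b)
    (hbig : D.M * ‖D.Φ‖ < b)
    {z : DelaySpace X} (h : (z, (b : ℂ) • z) ∈ delayGraph A D.Φ) : z = 0 := by
  obtain ⟨x, F, h1, h2, h3, h4, h5⟩ := h
  dsimp only at h1 h2 h3 h4 h5
  have hFe : F = expTensor X (b : ℂ) x := by
    rw [← h3]
    refine IsContRep.eq_expTensor h5 ?_ h2
    filter_upwards [Lp.coeFn_smul (b : ℂ) z.snd] with s hs
    exact hs.trans (Complex.coe_smul _ _)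
  have hgen : D.S.IsGenPair x (A x) := (hA _ _).1 (LinearPMap.mem_graph _ x)
  have hx := (isGenPair_iff_laplace D.growth (D.w_lt hb)).1 hgen
  have h6 : (b : ℂ) • (x : X) - A x = D.Φ F := by
    rw [WithLp.smul_fst, h1] at h4
    rw [h4, add_sub_cancel_left]
  rw [h6] at hx
  have hx0 : (x : X) = 0 := by
    by_contra hne
    have hpos := norm_pos_iff.2 hne
    have hbw : 0 < b - D.w := by linarith [D.w_neg]
    have n1 : ‖F‖ ≤ ‖(x : X)‖ := by
      rw [hFe]
      simpa using (expTensor X (b : ℂ)).le_of_opNorm_le (norm_expTensor_le (by simpa using hb.le)) x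
    have n2 : ‖(x : X)‖ ≤ D.M / (b - D.w) * (‖D.Φ‖ * ‖(x : X)‖) := by
      conv_lhs => rw [← hx]
      refine (ContinuousLinearMap.le_of_opNorm_le _ (norm_laplace_le D.growth (D.w_lt hb)) _).trans ?_
      have := D.growth.nonneg
      rw [Complex.ofReal_re]
      gcongr
      exact (D.Φ.le_opNorm F).trans (by gcongr)
    have n3 : D.M / (b - D.w) * (‖D.Φ‖ * ‖(x : X)‖) = D.M * ‖D.Φ‖ * ‖(x : X)‖ / (b - D.w) := by ring
    rw [n3, le_div_iff₀ hbw] at n2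
    nlinarith [D.w_neg]
  have hF0 : F = 0 := by rw [hFe, hx0, map_zero]
  refine WithLp.ofLp_injective 2 (Prod.ext (h1.trans hx0) ?_)
  refine Lp.ext (h2.trans ?_)
  filter_upwards [Lp.coeFn_zero X 2 delayMeasure] with s hs
  rw [hF0]
  refine Eq.trans ?_ hs.symm
  simp [IccExtend]

/-- The delay operator matrix generates the delay semigroup. -/
theorem isGeneratedBy_delayMatrix (hA : D.S.IsGeneratedBy A) :
    D.semigroup.IsGeneratedBy (delayMatrix A D.Φ) := by
  obtain ⟨C, hT⟩ := D.exists_hasGrowth_semigroup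
  have hM := D.growth.nonneg
  set b : ℝ := D.M * ‖D.Φ‖ + 1 with hb
  have hb0 : 0 < b := by positivity
  have hb' : 0 < (b : ℂ).re := by simpa using hb0
  intro z y
  rw [delayMatrix_graph]
  change _ ↔ D.semigroup.IsGenPair z y
  rw [isGenPair_iff_laplace hT hb']
  have hmem := D.laplace_mem_delayGraph hT hA hb0 hb' ((b : ℂ) • z - y)
  constructor
  · intro h
    have h1 := (delayGraph A D.Φ).sub_mem hmem h
    rw [← sub_eq_zero]
    refine D.eq_zero_of_mem_delayGraph hA hb0 (by rw [hb]; linarith) ?_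
    convert h1 using 1
    refine Prod.ext rfl ?_
    simp only [Prod.snd_sub, smul_sub]
    abel
  · intro h
    rw [h, sub_sub_cancel] at hmem
    exact hmem

end StableDelay

/-! ### Exponential weights -/

section Weight

/-- Multiplication by `s ↦ e^{βs}` on `C([-1, 0], X)`. -/
noncomputable def expWeightC (X : Type*) [NormedAddCommGroup X] [NormedSpace ℂ X] (β : ℝ) :
    C(Icc (-1 : ℝ) 0, X) →L[ℂ] C(Icc (-1 : ℝ) 0, X) :=
  LinearMap.mkContinuous
    { toFun := fun F => ⟨fun s => Real.exp (β * s) • F s, by fun_prop⟩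
      map_add' := fun F G => by ext s; exact smul_add _ _ _
      map_smul' := fun c F => by ext s; exact smul_comm _ c (F s) }
    (Real.exp |β|)
    fun F => by
      rw [ContinuousMap.norm_le _ (by positivity)]
      intro s
      change ‖Real.exp (β * s) • F s‖ ≤ _
      rw [norm_smul, Real.norm_eq_abs, Real.abs_exp]
      gcongr
      · refine (le_abs_self _).trans ?_
        rw [abs_mul]
        exact mul_le_of_le_one_right (abs_nonneg _) (abs_le.2 ⟨s.2.1, s.2.2.trans zero_le_one⟩)
      · exact F.norm_coe_le_norm s

theorem expWeightC_apply {X : Type*} [NormedAddCommGroup X] [NormedSpace ℂ X] (β : ℝ)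
    (F : C(Icc (-1 : ℝ) 0, X)) (s : Icc (-1 : ℝ) 0) :
    expWeightC X β F s = Real.exp (β * s) • F s := rfl

theorem expWeightC_neg {X : Type*} [NormedAddCommGroup X] [NormedSpace ℂ X] (β : ℝ)
    (F : C(Icc (-1 : ℝ) 0, X)) : expWeightC X β (expWeightC X (-β) F) = F := by
  ext s
  rw [expWeightC_apply, expWeightC_apply, smul_smul, ← Real.exp_add]
  simp

theorem expWeightC_comp_expTensor {X : Type*} [NormedAddCommGroup X] [NormedSpace ℂ X] (β : ℝ)
    (z : ℂ) : (expWeightC X β).comp (expTensor X z) = expTensor X (β + z) := by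
  ext x s
  change Real.exp (β * s) • Complex.exp (z * ((s : ℝ) : ℂ)) • x =
    Complex.exp ((β + z) * ((s : ℝ) : ℂ)) • x
  rw [← Complex.coe_smul, smul_smul, Complex.ofReal_exp, ← Complex.exp_add]
  push_cast
  ring_nf

variable {X : Type*} [NormedAddCommGroup X] [InnerProductSpace ℂ X]

/-- The weight is clamped to `[-1, 0]`, which makes it bounded on the line. -/
theorem isMultiplier_expWeight (X : Type*) [NormedAddCommGroup X] [InnerProductSpace ℂ X] (β : ℝ) :
    IsMultiplier delayMeasure
      (fun s => (Real.exp (β * clamp (-1) 0 s) : ℂ) • ContinuousLinearMap.id ℂ X)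
      (Real.exp |β|) := by
  refine .of_continuous (fun s => ?_) fun y => ?_
  · refine ContinuousLinearMap.opNorm_le_bound _ (by positivity) fun y => ?_
    rw [smul_apply, norm_smul, Complex.norm_real, Real.norm_eq_abs, Real.abs_exp]
    change Real.exp _ * ‖y‖ ≤ _
    gcongr
    refine (le_abs_self _).trans ?_
    rw [abs_mul]
    refine mul_le_of_le_one_right (abs_nonneg _) (abs_le.2 ⟨le_max_left _ _, ?_⟩)
    exact max_le (by norm_num) ((min_le_left _ _).trans zero_le_one)
  · have : Continuous (clamp (-1) 0) := by unfold clamp; fun_prop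
    simp only [smul_apply]
    fun_prop

/-- Multiplication by `s ↦ e^{βs}` on `L²([-1, 0], X)`. -/
noncomputable def expWeightL2 (X : Type*) [NormedAddCommGroup X] [InnerProductSpace ℂ X] (β : ℝ) :
    Lp X 2 delayMeasure →L[ℂ] Lp X 2 delayMeasure :=
  mulOp (isMultiplier_expWeight X β)

theorem coeFn_expWeightL2 (β : ℝ) (f : Lp X 2 delayMeasure) :
    expWeightL2 X β f =ᵐ[delayMeasure] fun s => Real.exp (β * s) • f s := by
  filter_upwards [coeFn_mulOp (isMultiplier_expWeight X β) f, ae_restrict_mem measurableSet_Icc]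
    with s h1 h2
  refine h1.trans ?_
  have : clamp (-1) 0 s = s := by rw [clamp, min_eq_right h2.2, max_eq_right h2.1]
  rw [this, smul_apply, Complex.coe_smul]
  rfl

theorem expWeightL2_neg (β : ℝ) (f : Lp X 2 delayMeasure) :
    expWeightL2 X β (expWeightL2 X (-β) f) = f := by
  refine Lp.ext ?_
  filter_upwards [coeFn_expWeightL2 β (expWeightL2 X (-β) f), coeFn_expWeightL2 (-β) f]
    with s h1 h2
  rw [h1, h2, smul_smul, ← Real.exp_add]
  simp

/-- The operator `(x, f) ↦ (x, e^{β·} f)` on the delay space. -/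
noncomputable def expWeight (X : Type*) [NormedAddCommGroup X] [InnerProductSpace ℂ X] (β : ℝ) :
    DelaySpace X →L[ℂ] DelaySpace X :=
  ((WithLp.prodContinuousLinearEquiv 2 ℂ X (Lp X 2 delayMeasure)).symm :
    X × Lp X 2 (delayMeasure) →L[ℂ] DelaySpace X).comp
    ((WithLp.fstL 2 ℂ X (Lp X 2 delayMeasure)).prod
      ((expWeightL2 X β).comp (WithLp.sndL 2 ℂ X (Lp X 2 delayMeasure))))

theorem expWeight_neg (β : ℝ) (z : DelaySpace X) : expWeight X β (expWeight X (-β) z) = z :=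
  WithLp.ofLp_injective 2 (Prod.ext rfl (expWeightL2_neg β z.snd))

/-- The isomorphism `(x, f) ↦ (x, e^{β·} f)` of the delay space. -/
noncomputable def expWeightEquiv (X : Type*) [NormedAddCommGroup X] [InnerProductSpace ℂ X]
    (β : ℝ) : DelaySpace X ≃L[ℂ] DelaySpace X :=
  .equivOfInverse (expWeight X β) (expWeight X (-β))
    (fun z => by simpa using expWeight_neg (-β) z) (expWeight_neg β)

/-- An exponential weight turns the delay operator matrix of `(A, Φ)`, shifted by `-β`, into the
delay operator matrix of `(A - β, Φ e^{β·})`. -/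
theorem expWeight_mem_delayGraph {A A' : X →ₗ.[ℂ] X} {Φ Φ' : C(Icc (-1 : ℝ) 0, X) →L[ℂ] X} {β : ℝ}
    (hA : ∀ x y, (x, y) ∈ A.graph → (x, y - (β : ℂ) • x) ∈ A'.graph)
    (hΦ : ∀ F, Φ' (expWeightC X (-β) F) = Φ F) {z y : DelaySpace X}
    (h : (z, y) ∈ delayGraph A Φ) :
    (expWeight X (-β) z, expWeight X (-β) (y - (β : ℂ) • z)) ∈ delayGraph A' Φ' := by
  obtain ⟨x, F, h1, h2, h3, h4, h5⟩ := h
  dsimp only at h1 h2 h3 h4 h5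
  obtain ⟨x', hx', hAx'⟩ := (LinearPMap.mem_graph_iff _).1 (hA _ _ (LinearPMap.mem_graph A x))
  dsimp only at hx' hAx'
  have hf : IntegrableOn z.snd (Icc (-1 : ℝ) 0) := (Lp.memLp z.snd).integrable (by norm_num)
  have hg : IntegrableOn y.snd (Icc (-1 : ℝ) 0) := (Lp.memLp y.snd).integrable (by norm_num)
  refine ⟨x', expWeightC X (-β) F, h1.trans hx'.symm, ?_, ?_, ?_, ?_⟩
  · filter_upwards [coeFn_expWeightL2 (-β) z.snd, h2, ae_restrict_mem measurableSet_Icc]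
      with s e1 e2 e3
    refine e1.trans ?_
    rw [e2, IccExtend_of_mem _ _ e3, IccExtend_of_mem _ _ e3]
    rfl
  · rw [expWeightC_apply, h3, hx']
    simp
  · change y.fst - (β : ℂ) • z.fst = _
    rw [hΦ, hAx', h4, h1]
    abel
  · refine h5.exp_smul (-β) hf hg (coeFn_expWeightL2 (-β) z.snd) ?_
    filter_upwards [coeFn_expWeightL2 (-β) (y - (β : ℂ) • z).snd,
      Lp.coeFn_sub y.snd ((β : ℂ) • z.snd), Lp.coeFn_smul (β : ℂ) z.snd] with s e1 e2 e3
    refine e1.trans ?_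
    change Real.exp (-β * s) • (y.snd - (β : ℂ) • z.snd : Lp X 2 delayMeasure) s = _
    rw [e2, Pi.sub_apply, e3, Pi.smul_apply, Complex.coe_smul, neg_smul, sub_eq_add_neg]

end Weight

/-! ### Delay equations with smallness condition on a vertical line -/

section Shift

variable {X : Type*} [NormedAddCommGroup X] [NormedSpace ℂ X]

/-- The operator `A - β` with domain `D(A)`. -/
noncomputable def shiftOp (A : X →ₗ.[ℂ] X) (β : ℝ) : X →ₗ.[ℂ] X :=
  ⟨A.domain, A.toFun - (β : ℂ) • A.domain.subtype⟩

theorem mem_graph_shiftOp {A : X →ₗ.[ℂ] X} {β : ℝ} {x y : X} :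
    (x, y) ∈ (shiftOp A β).graph ↔ (x, y + (β : ℂ) • x) ∈ A.graph := by
  rw [LinearPMap.mem_graph_iff, LinearPMap.mem_graph_iff]
  constructor
  · rintro ⟨u, rfl, h⟩
    exact ⟨u, rfl, sub_eq_iff_eq_add.1 h⟩
  · rintro ⟨u, h1, h2⟩
    dsimp only at h1 h2
    subst h1
    exact ⟨u, rfl, sub_eq_iff_eq_add.2 h2⟩

theorem C0Semigroup.IsGeneratedBy.rescale {S : C0Semigroup X} {A : X →ₗ.[ℂ] X}
    (hS : S.IsGeneratedBy A) (β : ℝ) : (S.rescale (-β)).IsGeneratedBy (shiftOp A β) := by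
  intro x y
  rw [mem_graph_shiftOp, hS]
  change S.IsGenPair x _ ↔ (S.rescale (-β)).IsGenPair x y
  rw [C0Semigroup.isGenPair_rescale_iff, Complex.ofReal_neg, neg_smul, sub_neg_eq_add]

end Shift

/-- The delay symbol depends continuously on the real part, uniformly along vertical lines. -/
theorem norm_expTensor_sub_le {X : Type*} [NormedAddCommGroup X] [NormedSpace ℂ X] {α : ℝ}
    (hα : α ≤ 0) {δ : ℝ} (hδ : 0 ≤ δ) (ω : ℝ) :
    ‖expTensor X (((α - δ : ℝ) : ℂ) + Complex.I * (ω : ℂ)) -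
      expTensor X ((α : ℂ) + Complex.I * (ω : ℂ))‖ ≤ Real.exp (-α) * (Real.exp δ - 1) := by
  have h1 : 0 ≤ Real.exp δ - 1 := by linarith [Real.one_le_exp hδ]
  refine ContinuousLinearMap.opNorm_le_bound _ (by positivity) fun x => ?_
  rw [ContinuousMap.norm_le _ (by positivity)]
  intro s
  change ‖Complex.exp ((((α - δ : ℝ) : ℂ) + Complex.I * (ω : ℂ)) * ((s : ℝ) : ℂ)) • x -
    Complex.exp (((α : ℂ) + Complex.I * (ω : ℂ)) * ((s : ℝ) : ℂ)) • x‖ ≤ _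
  have e1 : Complex.exp ((((α - δ : ℝ) : ℂ) + Complex.I * (ω : ℂ)) * ((s : ℝ) : ℂ)) =
      Complex.exp (((α : ℂ) + Complex.I * (ω : ℂ)) * ((s : ℝ) : ℂ)) *
        (Real.exp (-δ * s) : ℂ) := by
    rw [Complex.ofReal_exp, ← Complex.exp_add]
    push_cast
    ring_nf
  have hs := s.2
  have h2 : 1 ≤ Real.exp (-δ * s) := Real.one_le_exp (by nlinarith [hs.2])
  rw [← sub_smul, e1, ← mul_sub_one, norm_smul, norm_mul, Complex.norm_exp, ← Complex.ofReal_one,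
    ← Complex.ofReal_sub, Complex.norm_real, Real.norm_of_nonneg (by linarith)]
  gcongr
  · simp only [Complex.mul_re, Complex.add_re, Complex.ofReal_re, Complex.I_re, Complex.I_im,
      Complex.ofReal_im, Complex.add_im, Complex.mul_im]
    nlinarith [hs.1]
  · nlinarith [hs.1]

section VerticalLine

variable {X : Type*} [NormedAddCommGroup X] [InnerProductSpace ℂ X] [CompleteSpace X]

/-- If the smallness condition holds on the line `Re z = β`, then the delay operator matrix
generates a semigroup of growth `e^{βt}`. -/
theorem exists_isGeneratedBy_delayMatrix {A : X →ₗ.[ℂ] X} {S : C0Semigroup X}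
    (hS : S.IsGeneratedBy A) {M w : ℝ} (hM : S.HasGrowth M w)
    (Φ : C(Icc (-1 : ℝ) 0, X) →L[ℂ] X) {β : ℝ} (hw : w < β) {cR cΦ : ℝ}
    (hR : ∀ ω : ℝ, ‖resolventOp A (β + Complex.I * (ω : ℂ))‖ ≤ cR)
    (hΦ : ∀ ω : ℝ, ‖Φ.comp (expTensor X (β + Complex.I * (ω : ℂ)))‖ ≤ cΦ)
    (hsmall : cR * cΦ < 1) :
    ∃ (T : C0Semigroup (DelaySpace X)) (C : ℝ),
      T.IsGeneratedBy (delayMatrix A Φ) ∧ T.HasGrowth C β := by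
  have hw' : w + -β < 0 := by linarith
  have hlap : ∀ ω, C0Semigroup.laplaceI (hM.rescale (-β)) hw' ω =
      resolventOp A (β + Complex.I * (ω : ℂ)) := fun ω => by
    have hz : w < ((β : ℂ) + Complex.I * (ω : ℂ)).re := by simpa using hw
    rw [(hS.isResolventAt_laplace hM hz).eq_resolventOp]
    ext y
    rw [C0Semigroup.laplaceI, C0Semigroup.laplace_apply, C0Semigroup.laplace_apply]
    refine setIntegral_congr_fun measurableSet_Ioi fun r hr => ?_
    rw [C0Semigroup.rescale_op, smul_apply, smul_smul, ← Complex.exp_add,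
      Real.coe_toNNReal r (le_of_lt hr)]
    push_cast
    ring_nf
  let D : StableDelay X :=
    { S := S.rescale (-β)
      M := M
      w := w + -β
      growth := hM.rescale (-β)
      w_neg := hw'
      Φ := Φ.comp (expWeightC X β)
      cR := cR
      cΦ := cΦ
      norm_resolvent_le := fun ω => by rw [hlap]; exact hR ω
      norm_symbol_le := fun ω => by
        rw [ContinuousLinearMap.comp_assoc, expWeightC_comp_expTensor]; exact hΦ ω
      small := hsmall }
  have hD := D.isGeneratedBy_delayMatrix (hS.rescale β)
  obtain ⟨C, hC⟩ := D.exists_hasGrowth_semigroup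
  have hT := (hC.conj (expWeightEquiv X β)).rescale β
  rw [zero_add] at hT
  refine ⟨_, _, fun z y => ?_, hT⟩
  change _ ↔ C0Semigroup.IsGenPair _ z y
  rw [C0Semigroup.isGenPair_rescale_iff, C0Semigroup.isGenPair_conj_iff]
  refine Iff.trans ?_ (hD _ _)
  rw [delayMatrix_graph, delayMatrix_graph]
  change _ ↔ (expWeight X (-β) z, expWeight X (-β) (y - (β : ℂ) • z)) ∈ _
  constructor
  · refine expWeight_mem_delayGraph (fun u v h => ?_) fun F => ?_
    · rwa [mem_graph_shiftOp, sub_add_cancel]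
    · exact congrArg Φ (expWeightC_neg β F)
  · intro h
    have h1 := expWeight_mem_delayGraph (A' := A) (Φ' := Φ) (β := -β) (fun u v huv => ?_)
      (fun F => ?_) h
    · rw [neg_neg, expWeight_neg, Complex.ofReal_neg, neg_smul, sub_neg_eq_add, ← map_smul,
        ← map_add, sub_add_cancel, expWeight_neg] at h1
      exact h1
    · rwa [mem_graph_shiftOp, ← sub_neg_eq_add, ← neg_smul, ← Complex.ofReal_neg] at huv
    · rw [neg_neg]; rfl

/-- The smallness condition is stable under small shifts of the line: by the resolvent identity,
`‖R(α - δ + iω, A)‖ ≤ cR / (1 - δ cR)`. -/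
theorem exists_shift_smallness {A : X →ₗ.[ℂ] X} {S : C0Semigroup X}
    (hS : S.IsGeneratedBy A) {M w : ℝ} (hM : S.HasGrowth M w)
    (Φ : C(Icc (-1 : ℝ) 0, X) →L[ℂ] X) {α : ℝ} (hw : w < α) (hα : α ≤ 0) {cR cΦ : ℝ}
    (hR : ∀ ω : ℝ, ‖resolventOp A (α + Complex.I * (ω : ℂ))‖ ≤ cR)
    (hΦ : ∀ ω : ℝ, ‖Φ.comp (expTensor X (α + Complex.I * (ω : ℂ)))‖ ≤ cΦ)
    (hsmall : cR * cΦ < 1) :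
    ∃ β cR' cΦ' : ℝ, w < β ∧ β < α ∧
      (∀ ω : ℝ, ‖resolventOp A (β + Complex.I * (ω : ℂ))‖ ≤ cR') ∧
      (∀ ω : ℝ, ‖Φ.comp (expTensor X (β + Complex.I * (ω : ℂ)))‖ ≤ cΦ') ∧ cR' * cΦ' < 1 := by
  -- The bounds on the line `Re z = α - δ` tend to those on `Re z = α` as `δ → 0`.
  have hlim : Tendsto (fun δ : ℝ => cR / (1 - δ * cR) *
      (cΦ + ‖Φ‖ * (Real.exp (-α) * (Real.exp δ - 1)))) (𝓝 0) (𝓝 (cR * cΦ)) := by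
    have : ContinuousAt (fun δ : ℝ => cR / (1 - δ * cR) *
        (cΦ + ‖Φ‖ * (Real.exp (-α) * (Real.exp δ - 1)))) 0 := by
      refine (ContinuousAt.div (by fun_prop) (by fun_prop) (by simp)).mul (by fun_prop)
    simpa [ContinuousAt] using this
  have hlim2 : Tendsto (fun δ : ℝ => δ * cR) (𝓝 0) (𝓝 0) :=
    (by fun_prop : Continuous fun δ : ℝ => δ * cR).tendsto' _ _ (by simp)
  have hev := (((hlim.eventually (gt_mem_nhds hsmall)).and
    (hlim2.eventually (gt_mem_nhds one_pos))).and
      (gt_mem_nhds (sub_pos.2 hw))).filter_mono (nhdsWithin_le_nhds (s := Ioi 0))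
  obtain ⟨δ, ⟨⟨h1, h2⟩, h3⟩, h4⟩ := (hev.and self_mem_nhdsWithin).exists
  have hδ : 0 < δ := h4
  refine ⟨α - δ, _, _, by linarith, by linarith, fun ω => ?_, fun ω => ?_, h1⟩
  · have hz : w < ((α : ℂ) + Complex.I * (ω : ℂ)).re := by simpa using hw
    have hz' : w < (((α - δ : ℝ) : ℂ) + Complex.I * (ω : ℂ)).re := by
      simp only [Complex.add_re, Complex.ofReal_re, Complex.mul_re, Complex.I_re, Complex.I_im,
        Complex.ofReal_im]
      linarith
    have r1 := hS.isResolventAt_laplace hM hz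
    have r2 := hS.isResolventAt_laplace hM hz'
    have hRω := hR ω
    rw [r1.eq_resolventOp] at hRω
    rw [r2.eq_resolventOp]
    set R := S.laplace hM hz
    set R' := S.laplace hM hz'
    have hid := r2.sub_eq r1
    have e1 : ((α : ℂ) + Complex.I * (ω : ℂ)) - (((α - δ : ℝ) : ℂ) + Complex.I * (ω : ℂ)) =
        (δ : ℂ) := by push_cast; ring
    rw [e1] at hid
    have n1 : ‖R' - R‖ ≤ δ * (‖R'‖ * cR) := by
      rw [hid, norm_smul, Complex.norm_real, Real.norm_of_nonneg hδ.le]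
      gcongr
      exact (ContinuousLinearMap.opNorm_comp_le _ _).trans (by gcongr)
    have n2 := norm_le_norm_add_norm_sub' R' R
    rw [le_div_iff₀ (by linarith)]
    linarith
  · have e1 : Φ.comp (expTensor X (((α - δ : ℝ) : ℂ) + Complex.I * (ω : ℂ))) =
        Φ.comp (expTensor X (α + Complex.I * (ω : ℂ))) +
          Φ.comp (expTensor X (((α - δ : ℝ) : ℂ) + Complex.I * (ω : ℂ)) -
            expTensor X (α + Complex.I * (ω : ℂ))) := by
      rw [ContinuousLinearMap.comp_sub, add_sub_cancel]
    rw [e1]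
    refine (norm_add_le _ _).trans (add_le_add (hΦ ω) ?_)
    refine (ContinuousLinearMap.opNorm_comp_le _ _).trans ?_
    gcongr
    exact norm_expTensor_sub_le hα hδ.le ω

end VerticalLine

end DelayEq

theorem corollary4p4 {X : Type*} [NormedAddCommGroup X] [InnerProductSpace ℂ X] [CompleteSpace X]
    (A : X →ₗ.[ℂ] X) (S : DelayEq.C0Semigroup X) (hS : S.IsGeneratedBy A)
    (η : ℝ → X →L[ℂ] X) (hη : BoundedVariationOn η (Icc (-1 : ℝ) 0))
    (α : ℝ) (hSα : S.growthBound < (α : EReal)) (hα : α ≤ 0)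
    (hsmall : (⨆ ω : ℝ, ‖(DelayEq.stieltjesOp η hη).comp
          (DelayEq.expTensor X ((α : ℂ) + Complex.I * (ω : ℂ)))‖ₑ) <
        (⨆ ω : ℝ, ‖DelayEq.resolventOp A ((α : ℂ) + Complex.I * (ω : ℂ))‖ₑ)⁻¹) :
    (∃ T : DelayEq.C0Semigroup (DelayEq.DelaySpace X),
        T.IsGeneratedBy (DelayEq.delayMatrix A (DelayEq.stieltjesOp η hη))) ∧
      ∀ T : DelayEq.C0Semigroup (DelayEq.DelaySpace X),
        T.IsGeneratedBy (DelayEq.delayMatrix A (DelayEq.stieltjesOp η hη)) →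
          T.growthBound < (α : EReal) ∧ T.UniformlyExponentiallyStable := by
  set a := ⨆ ω : ℝ, ‖(DelayEq.stieltjesOp η hη).comp
    (DelayEq.expTensor X ((α : ℂ) + Complex.I * (ω : ℂ)))‖ₑ with ha
  set b := ⨆ ω : ℝ, ‖DelayEq.resolventOp A ((α : ℂ) + Complex.I * (ω : ℂ))‖ₑ with hb
  have ha_top : a ≠ ⊤ := hsmall.ne_top
  have hb_top : b ≠ ⊤ := fun h => by simp [h] at hsmall
  -- Both suprema are finite, so the inequality can be read in the reals, also if `b = 0`.
  have hab : b.toReal * a.toReal < 1 := by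
    rw [← one_div] at hsmall
    have h1 := ENNReal.mul_lt_of_lt_div hsmall
    rw [mul_comm, ← ENNReal.toReal_mul, ← ENNReal.toReal_one]
    exact (ENNReal.toReal_lt_toReal h1.ne_top ENNReal.one_ne_top).2 h1
  have hΦ : ∀ ω : ℝ, ‖(DelayEq.stieltjesOp η hη).comp
      (DelayEq.expTensor X ((α : ℂ) + Complex.I * (ω : ℂ)))‖ ≤ a.toReal := fun ω => by
    rw [← toReal_enorm]
    exact ENNReal.toReal_mono ha_top (le_iSup (fun ω : ℝ => ‖(DelayEq.stieltjesOp η hη).comp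
      (DelayEq.expTensor X ((α : ℂ) + Complex.I * (ω : ℂ)))‖ₑ) ω)
  have hR : ∀ ω : ℝ, ‖DelayEq.resolventOp A ((α : ℂ) + Complex.I * (ω : ℂ))‖ ≤ b.toReal :=
    fun ω => by
      rw [← toReal_enorm]
      exact ENNReal.toReal_mono hb_top
        (le_iSup (fun ω : ℝ => ‖DelayEq.resolventOp A ((α : ℂ) + Complex.I * (ω : ℂ))‖ₑ) ω)
  obtain ⟨w, hw, M, hM⟩ := DelayEq.C0Semigroup.exists_hasGrowth hSα
  obtain ⟨β, cR, cΦ, hwβ, hβα, hR', hΦ', hsmall'⟩ :=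
    DelayEq.exists_shift_smallness hS hM (DelayEq.stieltjesOp η hη) hw hα hR hΦ hab
  obtain ⟨T₀, C, hT₀, hC⟩ :=
    DelayEq.exists_isGeneratedBy_delayMatrix hS hM _ hwβ hR' hΦ' hsmall'
  refine ⟨⟨T₀, hT₀⟩, fun T hT => ?_⟩
  rw [hC.ext fun x y => (hT₀ x y).symm.trans (hT x y)]
  have hlt : T₀.growthBound < (α : EReal) :=
    hC.growthBound_le.trans_lt (EReal.coe_lt_coe_iff.2 hβα)
  exact ⟨hlt, hlt.trans_le (by exact_mod_cast hα)⟩
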